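/- Let $n\ge 2$, $d\ge 1$, $S^1=\mathbb R/2\pi\mathbb Z$. Let $\mathrm{Imm}(S^1,\mathbb R^d)=\{c\in C^\infty(S^1,\mathbb R^d): c'(\theta)\neq 0\ \forall\theta\}$ and $\mathcal I^n=\mathcal I^n(S^1,\mathbb R^d)=\{c\in H^n(S^1,\mathbb R^d): c'(\theta)\ne 0\ \forall\theta\}$. For a curve $c$ write $D_s=|c'|^{-1}\partial_\theta$, $\mathrm ds=|c'|\,\mathrm d\theta$, $\ell_c=\int_{S^1}\mathrm ds$, and $$\|h\|_{H^n(d\theta)}^2=\int_{S^1}|h|^2+|\partial_\theta^n h|^2\,\mathrm d\theta,\qquad \|h\|_{H^n(ds)}^2=\int_{S^1}|h|^2+|D_s^n h|^2\,\mathrm ds .$$ Let $a_0,\dots,a_n\in C^\infty((0,\infty),[0,\infty))$ with $a_0(\ell)>0$ and $a_n(\ell)>0$ for all $\ell>0$, and let $$G_c(h,k)=\sum_{j=0}^n\int_{S^1}a_j(\ell_c)\langle D_s^jh,D_s^jk\rangle\,\mathrm ds$$ be the corresponding length-weighted Sobolev metric of order $n$, on $\mathrm{Imm}(S^1,\mathbb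 R^d)$ and on $\mathcal I^n$. Assume $$(I_0)\ \ \max_{1\le k\le n}\int_0^1 r^{1/2-k}\sqrt{a_k(r)}\,\mathrm dr=\infty,\qquad (I_\infty)\ \ \max_{1\le k\le n}\int_1^\infty r^{1/2-k}\sqrt{a_k(r)}\,\mathrm dr=\infty .$$ In each of the two spaces let $B(c_0,R)$ be the set of curves whose geodesic distance to $c_0$ is less than $R$, where the geodesic distance is the infimum of $\int_0^1\sqrt{G_\gamma(\gamma_t,\gamma_t)}\,\mathrm dt$ over paths $\gamma:[0,1]\to\mathrm{Imm}(S^1,\mathbb R^d)$ that are smooth (resp. $\gamma:[0,1]\to\mathcal I^n$ that are $C^1$ with respect to the $H^n$-norm) joining the two curves, and is infinite if there is no such path. Then: 1. $G$ satisfies $(H_n)$: for every geodesic ball $B(c_0,R)$, $R>0$, in $\mathrm{Imm}(S^1,\mathbb R^d)$ there is a constant $C>0$ such that $\|h\|_{H^n(ds)}^2\le C\,G_c(h,h)$ for all $c\in B(c_0,R)$ and all $h\in H^n(S^1,\mathbb R^d)$. The same holds for every geodesic ball in $\mathcal I^n$. 2. For every geodesic ball $B(c_0,R)$, $R>0$,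 in $\mathcal I^n$ there is a constant $C>0$ such that $$C^{-1}\|h\|_{H^n(d\theta)}\le\sqrt{G_c(h,h)}\le C\,\|h\|_{H^n(d\theta)}$$ for all $c\in B(c_0,R)$ and all $h\in H^n(S^1,\mathbb R^d)$. -/

import Mathlib

open MeasureTheory Set
open scoped ENNReal ContDiff

noncomputable section

namespace SobolevCurves

/-- Euclidean space `ℝ^d`. -/
abbrev E (d : ℕ) : Type := EuclideanSpace ℝ (Fin d)

/-! ### Sobolev functions on the circle

The circle is `S¹ = ℝ / 2πℤ`; functions on it are `2π`-periodic functions on `ℝ`, and `dθ` is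
Lebesgue measure on one period. -/

/-- Membership in `H^n(S¹, ℝ^d)` for `n ≥ 1` (one-dimensional characterization, with the unique
continuous representative): `h` is of class `C^{n-1}`, its `(n-1)`-st derivative is absolutely
continuous, and the `n`-th derivative, which then exists almost everywhere and is the weak
derivative, is square integrable over a period. -/
structure MemSobolev (n : ℕ) {d : ℕ} (h : ℝ → E d) : Prop where
  periodic : Function.Periodic h (2 * Real.pi)
  contDiff : ContDiff ℝ ((n - 1 : ℕ) : ℕ∞) h
  absCont : AbsolutelyContinuousOnInterval (iteratedDeriv (n - 1) h) 0 (2 * Real.pi)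
  memLp : MemLp (iteratedDeriv n h) 2 (volume.restrict (Ioc 0 (2 * Real.pi)))

section MemSobolev

variable {n d : ℕ} {u v : ℝ → E d}

theorem MemSobolev.ae_differentiable (hu : MemSobolev n u) :
    ∀ᵐ x ∂(volume.restrict (Ioc 0 (2 * Real.pi))),
      DifferentiableAt ℝ (iteratedDeriv (n - 1) u) x := by
  have h := hu.absCont.boundedVariationOn.ae_differentiableAt_of_mem_uIcc
  rw [ae_restrict_iff' measurableSet_Ioc]
  filter_upwards [h] with x hx hx'
  apply hx
  rw [uIcc_of_le Real.two_pi_pos.le]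
  exact Ioc_subset_Icc_self hx'

theorem MemSobolev.iteratedDeriv_add (hu : MemSobolev n u) (hv : MemSobolev n v) :
    iteratedDeriv n (u + v) =ᵐ[volume.restrict (Ioc 0 (2 * Real.pi))]
      iteratedDeriv n u + iteratedDeriv n v := by
  rcases n with _ | m
  · simp
  · filter_upwards [hu.ae_differentiable, hv.ae_differentiable] with x hx hy
    have e : iteratedDeriv m (u + v) = iteratedDeriv m u + iteratedDeriv m v := by
      ext1 y
      exact _root_.iteratedDeriv_add (hu.contDiff.contDiffAt) (hv.contDiff.contDiffAt)
    simp only [iteratedDeriv_succ, Pi.add_apply]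
    rw [e]
    exact deriv_add hx hy

theorem MemSobolev.add (hu : MemSobolev n u) (hv : MemSobolev n v) : MemSobolev n (u + v) where
  periodic := hu.periodic.add hv.periodic
  contDiff := hu.contDiff.add hv.contDiff
  absCont := by
    have e : iteratedDeriv (n - 1) (u + v) = iteratedDeriv (n - 1) u + iteratedDeriv (n - 1) v := by
      ext1 y
      exact _root_.iteratedDeriv_add (hu.contDiff.contDiffAt) (hv.contDiff.contDiffAt)
    rw [e]
    exact hu.absCont.add hv.absCont
  memLp := (memLp_congr_ae (hu.iteratedDeriv_add hv)).2 (hu.memLp.add hv.memLp)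

theorem iteratedDeriv_smul_eq (m : ℕ) (r : ℝ) (u : ℝ → E d) :
    iteratedDeriv m (r • u) = r • iteratedDeriv m u := by
  ext1 x
  exact iteratedDeriv_const_smul_field r u

theorem MemSobolev.smul (r : ℝ) (hu : MemSobolev n u) : MemSobolev n (r • u) where
  periodic := hu.periodic.smul r
  contDiff := hu.contDiff.const_smul r
  absCont := by
    rw [iteratedDeriv_smul_eq]
    exact hu.absCont.const_smul r
  memLp := by
    rw [iteratedDeriv_smul_eq]
    exact hu.memLp.const_smul r

theorem MemSobolev.zero : MemSobolev n (0 : ℝ → E d) where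
  periodic := fun _ => rfl
  contDiff := contDiff_const
  absCont := by
    have e : iteratedDeriv (n - 1) (0 : ℝ → E d) = fun _ => 0 := by ext1 x; simp
    rw [e]
    exact (contDiff_const.contDiffOn (n := 1)).absolutelyContinuousOnInterval
  memLp := by
    have e : iteratedDeriv n (0 : ℝ → E d) = 0 := by ext1 x; simp
    rw [e]
    exact MemLp.zero

theorem MemSobolev.memLp_self (hu : MemSobolev n u) :
    MemLp u 2 (volume.restrict (Ioc 0 (2 * Real.pi))) := by
  have hc := hu.contDiff.continuous
  obtain ⟨C, hC⟩ := (isCompact_Icc (a := (0 : ℝ)) (b := 2 * Real.pi)).exists_bound_of_continuousOn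
    hc.continuousOn
  refine MemLp.of_bound hc.aestronglyMeasurable C ?_
  rw [ae_restrict_iff' measurableSet_Ioc]
  exact Filter.Eventually.of_forall fun x hx => hC x (Ioc_subset_Icc_self hx)

end MemSobolev

/-- `H^n(S¹, ℝ^d)` as a linear space of functions. -/
def sobolevSubmodule (n d : ℕ) : Submodule ℝ (ℝ → E d) where
  carrier := {h | MemSobolev n h}
  add_mem' := MemSobolev.add
  zero_mem' := MemSobolev.zero
  smul_mem' := fun r _ h => MemSobolev.smul r h

/-- The Hilbert space `H^n(S¹, ℝ^d)`, `n ≥ 1`. Its norm is the background norm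
`‖h‖_{H^n(dθ)}`, see `norm_sq_eq`. -/
def SobolevH (n d : ℕ) : Type := sobolevSubmodule n d

instance (n d : ℕ) : AddCommGroup (SobolevH n d) := inferInstanceAs (AddCommGroup (sobolevSubmodule n d))

instance (n d : ℕ) : Module ℝ (SobolevH n d) := inferInstanceAs (Module ℝ (sobolevSubmodule n d))

instance (n d : ℕ) : CoeFun (SobolevH n d) (fun _ => ℝ → E d) := ⟨fun h => h.1⟩

theorem integrable_inner_of_memLp {d : ℕ} {μ : Measure ℝ} {f g : ℝ → E d} (hf : MemLp f 2 μ)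
    (hg : MemLp g 2 μ) : Integrable (fun x => inner ℝ (f x) (g x)) μ := by
  refine (L2.integrable_inner (𝕜 := ℝ) (hf.toLp f) (hg.toLp g)).congr ?_
  filter_upwards [hf.coeFn_toLp, hg.coeFn_toLp] with x hx hy
  rw [hx, hy]

theorem integrable_density {n d : ℕ} (u v : SobolevH n d) :
    Integrable (fun θ => inner ℝ (u θ) (v θ) + inner ℝ (iteratedDeriv n u θ) (iteratedDeriv n v θ))
      (volume.restrict (Ioc 0 (2 * Real.pi))) :=
  (integrable_inner_of_memLp u.2.memLp_self v.2.memLp_self).add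
    (integrable_inner_of_memLp u.2.memLp v.2.memLp)

/-- The `H^n(dθ)` inner product `∫ ⟨u, v⟩ + ⟨u^{(n)}, v^{(n)}⟩ dθ`. -/
@[reducible] def sobolevCore (n d : ℕ) : InnerProductSpace.Core ℝ (SobolevH n d) where
  inner u v := ∫ θ in (0 : ℝ)..(2 * Real.pi),
    (inner ℝ (u θ) (v θ) + inner ℝ (iteratedDeriv n u θ) (iteratedDeriv n v θ))
  conj_inner_symm u v := by simp [real_inner_comm]
  re_inner_nonneg u := by
    refine intervalIntegral.integral_nonneg Real.two_pi_pos.le fun x _ => ?_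
    exact add_nonneg real_inner_self_nonneg real_inner_self_nonneg
  add_left u v w := by
    simp only [intervalIntegral.integral_of_le Real.two_pi_pos.le]
    rw [← integral_add (integrable_density u w) (integrable_density v w)]
    refine integral_congr_ae ?_
    filter_upwards [u.2.iteratedDeriv_add v.2] with x hx
    have hx' : iteratedDeriv n (u + v : SobolevH n d).1 x
      = iteratedDeriv n u.1 x + iteratedDeriv n v.1 x := hx
    have hy : (u + v : SobolevH n d).1 x = u.1 x + v.1 x := rfl
    rw [hx', hy, inner_add_left, inner_add_left]
    ring
  smul_left u v r := by
    simp only [intervalIntegral.integral_of_le Real.two_pi_pos.le]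
    rw [← integral_const_mul]
    refine integral_congr_ae (Filter.Eventually.of_forall fun x => ?_)
    have hx' : iteratedDeriv n (r • u : SobolevH n d).1 x = r • iteratedDeriv n u.1 x :=
      congrFun (iteratedDeriv_smul_eq n r u.1) x
    have hy : (r • u : SobolevH n d).1 x = r • u.1 x := rfl
    simp only [hx', hy, real_inner_smul_left, conj_trivial]
    ring
  definite u hu := by
    rw [intervalIntegral.integral_of_le Real.two_pi_pos.le, integral_eq_zero_iff_of_nonneg_ae
      (Filter.Eventually.of_forall fun x => add_nonneg real_inner_self_nonneg
        real_inner_self_nonneg) (integrable_density u u)] at hu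
    have h0 : u.1 =ᵐ[volume.restrict (Ioo 0 (2 * Real.pi))] fun _ => 0 := by
      rw [restrict_Ioo_eq_restrict_Ioc]
      filter_upwards [hu] with x hx
      have h1 : 0 ≤ inner ℝ (u.1 x) (u.1 x) := real_inner_self_nonneg
      have h2 : 0 ≤ inner ℝ (iteratedDeriv n u.1 x) (iteratedDeriv n u.1 x) :=
        real_inner_self_nonneg
      have h3 : inner ℝ (u.1 x) (u.1 x)
        + inner ℝ (iteratedDeriv n u.1 x) (iteratedDeriv n u.1 x) = 0 := hx
      exact inner_self_eq_zero.1 (le_antisymm (by linarith) h1)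
    have hc := u.2.contDiff.continuous
    have h1 : EqOn u.1 (fun _ => 0) (Ioo 0 (2 * Real.pi)) :=
      Measure.eqOn_open_of_ae_eq h0 isOpen_Ioo hc.continuousOn continuousOn_const
    have h2 : EqOn u.1 (fun _ => 0) (Icc 0 (2 * Real.pi)) := by
      rw [← closure_Ioo Real.two_pi_pos.ne]
      exact h1.closure hc continuous_const
    apply Subtype.ext
    funext x
    obtain ⟨y, hy, hxy⟩ := u.2.periodic.exists_mem_Ico₀ Real.two_pi_pos x
    exact hxy.trans (h2 (Ico_subset_Icc_self hy))

instance (n d : ℕ) : NormedAddCommGroup (SobolevH n d) :=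
  (sobolevCore n d).toNormedAddCommGroup

instance (n d : ℕ) : InnerProductSpace ℝ (SobolevH n d) :=
  InnerProductSpace.ofCore (sobolevCore n d).toCore

theorem norm_sq_eq {n d : ℕ} (h : SobolevH n d) :
    ‖h‖ ^ 2 = ∫ θ in (0 : ℝ)..(2 * Real.pi), (‖h θ‖ ^ 2 + ‖iteratedDeriv n h θ‖ ^ 2) := by
  rw [← real_inner_self_eq_norm_sq]
  simp only [← real_inner_self_eq_norm_sq]
  rfl

/-! ### Arc length calculus -/

/-- Differentiation with respect to arc length along `c`: `D_s u = u' / |c'|`. -/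
def Ds {d : ℕ} (c u : ℝ → E d) : ℝ → E d := fun θ => ‖deriv c θ‖⁻¹ • deriv u θ

/-- The length `ℓ_c = ∫ |c'| dθ`. -/
def len {d : ℕ} (c : ℝ → E d) : ℝ := ∫ θ in (0 : ℝ)..(2 * Real.pi), ‖deriv c θ‖

/-- `‖h‖²_{H^n(ds)} = ∫ |h|² + |D_s^n h|² ds`, with `ds = |c'| dθ`. -/
def normSqDs (n : ℕ) {d : ℕ} (c h : ℝ → E d) : ℝ :=
  ∫ θ in (0 : ℝ)..(2 * Real.pi), (‖h θ‖ ^ 2 + ‖((Ds c)^[n] h) θ‖ ^ 2) * ‖deriv c θ‖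

/-! ### Length-weighted Sobolev metrics -/

/-- `a_0, …, a_n` are admissible coefficients of a length-weighted Sobolev metric of order `n`:
smooth functions `(0,∞) → [0,∞)` with `a_0` and `a_n` positive. -/
structure IsLengthWeight (n : ℕ) (a : ℕ → ℝ → ℝ) : Prop where
  smooth : ∀ k ≤ n, ContDiffOn ℝ ∞ (a k) (Ioi 0)
  nonneg : ∀ k ≤ n, ∀ l, 0 < l → 0 ≤ a k l
  pos_zero : ∀ l, 0 < l → 0 < a 0 l
  pos_top : ∀ l, 0 < l → 0 < a n l

/-- The length-weighted Sobolev metric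
`G_c(h,k) = ∑_{j=0}^n ∫ a_j(ℓ_c) ⟨D_s^j h, D_s^j k⟩ ds`. -/
def G (n : ℕ) (a : ℕ → ℝ → ℝ) {d : ℕ} (c h k : ℝ → E d) : ℝ :=
  ∑ j ∈ Finset.range (n + 1), ∫ θ in (0 : ℝ)..(2 * Real.pi),
    a j (len c) * inner ℝ (((Ds c)^[j] h) θ) (((Ds c)^[j] k) θ) * ‖deriv c θ‖

/-- `∫_S r^{1/2-k} √(a_k(r)) dr ∈ [0,∞]`. -/
def weightIntegral (a : ℕ → ℝ → ℝ) (k : ℕ) (S : Set ℝ) : ℝ≥0∞ :=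
  ∫⁻ r in S, ENNReal.ofReal (r ^ ((1 : ℝ) / 2 - (k : ℝ)) * Real.sqrt (a k r))

/-- Condition `(I_0)`. -/
def CondZero (n : ℕ) (a : ℕ → ℝ → ℝ) : Prop :=
  (Finset.Icc 1 n).sup (fun k => weightIntegral a k (Ioc 0 1)) = ⊤

/-- Condition `(I_∞)`. -/
def CondInfty (n : ℕ) (a : ℕ → ℝ → ℝ) : Prop :=
  (Finset.Icc 1 n).sup (fun k => weightIntegral a k (Ici 1)) = ⊤

/-! ### Sobolev immersions and their geodesic balls -/

/-- The open subset `I^n(S¹, ℝ^d)` of `H^n(S¹, ℝ^d)`, `n ≥ 2`. -/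
def sobolevImm (n d : ℕ) : Set (SobolevH n d) := {c | ∀ θ, deriv c θ ≠ 0}

/-- `γ` restricted to `[0,1]` is a `C^1`-path in `I^n` from `c₀` to `c₁`. -/
structure IsPath {n d : ℕ} (c₀ c₁ : SobolevH n d) (γ : ℝ → SobolevH n d) : Prop where
  contDiffOn : ContDiffOn ℝ 1 γ (Icc 0 1)
  mem : ∀ t ∈ Icc (0 : ℝ) 1, γ t ∈ sobolevImm n d
  source : γ 0 = c₀
  target : γ 1 = c₁

/-- The length `∫_0^1 √(G_γ(γ_t, γ_t)) dt` of a path in `I^n`. -/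
def pathLen (n : ℕ) (a : ℕ → ℝ → ℝ) {d : ℕ} (γ : ℝ → SobolevH n d) : ℝ≥0∞ :=
  ∫⁻ t in Icc (0 : ℝ) 1, ENNReal.ofReal
    (Real.sqrt (G n a (γ t) (derivWithin γ (Icc 0 1) t : SobolevH n d)
      (derivWithin γ (Icc 0 1) t : SobolevH n d)))

/-- The geodesic distance on `I^n` (infinite between different components). -/
def geoDist (n : ℕ) (a : ℕ → ℝ → ℝ) {d : ℕ} (c₀ c₁ : SobolevH n d) : ℝ≥0∞ :=
  ⨅ (γ : ℝ → SobolevH n d) (_ : IsPath c₀ c₁ γ), pathLen n a γ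

/-- The geodesic ball `B(c₀, R)` in `I^n`. -/
def geoBall (n : ℕ) (a : ℕ → ℝ → ℝ) {d : ℕ} (c₀ : SobolevH n d) (R : ℝ) : Set (SobolevH n d) :=
  {c ∈ sobolevImm n d | geoDist n a c₀ c < ENNReal.ofReal R}

/-! ### Smooth immersions and their geodesic balls -/

/-- `Imm(S¹, ℝ^d)`. -/
def smoothImm (d : ℕ) : Set (ℝ → E d) :=
  {c | Function.Periodic c (2 * Real.pi) ∧ ContDiff ℝ ∞ c ∧ ∀ θ, deriv c θ ≠ 0}

/-- `γ` restricted to `[0,1]` is a smooth path in `Imm` from `c₀` to `c₁`: a map that is jointly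
smooth in time and parameter. -/
structure IsSmoothPath {d : ℕ} (c₀ c₁ : ℝ → E d) (γ : ℝ → ℝ → E d) : Prop where
  contDiffOn : ContDiffOn ℝ ∞ (Function.uncurry γ) (Icc 0 1 ×ˢ univ)
  mem : ∀ t ∈ Icc (0 : ℝ) 1, γ t ∈ smoothImm d
  source : γ 0 = c₀
  target : γ 1 = c₁

/-- The time derivative `γ_t` of a path in `Imm`. -/
def velocity {d : ℕ} (γ : ℝ → ℝ → E d) (t : ℝ) : ℝ → E d :=
  fun θ => derivWithin (fun s => γ s θ) (Icc 0 1) t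

/-- The length `∫_0^1 √(G_γ(γ_t, γ_t)) dt` of a path in `Imm`. -/
def smoothPathLen (n : ℕ) (a : ℕ → ℝ → ℝ) {d : ℕ} (γ : ℝ → ℝ → E d) : ℝ≥0∞ :=
  ∫⁻ t in Icc (0 : ℝ) 1, ENNReal.ofReal (Real.sqrt (G n a (γ t) (velocity γ t) (velocity γ t)))

/-- The geodesic distance on `Imm`. -/
def smoothGeoDist (n : ℕ) (a : ℕ → ℝ → ℝ) {d : ℕ} (c₀ c₁ : ℝ → E d) : ℝ≥0∞ :=
  ⨅ (γ : ℝ → ℝ → E d) (_ : IsSmoothPath c₀ c₁ γ), smoothPathLen n a γ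

/-- The geodesic ball `B(c₀, R)` in `Imm`. -/
def smoothGeoBall (n : ℕ) (a : ℕ → ℝ → ℝ) {d : ℕ} (c₀ : ℝ → E d) (R : ℝ) : Set (ℝ → E d) :=
  {c ∈ smoothImm d | smoothGeoDist n a c₀ c < ENNReal.ofReal R}

/-- Property `(H_n)` of the metric on `Imm(S¹, ℝ^d)`: on each geodesic ball of `Imm` one has
`‖h‖²_{H^n(ds)} ≤ C G_c(h,h)` with a constant that is uniform on the ball. -/
def PropertyH (n d : ℕ) (a : ℕ → ℝ → ℝ) : Prop :=
  ∀ c₀ ∈ smoothImm d, ∀ R : ℝ, 0 < R → ∃ C : ℝ, 0 < C ∧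
    ∀ c ∈ smoothGeoBall n a c₀ R, ∀ h : ℝ → E d, MemSobolev n h →
      normSqDs n c h ≤ C * G n a c h h

/-- Property `(H_n)` of the metric on the Sobolev completion `I^n(S¹, ℝ^d)`. -/
def PropertyHSobolev (n d : ℕ) (a : ℕ → ℝ → ℝ) : Prop :=
  ∀ c₀ ∈ sobolevImm n d, ∀ R : ℝ, 0 < R → ∃ C : ℝ, 0 < C ∧
    ∀ c ∈ geoBall n a c₀ R, ∀ h : SobolevH n d, normSqDs n c h ≤ C * G n a c h h

end SobolevCurves

end

/-!
The proof works on the Sobolev space `I^n`; the assertion on smooth immersions follows because a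
smooth path is a `C¹`-path in `H^n` of the same length (`IsSmoothPath.isPath_lift`,
`IsSmoothPath.pathLen_lift`), so that smooth geodesic balls lie in Sobolev ones. All bounds come
from one mechanism: along a path `γ`, a quantity `P (q γ)` with `q` a continuous seminorm on `H^n`
and `P` a differentiable function is Lipschitz for the geodesic distance as soon as
`|P' (q γ)| q (γ_t) ≤ K √(G_γ(γ_t, γ_t))` (`abs_sub_le_of_path`). For `P` the logarithm, or the
logarithm of `1 + x`, this is Grönwall's inequality. Every estimate is proved for the set `reach`
of all curves on paths of length less than `R`, which contains the ball and, with the endpoint of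
such a path, all of the path.

*Length.* Since `D_s h` integrates to zero over the circle, Poincaré's inequality and
Cauchy–Schwarz give `∫ |D_s h| ds ≤ ℓ^{k-1/2} (∫ |D_s^k h|² ds)^{1/2}`, that is,
`ℓ^{1/2-k} √(a_k(ℓ)) ∫ |h'| dθ ≤ √(G_c(h,h))` for every `1 ≤ k ≤ n`
(`IsLengthWeight.weight_mul_arcL1_le`). Applied with `q` the seminorm `∫ |h'| dθ`, whose value at a
curve is its length, and with `P` the primitive of the weight, this shows that the integral of the
weight between `ℓ_{c₀}` and `ℓ_c` is at most `R`. By `(I_0)` and `(I_∞)` the length is therefore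
bounded above and away from zero (`exists_len_bounds`). Hence `a_0(ℓ_c)` and `a_n(ℓ_c)` are bounded
below, which is `(H_n)` (`exists_energy_bounds`, `propertyHSobolev`).

*Lower derivatives.* The same Poincaré argument bounds `|D_s^j h|` pointwise by `√(G_c(h,h))` for
`1 ≤ j < n` (`exists_norm_iterate_le`). As `|h'| = |D_s h| |c'|`, the mechanism for
`q(h) = |h'(θ)|` bounds `|c'|` and `|c'|⁻¹` (`exists_speed_bounds`). The derivatives `c^{(k)}` with
`k < n` are bounded pointwise by induction on `k`: the `k`-th derivative of `h` is a combination of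
the `D_s^j h` in which `c^{(k)}` appears linearly and the other coefficients are already bounded
(`exists_jet_deriv_le`, `exists_jetBound`).

*Top order.* The function `h^{(n)}` is only square integrable, and the same estimate holds almost
everywhere. There `c^{(n)}` multiplies only derivatives of `h` of order less than `n`, which are
bounded in the supremum norm, so that `‖h‖ ≤ K √(G_c(h,h)) (1 + ‖c‖)` with the `H^n(dθ)` norms
(`exists_norm_le_mul_one_add`). The mechanism for `q` the norm bounds `‖c‖` on the ball, and the
two sides of the norm equivalence follow (`exists_norm_le_sqrt_G`, `exists_sqrt_G_le_norm`).
-/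

namespace SobolevCurves

/-! ### Sobolev classes on a period, by recursion on the order -/

section Regularity

variable {V W Z : Type*} [NormedAddCommGroup V] [NormedSpace ℝ V]
  [NormedAddCommGroup W] [NormedSpace ℝ W] [NormedAddCommGroup Z] [NormedSpace ℝ Z]

/-- Lebesgue measure `dθ` on one period. -/
noncomputable abbrev circ : Measure ℝ := volume.restrict (Ioc 0 (2 * Real.pi))

/-- A function whose increments are controlled by those of two absolutely continuous functions is
absolutely continuous. -/
theorem absolutelyContinuousOnInterval_of_dist_le {X Y T : Type*} [PseudoMetricSpace X]
    [PseudoMetricSpace Y] [PseudoMetricSpace T] {f : ℝ → X} {u : ℝ → Y} {w : ℝ → T} {a b : ℝ}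
    (hf : AbsolutelyContinuousOnInterval f a b) (hu : AbsolutelyContinuousOnInterval u a b)
    (K : ℝ) (h : ∀ x ∈ uIcc a b, ∀ y ∈ uIcc a b,
      dist (w x) (w y) ≤ K * dist (f x) (f y) + K * dist (u x) (u y)) :
    AbsolutelyContinuousOnInterval w a b := by
  unfold AbsolutelyContinuousOnInterval at hf hu
  apply squeeze_zero' ?_ ?_ (by simpa using (hf.const_mul K).add (hu.const_mul K))
  · exact Filter.Eventually.of_forall <| fun _ ↦ Finset.sum_nonneg (fun i hi ↦ dist_nonneg)
  rw [Filter.eventually_inf_principal]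
  filter_upwards with (n, I) hnI
  simp only [Finset.mul_sum, ← Finset.sum_add_distrib]
  refine Finset.sum_le_sum fun i hi => ?_
  simp only [AbsolutelyContinuousOnInterval.disjWithin, mem_ofPred_eq] at hnI
  exact h _ (hnI.left i hi |>.left) _ (hnI.left i hi |>.right)

/-- A bilinear image of absolutely continuous functions is absolutely continuous. -/
theorem absolutelyContinuousOnInterval_bilin (B : V →L[ℝ] W →L[ℝ] Z) {f : ℝ → V} {u : ℝ → W}
    {a b : ℝ} (hf : AbsolutelyContinuousOnInterval f a b)
    (hu : AbsolutelyContinuousOnInterval u a b) :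
    AbsolutelyContinuousOnInterval (fun x => B (f x) (u x)) a b := by
  obtain ⟨C, hC⟩ := hf.exists_bound
  obtain ⟨D, hD⟩ := hu.exists_bound
  refine absolutelyContinuousOnInterval_of_dist_le hf hu (‖B‖ * max C D) fun x hx y hy => ?_
  have e : B (f x) (u x) - B (f y) (u y) = B (f x - f y) (u x) + B (f y) (u x - u y) := by
    simp only [map_sub, sub_apply]; abel
  rw [dist_eq_norm, dist_eq_norm, dist_eq_norm, e]
  have h1 := B.le_opNorm₂ (f x - f y) (u x)
  have h2 := B.le_opNorm₂ (f y) (u x - u y)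
  have h3 : ‖B‖ * ‖f x - f y‖ * ‖u x‖ ≤ ‖B‖ * ‖f x - f y‖ * max C D := by
    gcongr; exact (hD x hx).trans (le_max_right _ _)
  have h4 : ‖B‖ * ‖f y‖ * ‖u x - u y‖ ≤ ‖B‖ * max C D * ‖u x - u y‖ := by
    gcongr; exact (hC y hy).trans (le_max_left _ _)
  refine (norm_add_le _ _).trans ?_
  linarith

/-- Functions of Sobolev class `H^m` on one period, by recursion on `m`: square integrable for
`m = 0`, and absolutely continuous with derivative of class `H^{m-1}` for `m ≥ 1`. For `m ≥ 2`
differentiability is required at every point, so that the pointwise derivative is the continuous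
one. Periodicity is not part of the definition. -/
def MemHs : ℕ → (ℝ → V) → Prop
  | 0, u => MemLp u 2 circ
  | m + 1, u => (Continuous u ∧ AbsolutelyContinuousOnInterval u 0 (2 * Real.pi) ∧
      (0 < m → Differentiable ℝ u)) ∧ MemHs m (deriv u)

theorem memLp_of_continuous {V : Type*} [NormedAddCommGroup V] {u : ℝ → V}
    (hc : Continuous u) : MemLp u 2 circ := by
  obtain ⟨C, hC⟩ := (isCompact_Icc (a := (0 : ℝ)) (b := 2 * Real.pi)).exists_bound_of_continuousOn
    hc.continuousOn
  refine MemLp.of_bound hc.aestronglyMeasurable C ?_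
  rw [ae_restrict_iff' measurableSet_Ioc]
  exact Filter.Eventually.of_forall fun x hx => hC x (Ioc_subset_Icc_self hx)

theorem MemHs.continuous {m : ℕ} {u : ℝ → V} (h : MemHs (m + 1) u) : Continuous u := h.1.1

theorem MemHs.absCont {m : ℕ} {u : ℝ → V} (h : MemHs (m + 1) u) :
    AbsolutelyContinuousOnInterval u 0 (2 * Real.pi) := h.1.2.1

theorem MemHs.differentiable {m : ℕ} {u : ℝ → V} (h : MemHs (m + 2) u) : Differentiable ℝ u :=
  h.1.2.2 (Nat.succ_pos m)

theorem MemHs.deriv {m : ℕ} {u : ℝ → V} (h : MemHs (m + 1) u) : MemHs m (deriv u) := h.2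

theorem MemHs.of_succ {m : ℕ} {u : ℝ → V} (h : MemHs (m + 1) u) : MemHs m u := by
  induction m generalizing u with
  | zero => exact memLp_of_continuous h.continuous
  | succ k ih => exact ⟨⟨h.continuous, h.absCont, fun _ => h.differentiable⟩, ih h.deriv⟩

theorem MemHs.mono {m k : ℕ} (hk : k ≤ m) {u : ℝ → V} (h : MemHs m u) : MemHs k u := by
  induction hk with
  | refl => exact h
  | step _ ih => exact ih h.of_succ

theorem MemHs.memLp {m : ℕ} {u : ℝ → V} (h : MemHs m u) : MemLp u 2 circ :=
  h.mono (Nat.zero_le m)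

theorem memHs_const (m : ℕ) (v : V) : MemHs m (fun _ : ℝ => v) := by
  induction m generalizing v with
  | zero => exact memLp_of_continuous continuous_const
  | succ k ih =>
    refine ⟨⟨continuous_const, ?_, fun _ => differentiable_const _⟩, ?_⟩
    · exact (contDiff_const.contDiffOn (n := 1)).absolutelyContinuousOnInterval
    · rw [deriv_const']
      exact ih 0

theorem ae_differentiableAt_of_absCont [FiniteDimensional ℝ V] {u : ℝ → V}
    (h : AbsolutelyContinuousOnInterval u 0 (2 * Real.pi)) :
    ∀ᵐ x ∂circ, DifferentiableAt ℝ u x := by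
  rw [ae_restrict_iff' measurableSet_Ioc]
  filter_upwards [h.boundedVariationOn.ae_differentiableAt_of_mem_uIcc] with x hx hx'
  apply hx
  rw [uIcc_of_le Real.two_pi_pos.le]
  exact Ioc_subset_Icc_self hx'

theorem MemHs.ae_differentiableAt [FiniteDimensional ℝ V] {m : ℕ} {u : ℝ → V}
    (h : MemHs (m + 1) u) : ∀ᵐ x ∂circ, DifferentiableAt ℝ u x :=
  ae_differentiableAt_of_absCont h.absCont

theorem MemHs.congr_ae_deriv {m : ℕ} {u v : ℝ → V} (hu : MemHs m u)
    (h : (0 < m → v = u)) (h' : v =ᵐ[circ] u) : MemHs m v := by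
  rcases m with _ | m
  · exact (memLp_congr_ae h').2 hu
  · rw [h (Nat.succ_pos m)]; exact hu

theorem memLp_bilin_left (B : V →L[ℝ] W →L[ℝ] Z) {f : ℝ → V} {u : ℝ → W} (hf : Continuous f)
    (hu : MemLp u 2 circ) : MemLp (fun x => B (f x) (u x)) 2 circ := by
  obtain ⟨C, hC⟩ := (isCompact_Icc (a := (0 : ℝ)) (b := 2 * Real.pi)).exists_bound_of_continuousOn
    hf.continuousOn
  refine hu.of_le_mul (c := ‖B‖ * C)
    (B.aestronglyMeasurable_comp₂ hf.aestronglyMeasurable hu.aestronglyMeasurable) ?_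
  rw [ae_restrict_iff' measurableSet_Ioc]
  refine Filter.Eventually.of_forall fun x hx => (B.le_opNorm₂ _ _).trans ?_
  gcongr
  exact hC x (Ioc_subset_Icc_self hx)

theorem memLp_bilin_right (B : V →L[ℝ] W →L[ℝ] Z) {f : ℝ → V} {u : ℝ → W}
    (hf : MemLp f 2 circ) (hu : Continuous u) : MemLp (fun x => B (f x) (u x)) 2 circ :=
  memLp_bilin_left B.flip hu hf

theorem deriv_bilin (B : V →L[ℝ] W →L[ℝ] Z) {f : ℝ → V} {u : ℝ → W} {x : ℝ}
    (hf : DifferentiableAt ℝ f x) (hu : DifferentiableAt ℝ u x) :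
    deriv (fun y => B (f y) (u y)) x = B (f x) (deriv u x) + B (deriv f x) (u x) :=
  (B.hasDerivAt_of_bilinear (fun _ => hf.hasDerivAt) (fun _ => hu.hasDerivAt)).deriv

theorem differentiableAt_bilin (B : V →L[ℝ] W →L[ℝ] Z) {f : ℝ → V} {u : ℝ → W} {x : ℝ}
    (hf : DifferentiableAt ℝ f x) (hu : DifferentiableAt ℝ u x) :
    DifferentiableAt ℝ (fun y => B (f y) (u y)) x :=
  (B.hasDerivAt_of_bilinear (fun _ => hf.hasDerivAt) (fun _ => hu.hasDerivAt)).differentiableAt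

variable [FiniteDimensional ℝ V]

theorem MemHs.add {m : ℕ} {u v : ℝ → V} (hu : MemHs m u) (hv : MemHs m v) :
    MemHs m (fun x => u x + v x) := by
  induction m generalizing u v with
  | zero => exact MemLp.add hu hv
  | succ k ih =>
    refine ⟨⟨hu.continuous.add hv.continuous, hu.absCont.add hv.absCont,
      fun hk => (hu.1.2.2 hk).add (hv.1.2.2 hk)⟩, ?_⟩
    refine (ih hu.deriv hv.deriv).congr_ae_deriv (fun hk => ?_) ?_
    · funext x
      exact deriv_fun_add (hu.1.2.2 hk x) (hv.1.2.2 hk x)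
    · filter_upwards [hu.ae_differentiableAt, hv.ae_differentiableAt] with x h1 h2
      exact deriv_fun_add h1 h2

variable [FiniteDimensional ℝ W] [FiniteDimensional ℝ Z]

/-- `H^{m+1}` is closed under bilinear products. -/
theorem MemHs.bilin
    (B : V →L[ℝ] W →L[ℝ] Z) {m : ℕ} {f : ℝ → V} {u : ℝ → W}
    (hf : MemHs (m + 1) f) (hu : MemHs (m + 1) u) : MemHs (m + 1) (fun x => B (f x) (u x)) := by
  induction m generalizing f u with
  | zero =>
    refine ⟨⟨(B.continuous.comp hf.continuous).clm_apply hu.continuous,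
      absolutelyContinuousOnInterval_bilin B hf.absCont hu.absCont, fun h => absurd h (by simp)⟩,
      ?_⟩
    have h : MemHs 0 (fun x => B (f x) (_root_.deriv u x) + B (_root_.deriv f x) (u x)) :=
      MemHs.add (m := 0) (memLp_bilin_left B hf.continuous hu.deriv)
        (memLp_bilin_right B hf.deriv hu.continuous)
    refine h.congr_ae_deriv (fun h => absurd h (by simp)) ?_
    filter_upwards [hf.ae_differentiableAt, hu.ae_differentiableAt] with x h1 h2
    exact deriv_bilin B h1 h2
  | succ k ih =>
    refine ⟨⟨(B.continuous.comp hf.continuous).clm_apply hu.continuous,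
      absolutelyContinuousOnInterval_bilin B hf.absCont hu.absCont,
      fun _ x => differentiableAt_bilin B (hf.differentiable x) (hu.differentiable x)⟩, ?_⟩
    have e : _root_.deriv (fun x => B (f x) (u x)) =
        fun x => B (f x) (_root_.deriv u x) + B (_root_.deriv f x) (u x) :=
      funext fun x => deriv_bilin B (hf.differentiable x) (hu.differentiable x)
    rw [e]
    exact (ih hf.of_succ hu.deriv).add (ih hf.deriv hu.of_succ)

/-- Multiplication by a continuous function of class `H^m` preserves `H^m`. -/
theorem MemHs.bilin_left (B : V →L[ℝ] W →L[ℝ] Z) {m : ℕ} {f : ℝ → V} {u : ℝ → W}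
    (hc : Continuous f) (hf : MemHs m f) (hu : MemHs m u) :
    MemHs m (fun x => B (f x) (u x)) := by
  rcases m with _ | m
  · exact memLp_bilin_left B hc hu
  · exact hf.bilin B hu

theorem MemHs.smul {m : ℕ} {f : ℝ → ℝ} {u : ℝ → V} (hc : Continuous f)
    (hf : MemHs m f) (hu : MemHs m u) : MemHs m (fun x => f x • u x) :=
  MemHs.bilin_left (ContinuousLinearMap.lsmul ℝ ℝ) hc hf hu

end Regularity

section Inverse

variable {V : Type*} [NormedAddCommGroup V] [InnerProductSpace ℝ V]

theorem deriv_norm_inv {b : ℝ → V} {x : ℝ} (hb : DifferentiableAt ℝ b x) (h0 : b x ≠ 0) :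
    HasDerivAt (fun y => ‖b y‖⁻¹) (-(‖b x‖⁻¹ ^ 3 * inner ℝ (b x) (deriv b x))) x := by
  have h1 : HasDerivAt (fun y => ‖b y‖ ^ 2) (2 * inner ℝ (b x) (deriv b x)) x :=
    hb.hasDerivAt.norm_sq
  have h2 : ‖b x‖ ≠ 0 := norm_ne_zero_iff.2 h0
  have h3 := (h1.sqrt (pow_ne_zero 2 h2))
  simp only [Real.sqrt_sq (norm_nonneg _)] at h3
  refine (h3.inv h2).congr_deriv ?_
  field_simp

theorem absCont_norm_inv {V : Type*} [NormedAddCommGroup V] {b : ℝ → V} {x y : ℝ}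
    (hb : AbsolutelyContinuousOnInterval b x y) (hc : Continuous b) (h0 : ∀ θ, b θ ≠ 0) :
    AbsolutelyContinuousOnInterval (fun θ => ‖b θ‖⁻¹) x y := by
  obtain ⟨C, hC⟩ := (isCompact_uIcc (a := x) (b := y)).exists_bound_of_continuousOn
    (f := fun θ => ‖b θ‖⁻¹) (hc.norm.inv₀ fun θ => norm_ne_zero_iff.2 (h0 θ)).continuousOn
  refine absolutelyContinuousOnInterval_of_dist_le hb hb (C ^ 2) fun s hs t ht => ?_
  have hs0 : 0 < ‖b s‖ := norm_pos_iff.2 (h0 s)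
  have ht0 : 0 < ‖b t‖ := norm_pos_iff.2 (h0 t)
  have h1 := hC s hs
  have h2 := hC t ht
  rw [Real.norm_of_nonneg (by positivity)] at h1 h2
  have hC0 : 0 ≤ C := le_trans (by positivity) h1
  have e : ‖b s‖⁻¹ - ‖b t‖⁻¹ = ‖b s‖⁻¹ * ‖b t‖⁻¹ * (‖b t‖ - ‖b s‖) := by field_simp
  have h3 : |‖b t‖ - ‖b s‖| ≤ ‖b s - b t‖ := by
    rw [abs_sub_comm]; exact abs_norm_sub_norm_le _ _
  rw [dist_eq_norm, dist_eq_norm, e, norm_mul, Real.norm_of_nonneg (by positivity),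
    Real.norm_eq_abs]
  have h4 : ‖b s‖⁻¹ * ‖b t‖⁻¹ ≤ C ^ 2 := by
    rw [sq]; exact mul_le_mul h1 h2 (by positivity) hC0
  calc _ ≤ C ^ 2 * ‖b s - b t‖ := mul_le_mul h4 h3 (abs_nonneg _) (by positivity)
    _ ≤ _ := by
      have : 0 ≤ C ^ 2 * ‖b s - b t‖ := by positivity
      linarith

variable [FiniteDimensional ℝ V]

/-- If `b` is nowhere zero and of class `H^{m+1}`, so is `|b|⁻¹`: its derivative
`-|b|⁻³⟨b, b'⟩` is a product of functions already known to be of class `H^m`. -/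
theorem MemHs.norm_inv {m : ℕ} {b : ℝ → V} (hb : MemHs (m + 1) b) (h0 : ∀ θ, b θ ≠ 0) :
    MemHs (m + 1) (fun θ => ‖b θ‖⁻¹) := by
  have hcp : Continuous (fun θ => ‖b θ‖⁻¹) :=
    hb.continuous.norm.inv₀ fun θ => norm_ne_zero_iff.2 (h0 θ)
  have key : ∀ {k : ℕ}, MemHs k (fun θ => ‖b θ‖⁻¹) → MemHs k b → MemHs k (_root_.deriv b) →
      MemHs k (fun θ => -(‖b θ‖⁻¹ ^ 3 * inner ℝ (b θ) (_root_.deriv b θ))) := by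
    intro k hp hbk hb'
    have h1 : MemHs k (fun θ => inner ℝ (b θ) (_root_.deriv b θ)) :=
      MemHs.bilin_left (innerSL ℝ) hb.continuous hbk hb'
    have h2 := MemHs.smul continuous_const (memHs_const k (-1 : ℝ))
      (MemHs.smul hcp hp (MemHs.smul hcp hp (MemHs.smul hcp hp h1)))
    refine h2.congr_ae_deriv (fun _ => ?_) (Filter.Eventually.of_forall fun θ => ?_)
    · funext θ; simp only [smul_eq_mul]; ring
    · simp only [smul_eq_mul]; ring
  induction m with
  | zero =>
    refine ⟨⟨hcp, absCont_norm_inv hb.absCont hb.continuous h0, fun h => absurd h (by simp)⟩, ?_⟩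
    refine (key (k := 0) (memLp_of_continuous hcp) hb.memLp hb.deriv).congr_ae_deriv
      (fun h => absurd h (by simp)) ?_
    filter_upwards [hb.ae_differentiableAt] with θ hθ
    exact (deriv_norm_inv hθ (h0 θ)).deriv
  | succ k ih =>
    refine ⟨⟨hcp, absCont_norm_inv hb.absCont hb.continuous h0,
      fun _ θ => (deriv_norm_inv (hb.differentiable θ) (h0 θ)).differentiableAt⟩, ?_⟩
    have e : _root_.deriv (fun θ => ‖b θ‖⁻¹) =
        fun θ => -(‖b θ‖⁻¹ ^ 3 * inner ℝ (b θ) (_root_.deriv b θ)) :=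
      funext fun θ => (deriv_norm_inv (hb.differentiable θ) (h0 θ)).deriv
    rw [e]
    exact key (ih hb.of_succ) hb.of_succ hb.deriv

end Inverse

section Comparison

variable {n d : ℕ} {h : ℝ → E d}

theorem memHs_of_contDiff {V : Type*} [NormedAddCommGroup V] [NormedSpace ℝ V] {m : ℕ} {u : ℝ → V}
    (h1 : ContDiff ℝ (m : ℕ∞) u)
    (h2 : AbsolutelyContinuousOnInterval (iteratedDeriv m u) 0 (2 * Real.pi))
    (h3 : MemLp (iteratedDeriv (m + 1) u) 2 circ) : MemHs (m + 1) u := by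
  induction m generalizing u with
  | zero =>
    refine ⟨⟨h1.continuous, by simpa using h2, fun h => absurd h (by simp)⟩, ?_⟩
    simpa [MemHs, iteratedDeriv_one] using h3
  | succ k ih =>
    have h1' : ContDiff ℝ ((k : ℕ∞) + 1) u := by exact_mod_cast h1
    have hd := contDiff_succ_iff_deriv.1 h1'
    refine ⟨⟨h1.continuous, ?_, fun _ => hd.1⟩, ih (by exact_mod_cast hd.2.2) ?_ ?_⟩
    · exact ((h1.of_le (by exact_mod_cast Nat.le_add_left 1 k)).contDiffOn
        (n := 1)).absolutelyContinuousOnInterval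
    · rwa [← iteratedDeriv_succ']
    · rwa [← iteratedDeriv_succ']

/-- The class `MemSobolev` of the statement is contained in the recursive class `MemHs`. -/
theorem MemSobolev.memHs (hn : 1 ≤ n) (hh : MemSobolev n h) : MemHs n h := by
  obtain ⟨m, rfl⟩ : ∃ m, n = m + 1 := ⟨n - 1, by omega⟩
  exact memHs_of_contDiff hh.contDiff hh.absCont hh.memLp

end Comparison

/-! ### Pointwise estimates for jets -/

section Jets

variable {V W Z : Type*} [NormedAddCommGroup V] [NormedSpace ℝ V]
  [NormedAddCommGroup W] [NormedSpace ℝ W] [NormedAddCommGroup Z] [NormedSpace ℝ Z]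

/-- Differentiation with respect to the parameter `s` with `ds = p⁻¹ dθ`. For `p = |c'|⁻¹` this is
`D_s`, for `p = 1` it is `∂_θ`. -/
noncomputable def arcDeriv (p : ℝ → ℝ) (u : ℝ → V) : ℝ → V := fun θ => p θ • deriv u θ

/-- `u` has derivatives up to order `m` at `θ`, and those of order at most `m - 1` exist on the
whole line. Functions of class `H^m` have this property at almost every `θ`. -/
def DiffUpTo (θ : ℝ) : ℕ → (ℝ → V) → Prop
  | 0, _ => True
  | m + 1, u => ((0 < m → Differentiable ℝ u) ∧ DifferentiableAt ℝ u θ) ∧ DiffUpTo θ m (deriv u)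

/-- The size `∑_{i ≤ m} |u^{(i)}(θ)|` of the `m`-jet of `u` at `θ`. -/
noncomputable def jet (θ : ℝ) : ℕ → (ℝ → V) → ℝ
  | 0, u => ‖u θ‖
  | m + 1, u => ‖u θ‖ + jet θ m (deriv u)

/-- The size `∑_{i ≤ m} |D^i u(θ)|` of the `m`-jet of `u` at `θ` with respect to
`D = arcDeriv p`. -/
noncomputable def arcJet (p : ℝ → ℝ) (θ : ℝ) : ℕ → (ℝ → V) → ℝ
  | 0, u => ‖u θ‖
  | m + 1, u => ‖u θ‖ + arcJet p θ m (arcDeriv p u)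

variable {θ : ℝ} {m : ℕ} {u v : ℝ → V} {p : ℝ → ℝ}

theorem jet_nonneg : 0 ≤ jet θ m u := by
  induction m generalizing u with
  | zero => exact norm_nonneg _
  | succ k ih => exact add_nonneg (norm_nonneg _) ih

theorem arcJet_nonneg : 0 ≤ arcJet p θ m u := by
  induction m generalizing u with
  | zero => exact norm_nonneg _
  | succ k ih => exact add_nonneg (norm_nonneg _) ih

theorem norm_le_jet : ‖u θ‖ ≤ jet θ m u := by
  rcases m with _ | m
  · exact le_rfl
  · exact le_add_of_nonneg_right jet_nonneg

theorem jet_deriv_le : jet θ m (deriv u) ≤ jet θ (m + 1) u :=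
  le_add_of_nonneg_left (norm_nonneg _)

theorem jet_succ_eq : jet θ (m + 1) u = jet θ m u + ‖iteratedDeriv (m + 1) u θ‖ := by
  induction m generalizing u with
  | zero => simp [jet, iteratedDeriv_one]
  | succ k ih =>
    rw [jet, ih, ← iteratedDeriv_succ', ← add_assoc]
    rfl

theorem jet_le_succ : jet θ m u ≤ jet θ (m + 1) u := by
  rw [jet_succ_eq]; exact le_add_of_nonneg_right (norm_nonneg _)

theorem arcJet_succ_eq :
    arcJet p θ (m + 1) u = arcJet p θ m u + ‖((arcDeriv p)^[m + 1] u) θ‖ := by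
  induction m generalizing u with
  | zero => simp [arcJet]
  | succ k ih =>
    rw [arcJet, ih, Function.iterate_succ_apply (arcDeriv p) (k + 1), ← add_assoc]
    rfl

theorem arcJet_le_succ : arcJet p θ m u ≤ arcJet p θ (m + 1) u := by
  rw [arcJet_succ_eq]; exact le_add_of_nonneg_right (norm_nonneg _)

theorem DiffUpTo.of_succ (h : DiffUpTo θ (m + 1) u) : DiffUpTo θ m u := by
  induction m generalizing u with
  | zero => trivial
  | succ k ih => exact ⟨⟨fun _ => h.1.1 (Nat.succ_pos k), h.1.2⟩, ih h.2⟩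

theorem MemHs.ae_diffUpTo [FiniteDimensional ℝ V] (h : MemHs m u) :
    ∀ᵐ θ ∂circ, DiffUpTo θ m u := by
  induction m generalizing u with
  | zero => exact Filter.Eventually.of_forall fun _ => trivial
  | succ k ih =>
    filter_upwards [h.ae_differentiableAt, ih h.deriv] with θ h1 h2
    exact ⟨⟨h.1.2.2, h1⟩, h2⟩

theorem MemHs.diffUpTo (h : MemHs (m + 1) u) : DiffUpTo θ m u := by
  induction m generalizing u with
  | zero => trivial
  | succ k ih => exact ⟨⟨fun _ => h.differentiable, h.differentiable θ⟩, ih h.deriv⟩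

/-- If `v = u` at `θ`, and everywhere when derivatives are involved, then the jets agree. -/
theorem jet_congr (h : 0 < m → v = u) (h' : v θ = u θ) : jet θ m v = jet θ m u := by
  rcases m with _ | m
  · simp [jet, h']
  · rw [h (Nat.succ_pos m)]

theorem DiffUpTo.congr (hu : DiffUpTo θ m u) (h : 0 < m → v = u) : DiffUpTo θ m v := by
  rcases m with _ | m
  · trivial
  · rwa [h (Nat.succ_pos m)]

theorem DiffUpTo.add (hu : DiffUpTo θ m u) (hv : DiffUpTo θ m v) :
    DiffUpTo θ m (fun x => u x + v x) := by
  induction m generalizing u v with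
  | zero => trivial
  | succ k ih =>
    exact ⟨⟨fun hk => (hu.1.1 hk).add (hv.1.1 hk), hu.1.2.add hv.1.2⟩,
      (ih hu.2 hv.2).congr fun hk => funext fun x => deriv_fun_add (hu.1.1 hk x) (hv.1.1 hk x)⟩

theorem jet_add_le (hu : DiffUpTo θ m u) (hv : DiffUpTo θ m v) :
    jet θ m (fun x => u x + v x) ≤ jet θ m u + jet θ m v := by
  induction m generalizing u v with
  | zero => exact norm_add_le _ _
  | succ k ih =>
    have e : jet θ k (deriv fun x => u x + v x) = jet θ k (fun x => deriv u x + deriv v x) :=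
      jet_congr (fun hk => funext fun x => deriv_fun_add (hu.1.1 hk x) (hv.1.1 hk x))
        (deriv_fun_add hu.1.2 hv.1.2)
    have h1 := ih hu.2 hv.2
    have h2 := norm_add_le (u θ) (v θ)
    simp only [jet]
    rw [e]
    linarith

theorem DiffUpTo.bilin (B : V →L[ℝ] W →L[ℝ] Z) {f : ℝ → V} {g : ℝ → W}
    (hf : DiffUpTo θ m f) (hg : DiffUpTo θ m g) : DiffUpTo θ m (fun x => B (f x) (g x)) := by
  induction m generalizing f g with
  | zero => trivial
  | succ k ih =>
    refine ⟨⟨fun hk x => differentiableAt_bilin B (hf.1.1 hk x) (hg.1.1 hk x),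
      differentiableAt_bilin B hf.1.2 hg.1.2⟩, ?_⟩
    exact ((ih hf.of_succ hg.2).add (ih hf.2 hg.of_succ)).congr fun hk => funext fun x =>
      deriv_bilin B (hf.1.1 hk x) (hg.1.1 hk x)

theorem jet_bilin_le (B : V →L[ℝ] W →L[ℝ] Z) (hB : ‖B‖ ≤ 1) {f : ℝ → V} {g : ℝ → W}
    (hf : DiffUpTo θ m f) (hg : DiffUpTo θ m g) :
    jet θ m (fun x => B (f x) (g x)) ≤ 3 ^ m * (jet θ m f * jet θ m g) := by
  have h0 : ∀ (x : V) (y : W), ‖B x y‖ ≤ ‖x‖ * ‖y‖ := fun x y =>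
    (B.le_opNorm₂ x y).trans (by
      rw [mul_assoc]; exact mul_le_of_le_one_left (by positivity) hB)
  induction m generalizing f g with
  | zero => simpa [jet] using h0 (f θ) (g θ)
  | succ k ih =>
    have e : jet θ k (deriv fun x => B (f x) (g x)) =
        jet θ k (fun x => B (f x) (deriv g x) + B (deriv f x) (g x)) :=
      jet_congr (fun hk => funext fun x => deriv_bilin B (hf.1.1 hk x) (hg.1.1 hk x))
        (deriv_bilin B hf.1.2 hg.1.2)
    have h1 := jet_add_le (hf.of_succ.bilin B hg.2) (hf.2.bilin B hg.of_succ)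
    have h2 := ih hf.of_succ hg.2
    have h3 := ih hf.2 hg.of_succ
    have h4 : ‖B (f θ) (g θ)‖ ≤ 3 ^ k * (jet θ (k + 1) f * jet θ (k + 1) g) :=
      (h0 _ _).trans ((mul_le_mul norm_le_jet norm_le_jet (norm_nonneg _) jet_nonneg).trans
        (le_mul_of_one_le_left (mul_nonneg jet_nonneg jet_nonneg) (one_le_pow₀ (by norm_num))))
    have h5 : jet θ k f * jet θ k (deriv g) ≤ jet θ (k + 1) f * jet θ (k + 1) g :=
      mul_le_mul jet_le_succ jet_deriv_le jet_nonneg jet_nonneg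
    have h6 : jet θ k (deriv f) * jet θ k g ≤ jet θ (k + 1) f * jet θ (k + 1) g :=
      mul_le_mul jet_deriv_le jet_le_succ jet_nonneg jet_nonneg
    have h7 : (0 : ℝ) < 3 ^ k := by positivity
    have h5' := mul_le_mul_of_nonneg_left h5 h7.le
    have h6' := mul_le_mul_of_nonneg_left h6 h7.le
    rw [jet, e, pow_succ]
    linarith

/-- The tame product estimate: the highest derivatives enter linearly. -/
theorem jet_succ_bilin_le (B : V →L[ℝ] W →L[ℝ] Z) (hB : ‖B‖ ≤ 1) {f : ℝ → V} {g : ℝ → W}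
    (hf : DiffUpTo θ (m + 1) f) (hg : DiffUpTo θ (m + 1) g) :
    jet θ (m + 1) (fun x => B (f x) (g x)) ≤
      3 ^ (m + 1) * (jet θ m f * jet θ (m + 1) g + jet θ (m + 1) f * jet θ m g) := by
  have h0 : ‖B (f θ) (g θ)‖ ≤ ‖f θ‖ * ‖g θ‖ :=
    (B.le_opNorm₂ _ _).trans (by
      rw [mul_assoc]; exact mul_le_of_le_one_left (by positivity) hB)
  have e : jet θ m (deriv fun x => B (f x) (g x)) =
      jet θ m (fun x => B (f x) (deriv g x) + B (deriv f x) (g x)) :=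
    jet_congr (fun hk => funext fun x => deriv_bilin B (hf.1.1 hk x) (hg.1.1 hk x))
      (deriv_bilin B hf.1.2 hg.1.2)
  have h1 := jet_add_le (hf.of_succ.bilin B hg.2) (hf.2.bilin B hg.of_succ)
  have h2 := jet_bilin_le B hB hf.of_succ hg.2
  have h3 := jet_bilin_le B hB hf.2 hg.of_succ
  have h4 : ‖B (f θ) (g θ)‖ ≤ 3 ^ m * (jet θ m f * jet θ (m + 1) g) :=
    h0.trans ((mul_le_mul norm_le_jet norm_le_jet (norm_nonneg _) jet_nonneg).trans
      (le_mul_of_one_le_left (mul_nonneg jet_nonneg jet_nonneg) (one_le_pow₀ (by norm_num))))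
  have h5 : jet θ m f * jet θ m (deriv g) ≤ jet θ m f * jet θ (m + 1) g :=
    mul_le_mul_of_nonneg_left jet_deriv_le jet_nonneg
  have h6 : jet θ m (deriv f) * jet θ m g ≤ jet θ (m + 1) f * jet θ m g :=
    mul_le_mul_of_nonneg_right jet_deriv_le jet_nonneg
  have h7 : (0 : ℝ) < 3 ^ m := by positivity
  have h5' := mul_le_mul_of_nonneg_left h5 h7.le
  have h6' := mul_le_mul_of_nonneg_left h6 h7.le
  have h8 : 0 ≤ 3 ^ m * (jet θ (m + 1) f * jet θ m g) :=
    mul_nonneg h7.le (mul_nonneg jet_nonneg jet_nonneg)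
  have h9 : 0 ≤ 3 ^ m * (jet θ m f * jet θ (m + 1) g) :=
    mul_nonneg h7.le (mul_nonneg jet_nonneg jet_nonneg)
  rw [jet, e, pow_succ]
  linarith

theorem DiffUpTo.smul {f : ℝ → ℝ} (hf : DiffUpTo θ m f) (hu : DiffUpTo θ m u) :
    DiffUpTo θ m (fun x => f x • u x) := hf.bilin (ContinuousLinearMap.lsmul ℝ ℝ) hu

theorem jet_smul_le {f : ℝ → ℝ} (hf : DiffUpTo θ m f) (hu : DiffUpTo θ m u) :
    jet θ m (fun x => f x • u x) ≤ 3 ^ m * (jet θ m f * jet θ m u) :=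
  jet_bilin_le (ContinuousLinearMap.lsmul ℝ ℝ) ContinuousLinearMap.opNorm_lsmul_le hf hu

theorem jet_succ_smul_le {f : ℝ → ℝ} (hf : DiffUpTo θ (m + 1) f) (hu : DiffUpTo θ (m + 1) u) :
    jet θ (m + 1) (fun x => f x • u x) ≤
      3 ^ (m + 1) * (jet θ m f * jet θ (m + 1) u + jet θ (m + 1) f * jet θ m u) :=
  jet_succ_bilin_le (ContinuousLinearMap.lsmul ℝ ℝ) ContinuousLinearMap.opNorm_lsmul_le hf hu

end Jets

section SpeedJets

variable {V : Type*} [NormedAddCommGroup V] [InnerProductSpace ℝ V] {θ : ℝ} {m : ℕ} {b : ℝ → V}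

theorem norm_innerSL_le_one : ‖innerSL ℝ (E := V)‖ ≤ 1 :=
  ContinuousLinearMap.opNorm_le_bound _ zero_le_one fun v => by simp

theorem jet_neg {V : Type*} [NormedAddCommGroup V] [NormedSpace ℝ V] {u : ℝ → V} :
    jet θ m (fun x => -u x) = jet θ m u := by
  induction m generalizing u with
  | zero => simp [jet]
  | succ k ih =>
    have e : deriv (fun x => -u x) = fun x => -deriv u x := funext fun x => deriv.fun_neg
    simp only [jet, norm_neg]
    rw [e, ih]

theorem DiffUpTo.neg {V : Type*} [NormedAddCommGroup V] [NormedSpace ℝ V] {u : ℝ → V}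
    (hu : DiffUpTo θ m u) : DiffUpTo θ m (fun x => -u x) := by
  induction m generalizing u with
  | zero => trivial
  | succ k ih =>
    have e : deriv (fun x => -u x) = fun x => -deriv u x := funext fun x => deriv.fun_neg
    refine ⟨⟨fun hk => (hu.1.1 hk).neg, hu.1.2.neg⟩, ?_⟩
    rw [e]
    exact ih hu.2

/-- The derivative `-|b|⁻³⟨b, b'⟩` of `|b|⁻¹` as a product. -/
theorem jet_deriv_norm_inv_le (hp : DiffUpTo θ m fun x => ‖b x‖⁻¹) (hb : DiffUpTo θ m b)
    (hb' : DiffUpTo θ m (deriv b)) :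
    DiffUpTo θ m (fun x => -(‖b x‖⁻¹ ^ 3 * inner ℝ (b x) (deriv b x))) ∧
    jet θ m (fun x => -(‖b x‖⁻¹ ^ 3 * inner ℝ (b x) (deriv b x))) ≤
      (3 ^ m) ^ 4 * jet θ m (fun x => ‖b x‖⁻¹) ^ 3 * jet θ m b * jet θ m (deriv b) := by
  have h0 : DiffUpTo θ m (fun x => inner ℝ (b x) (deriv b x)) := hb.bilin (innerSL ℝ) hb'
  have h1 := hp.smul h0
  have h2 := hp.smul h1
  have h3 := hp.smul h2
  have e : (fun x => -(‖b x‖⁻¹ ^ 3 * inner ℝ (b x) (deriv b x))) =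
      fun x => -(‖b x‖⁻¹ • ‖b x‖⁻¹ • ‖b x‖⁻¹ • inner ℝ (b x) (deriv b x)) := by
    funext x; simp only [smul_eq_mul]; ring
  rw [e, jet_neg]
  refine ⟨h3.neg, (jet_smul_le hp h2).trans ?_⟩
  have i0 : jet θ m (fun x => inner ℝ (b x) (deriv b x)) ≤
      3 ^ m * (jet θ m b * jet θ m (deriv b)) :=
    jet_bilin_le (innerSL ℝ) norm_innerSL_le_one hb hb'
  have i1 := jet_smul_le hp h0
  have i2 := jet_smul_le hp h1
  have hP : 0 ≤ jet θ m (fun x => ‖b x‖⁻¹) := jet_nonneg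
  have h3 : (0 : ℝ) ≤ 3 ^ m := by positivity
  calc _ ≤ 3 ^ m * (jet θ m (fun x => ‖b x‖⁻¹) * (3 ^ m * (jet θ m (fun x => ‖b x‖⁻¹) *
        (3 ^ m * (jet θ m (fun x => ‖b x‖⁻¹) * (3 ^ m * (jet θ m b * jet θ m (deriv b)))))))) := by
        refine mul_le_mul_of_nonneg_left (mul_le_mul_of_nonneg_left (i2.trans ?_) hP) h3
        refine mul_le_mul_of_nonneg_left (mul_le_mul_of_nonneg_left (i1.trans ?_) hP) h3
        exact mul_le_mul_of_nonneg_left (mul_le_mul_of_nonneg_left i0 hP) h3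
    _ = _ := by ring

theorem DiffUpTo.norm_inv (h0 : ∀ x, b x ≠ 0) (hb : DiffUpTo θ m b) :
    DiffUpTo θ m (fun x => ‖b x‖⁻¹) := by
  induction m with
  | zero => trivial
  | succ k ih =>
    refine ⟨⟨fun hk x => (deriv_norm_inv (hb.1.1 hk x) (h0 x)).differentiableAt,
      (deriv_norm_inv hb.1.2 (h0 θ)).differentiableAt⟩, ?_⟩
    exact (jet_deriv_norm_inv_le (ih hb.of_succ) hb.of_succ hb.2).1.congr fun hk =>
      funext fun x => (deriv_norm_inv (hb.1.1 hk x) (h0 x)).deriv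

theorem jet_succ_norm_inv_le (h0 : ∀ x, b x ≠ 0) (hb : DiffUpTo θ (m + 1) b) :
    jet θ (m + 1) (fun x => ‖b x‖⁻¹) ≤ ‖b θ‖⁻¹ +
      (3 ^ m) ^ 4 * jet θ m (fun x => ‖b x‖⁻¹) ^ 3 * jet θ m b * jet θ m (deriv b) := by
  have e : jet θ m (deriv fun x => ‖b x‖⁻¹) =
      jet θ m (fun x => -(‖b x‖⁻¹ ^ 3 * inner ℝ (b x) (deriv b x))) :=
    jet_congr (fun hk => funext fun x => (deriv_norm_inv (hb.1.1 hk x) (h0 x)).deriv)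
      (deriv_norm_inv hb.1.2 (h0 θ)).deriv
  rw [jet, e, Real.norm_of_nonneg (by positivity)]
  gcongr
  exact (jet_deriv_norm_inv_le (hb.of_succ.norm_inv h0) hb.of_succ hb.2).2

/-- The bounds on the curve that control all coefficients of order `m`: its speed vector `b = c'`
is nowhere zero, and `|b|⁻¹ ≤ M` and the `m`-jet of `b` is at most `M` at `θ`. -/
structure JetBound (θ M : ℝ) (m : ℕ) (b : ℝ → V) : Prop where
  ne_zero : ∀ x, b x ≠ 0
  inv_le : ‖b θ‖⁻¹ ≤ M
  jet_le : jet θ m b ≤ M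

theorem JetBound.of_succ {M : ℝ} (h : JetBound θ M (m + 1) b) : JetBound θ M m b :=
  ⟨h.ne_zero, h.inv_le, jet_le_succ.trans h.jet_le⟩

variable (V) in
/-- The `m`-jet of `|b|⁻¹` is bounded in terms of the `m`-jet of `b`. -/
theorem exists_jet_norm_inv_le (m : ℕ) (M : ℝ) : ∃ C, 0 ≤ C ∧ ∀ (b : ℝ → V) (θ : ℝ),
    JetBound θ M m b → DiffUpTo θ m b → jet θ m (fun x => ‖b x‖⁻¹) ≤ C := by
  induction m with
  | zero =>
    refine ⟨max M 0, le_max_right _ _, fun b θ h _ => ?_⟩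
    simp only [jet, norm_inv, norm_norm]
    exact h.inv_le.trans (le_max_left _ _)
  | succ m ih =>
    obtain ⟨C, hC0, hC⟩ := ih
    refine ⟨max M 0 + (3 ^ m) ^ 4 * C ^ 3 * max M 0 * max M 0, by positivity, fun b θ h hb => ?_⟩
    have hM : M ≤ max M 0 := le_max_left _ _
    refine (jet_succ_norm_inv_le h.ne_zero hb).trans ?_
    have h1 := hC b θ h.of_succ hb.of_succ
    have h2 := h.of_succ.jet_le.trans hM
    have h3 := (jet_deriv_le.trans h.jet_le).trans hM
    have h4 := h.inv_le.trans hM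
    have h5 : 0 ≤ jet θ m (fun x => ‖b x‖⁻¹) := jet_nonneg
    have h6 : 0 ≤ jet θ m b := jet_nonneg
    have h7 : 0 ≤ jet θ m (deriv b) := jet_nonneg
    gcongr

variable (V) in
/-- The `(m+1)`-jet of `|b|⁻¹` grows at most linearly in that of `b` once the `m`-jet is bounded. -/
theorem exists_jet_succ_norm_inv_le (m : ℕ) (M : ℝ) : ∃ C, 0 ≤ C ∧ ∀ (b : ℝ → V) (θ : ℝ),
    JetBound θ M m b → DiffUpTo θ (m + 1) b →
    jet θ (m + 1) (fun x => ‖b x‖⁻¹) ≤ C * (1 + jet θ (m + 1) b) := by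
  obtain ⟨C, hC0, hC⟩ := exists_jet_norm_inv_le V m M
  refine ⟨max M 0 + (3 ^ m) ^ 4 * C ^ 3 * max M 0, by positivity, fun b θ h hb => ?_⟩
  have hM : M ≤ max M 0 := le_max_left _ _
  refine (jet_succ_norm_inv_le h.ne_zero hb).trans ?_
  have h1 := hC b θ h hb.of_succ
  have h2 := h.jet_le.trans hM
  have h3 : jet θ m (deriv b) ≤ jet θ (m + 1) b := jet_deriv_le
  have h4 := h.inv_le.trans hM
  have h5 : 0 ≤ jet θ m (fun x => ‖b x‖⁻¹) := jet_nonneg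
  have h6 : 0 ≤ jet θ m b := jet_nonneg
  have h7 : 0 ≤ jet θ m (deriv b) := jet_nonneg
  calc _ ≤ max M 0 + (3 ^ m) ^ 4 * C ^ 3 * max M 0 * jet θ (m + 1) b := by gcongr
    _ ≤ _ := by
      have h8 : 0 ≤ max M 0 := le_max_right _ _
      have h9 : 0 ≤ (3 ^ m) ^ 4 * C ^ 3 * max M 0 := by positivity
      have h10 : 0 ≤ jet θ (m + 1) b := jet_nonneg
      nlinarith [mul_nonneg h8 h10]

/-- The speed as a product `|b|⁻¹ ⟨b, b⟩`, which reduces its jets to those of `|b|⁻¹`. -/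
theorem norm_eq_smul_inner (h0 : ∀ x, b x ≠ 0) :
    (fun x => ‖b x‖) = fun x => ‖b x‖⁻¹ • (inner ℝ (b x) (b x) : ℝ) := by
  funext x
  have := norm_ne_zero_iff.2 (h0 x)
  rw [real_inner_self_eq_norm_sq, smul_eq_mul]
  field_simp

theorem DiffUpTo.norm (h0 : ∀ x, b x ≠ 0) (hb : DiffUpTo θ m b) :
    DiffUpTo θ m (fun x => ‖b x‖) := by
  rw [norm_eq_smul_inner h0]
  exact (hb.norm_inv h0).smul (hb.bilin (innerSL ℝ) hb)

variable (V) in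
theorem exists_jet_norm_le (m : ℕ) (M : ℝ) : ∃ C, 0 ≤ C ∧ ∀ (b : ℝ → V) (θ : ℝ),
    JetBound θ M m b → DiffUpTo θ m b → jet θ m (fun x => ‖b x‖) ≤ C := by
  obtain ⟨C, hC0, hC⟩ := exists_jet_norm_inv_le V m M
  refine ⟨3 ^ m * (C * (3 ^ m * (max M 0 * max M 0))), by positivity, fun b θ h hb => ?_⟩
  have hM : jet θ m b ≤ max M 0 := h.jet_le.trans (le_max_left _ _)
  have hi : DiffUpTo θ m (fun x => (inner ℝ (b x) (b x) : ℝ)) := hb.bilin (innerSL ℝ) hb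
  have h1 : jet θ m (fun x => (inner ℝ (b x) (b x) : ℝ)) ≤ 3 ^ m * (jet θ m b * jet θ m b) :=
    jet_bilin_le (innerSL ℝ) norm_innerSL_le_one hb hb
  have h0 : 0 ≤ jet θ m b := jet_nonneg
  rw [norm_eq_smul_inner h.ne_zero]
  refine (jet_smul_le (hb.norm_inv h.ne_zero) hi).trans ?_
  have h2 := hC b θ h hb
  have h3 : 0 ≤ jet θ m (fun x => ‖b x‖⁻¹) := jet_nonneg
  have h4 : 0 ≤ jet θ m (fun x => (inner ℝ (b x) (b x) : ℝ)) := jet_nonneg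
  have h5 : jet θ m (fun x => (inner ℝ (b x) (b x) : ℝ)) ≤ 3 ^ m * (max M 0 * max M 0) :=
    h1.trans (by gcongr)
  gcongr

variable (V) in
theorem exists_jet_succ_norm_le (m : ℕ) (M : ℝ) : ∃ C, 0 ≤ C ∧ ∀ (b : ℝ → V) (θ : ℝ),
    JetBound θ M m b → DiffUpTo θ (m + 1) b →
    jet θ (m + 1) (fun x => ‖b x‖) ≤ C * (1 + jet θ (m + 1) b) := by
  obtain ⟨C, hC0, hC⟩ := exists_jet_norm_inv_le V m M
  obtain ⟨D, hD0, hD⟩ := exists_jet_succ_norm_inv_le V m M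
  refine ⟨3 ^ (m + 1) * (C * (3 ^ (m + 1) * (2 * max M 0)) +
    D * (3 ^ m * (max M 0 * max M 0))), by positivity, fun b θ h hb => ?_⟩
  have hM : jet θ m b ≤ max M 0 := h.jet_le.trans (le_max_left _ _)
  have hi : DiffUpTo θ (m + 1) (fun x => (inner ℝ (b x) (b x) : ℝ)) := hb.bilin (innerSL ℝ) hb
  have h1 : jet θ m (fun x => (inner ℝ (b x) (b x) : ℝ)) ≤ 3 ^ m * (jet θ m b * jet θ m b) :=
    jet_bilin_le (innerSL ℝ) norm_innerSL_le_one hb.of_succ hb.of_succ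
  have h1' : jet θ (m + 1) (fun x => (inner ℝ (b x) (b x) : ℝ)) ≤
      3 ^ (m + 1) * (jet θ m b * jet θ (m + 1) b + jet θ (m + 1) b * jet θ m b) :=
    jet_succ_bilin_le (innerSL ℝ) norm_innerSL_le_one hb hb
  have h0 : 0 ≤ jet θ m b := jet_nonneg
  have h0' : 0 ≤ jet θ (m + 1) b := jet_nonneg
  rw [norm_eq_smul_inner h.ne_zero]
  refine (jet_succ_smul_le (hb.norm_inv h.ne_zero) hi).trans ?_
  have h2 := hC b θ h hb.of_succ
  have h2' := hD b θ h hb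
  have h3 : 0 ≤ jet θ m (fun x => ‖b x‖⁻¹) := jet_nonneg
  have h4 : 0 ≤ jet θ m (fun x => (inner ℝ (b x) (b x) : ℝ)) := jet_nonneg
  have h4' : 0 ≤ jet θ (m + 1) (fun x => (inner ℝ (b x) (b x) : ℝ)) := jet_nonneg
  have h5 : jet θ m (fun x => (inner ℝ (b x) (b x) : ℝ)) ≤ 3 ^ m * (max M 0 * max M 0) :=
    h1.trans (by gcongr)
  have h6 : jet θ (m + 1) (fun x => (inner ℝ (b x) (b x) : ℝ)) ≤
      3 ^ (m + 1) * (2 * max M 0) * (1 + jet θ (m + 1) b) := by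
    refine h1'.trans ?_
    rw [mul_assoc]
    refine mul_le_mul_of_nonneg_left ?_ (by positivity)
    have : 0 ≤ max M 0 := le_max_right _ _
    nlinarith
  calc _ ≤ 3 ^ (m + 1) * (C * (3 ^ (m + 1) * (2 * max M 0) * (1 + jet θ (m + 1) b)) +
      D * (1 + jet θ (m + 1) b) * (3 ^ m * (max M 0 * max M 0))) := by gcongr
    _ = _ := by ring

/-! ### Comparing parameter and arc length derivatives -/

theorem deriv_eq_norm_smul_arcDeriv {V W : Type*} [NormedAddCommGroup V]
    [NormedAddCommGroup W] [NormedSpace ℝ W] {b : ℝ → V} (h0 : ∀ x, b x ≠ 0) (u : ℝ → W) :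
    deriv u = fun x => ‖b x‖ • arcDeriv (fun y => ‖b y‖⁻¹) u x := by
  funext x
  have := norm_ne_zero_iff.2 (h0 x)
  rw [arcDeriv, smul_smul, mul_inv_cancel₀ this, one_smul]

theorem DiffUpTo.arcDeriv (h0 : ∀ x, b x ≠ 0) (hb : DiffUpTo θ m b) {u : ℝ → V}
    (hu : DiffUpTo θ (m + 1) u) :
    DiffUpTo θ m (arcDeriv (fun y => ‖b y‖⁻¹) u) := (hb.norm_inv h0).smul hu.2

variable (V) in
theorem exists_jet_succ_le_arcJet (m : ℕ) (M : ℝ) : ∃ C, 0 ≤ C ∧ ∀ (b u : ℝ → V) (θ : ℝ),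
    JetBound θ M m b → DiffUpTo θ m b → DiffUpTo θ (m + 1) u →
    jet θ (m + 1) u ≤ C * arcJet (fun y => ‖b y‖⁻¹) θ (m + 1) u := by
  induction m with
  | zero =>
    refine ⟨1 + max M 0, by positivity, fun b u θ h _ _ => ?_⟩
    have e : deriv u θ = ‖b θ‖ • arcDeriv (fun y => ‖b y‖⁻¹) u θ :=
      congrFun (deriv_eq_norm_smul_arcDeriv h.ne_zero u) θ
    have h1 : ‖b θ‖ ≤ max M 0 := h.jet_le.trans (le_max_left _ _)
    simp only [jet, arcJet]
    rw [e, norm_smul, norm_norm]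
    have h2 : 0 ≤ max M 0 := le_max_right _ _
    have h3 := norm_nonneg (arcDeriv (fun y => ‖b y‖⁻¹) u θ)
    have h4 := norm_nonneg (u θ)
    nlinarith [mul_nonneg h2 h4, mul_le_mul_of_nonneg_right h1 h3]
  | succ m ih =>
    obtain ⟨C, hC0, hC⟩ := ih
    obtain ⟨D, hD0, hD⟩ := exists_jet_norm_le V (m + 1) M
    refine ⟨1 + 3 ^ (m + 1) * (D * C), by positivity, fun b u θ h hb hu => ?_⟩
    have hDu := hb.arcDeriv h.ne_zero hu
    have h1 := jet_smul_le (hb.norm h.ne_zero) hDu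
    rw [← deriv_eq_norm_smul_arcDeriv h.ne_zero u] at h1
    have h2 := hC b _ θ h.of_succ hb.of_succ hDu
    have h3 := hD b θ h hb
    have h4 : 0 ≤ jet θ (m + 1) (fun y => ‖b y‖) := jet_nonneg
    have h5 : 0 ≤ arcJet (fun y => ‖b y‖⁻¹) θ (m + 1) (arcDeriv (fun y => ‖b y‖⁻¹) u) :=
      arcJet_nonneg
    have h6 : 0 ≤ jet θ (m + 1) (arcDeriv (fun y => ‖b y‖⁻¹) u) := jet_nonneg
    have h7 := norm_nonneg (u θ)
    have h8 : jet θ (m + 1) (deriv u) ≤ 3 ^ (m + 1) * (D * (C *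
        arcJet (fun y => ‖b y‖⁻¹) θ (m + 1) (arcDeriv (fun y => ‖b y‖⁻¹) u))) :=
      h1.trans (by gcongr)
    have h9 : 0 ≤ (3 : ℝ) ^ (m + 1) * (D * C) := by positivity
    rw [jet, arcJet]
    nlinarith [mul_nonneg h9 h7]

variable (V) in
theorem exists_jet_le_arcJet (m : ℕ) (M : ℝ) : ∃ C, 0 ≤ C ∧ ∀ (b u : ℝ → V) (θ : ℝ),
    JetBound θ M m b → DiffUpTo θ m b → DiffUpTo θ m u →
    jet θ m u ≤ C * arcJet (fun y => ‖b y‖⁻¹) θ m u := by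
  rcases m with _ | m
  · exact ⟨1, zero_le_one, fun b u θ _ _ _ => by simp [jet, arcJet]⟩
  · obtain ⟨C, hC0, hC⟩ := exists_jet_succ_le_arcJet V m M
    exact ⟨C, hC0, fun b u θ h hb hu => hC b u θ h.of_succ hb.of_succ hu⟩

variable (V) in
/-- Parameter derivatives of `h` in terms of arc length derivatives. The top derivative of the
curve enters linearly and is multiplied only by derivatives of `h` of lower order. -/
theorem exists_jet_deriv_le (m : ℕ) (M : ℝ) : ∃ C, 0 ≤ C ∧ ∀ (b h : ℝ → V) (θ : ℝ),
    JetBound θ M m b → DiffUpTo θ (m + 1) b → DiffUpTo θ (m + 2) h →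
    jet θ (m + 1) (deriv h) ≤
      C * (arcJet (fun y => ‖b y‖⁻¹) θ (m + 1) (arcDeriv (fun y => ‖b y‖⁻¹) h) +
      jet θ (m + 1) b * arcJet (fun y => ‖b y‖⁻¹) θ m (arcDeriv (fun y => ‖b y‖⁻¹) h)) := by
  obtain ⟨C₁, h1, H1⟩ := exists_jet_norm_le V m M
  obtain ⟨C₂, h2, H2⟩ := exists_jet_succ_norm_le V m M
  obtain ⟨C₃, h3, H3⟩ := exists_jet_succ_le_arcJet V m M
  obtain ⟨C₄, h4, H4⟩ := exists_jet_le_arcJet V m M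
  refine ⟨3 ^ (m + 1) * (C₁ * C₃ + C₂ * C₄), by positivity, fun b h θ hJ hb hh => ?_⟩
  have hDu := hb.arcDeriv hJ.ne_zero hh
  have key := jet_succ_smul_le (hb.norm hJ.ne_zero) hDu
  rw [← deriv_eq_norm_smul_arcDeriv hJ.ne_zero h] at key
  have i1 := H1 b θ hJ hb.of_succ
  have i2 := H2 b θ hJ hb
  have i3 := H3 b _ θ hJ hb.of_succ hDu
  have i4 := H4 b _ θ hJ hb.of_succ hDu.of_succ
  set v := arcDeriv (fun y => ‖b y‖⁻¹) h
  have j1 : 0 ≤ jet θ m (fun y => ‖b y‖) := jet_nonneg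
  have j2 : 0 ≤ jet θ (m + 1) (fun y => ‖b y‖) := jet_nonneg
  have j3 : 0 ≤ jet θ (m + 1) v := jet_nonneg
  have j4 : 0 ≤ jet θ m v := jet_nonneg
  have j5 : 0 ≤ jet θ (m + 1) b := jet_nonneg
  have j6 : 0 ≤ arcJet (fun y => ‖b y‖⁻¹) θ m v := arcJet_nonneg
  have j7 : arcJet (fun y => ‖b y‖⁻¹) θ m v ≤ arcJet (fun y => ‖b y‖⁻¹) θ (m + 1) v :=
    arcJet_le_succ
  calc jet θ (m + 1) (deriv h)
      ≤ 3 ^ (m + 1) * (C₁ * (C₃ * arcJet (fun y => ‖b y‖⁻¹) θ (m + 1) v) +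
        C₂ * (1 + jet θ (m + 1) b) * (C₄ * arcJet (fun y => ‖b y‖⁻¹) θ m v)) :=
        key.trans (by gcongr)
    _ = 3 ^ (m + 1) * (C₁ * C₃ * arcJet (fun y => ‖b y‖⁻¹) θ (m + 1) v +
        C₂ * C₄ * (arcJet (fun y => ‖b y‖⁻¹) θ m v +
          jet θ (m + 1) b * arcJet (fun y => ‖b y‖⁻¹) θ m v)) := by ring
    _ ≤ 3 ^ (m + 1) * (C₁ * C₃ * (arcJet (fun y => ‖b y‖⁻¹) θ (m + 1) v +
          jet θ (m + 1) b * arcJet (fun y => ‖b y‖⁻¹) θ m v) +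
        C₂ * C₄ * (arcJet (fun y => ‖b y‖⁻¹) θ (m + 1) v +
          jet θ (m + 1) b * arcJet (fun y => ‖b y‖⁻¹) θ m v)) := by
        gcongr
        exact le_add_of_nonneg_right (mul_nonneg j5 j6)
    _ = _ := by ring

variable (V) in
theorem exists_arcJet_succ_le_jet (m : ℕ) (M : ℝ) : ∃ C, 0 ≤ C ∧ ∀ (b u : ℝ → V) (θ : ℝ),
    JetBound θ M m b → DiffUpTo θ m b → DiffUpTo θ (m + 1) u →
    arcJet (fun y => ‖b y‖⁻¹) θ (m + 1) u ≤ C * jet θ (m + 1) u := by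
  induction m with
  | zero =>
    refine ⟨1 + max M 0, by positivity, fun b u θ h _ _ => ?_⟩
    have h1 : ‖b θ‖⁻¹ ≤ max M 0 := h.inv_le.trans (le_max_left _ _)
    simp only [jet, arcJet, arcDeriv, norm_smul, norm_inv, norm_norm]
    have h2 : 0 ≤ max M 0 := le_max_right _ _
    have h3 := norm_nonneg (deriv u θ)
    have h4 := norm_nonneg (u θ)
    nlinarith [mul_nonneg h2 h4, mul_le_mul_of_nonneg_right h1 h3]
  | succ m ih =>
    obtain ⟨C, hC0, hC⟩ := ih
    obtain ⟨D, hD0, hD⟩ := exists_jet_norm_inv_le V (m + 1) M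
    refine ⟨1 + C * (3 ^ (m + 1) * D), by positivity, fun b u θ h hb hu => ?_⟩
    have hDu := hb.arcDeriv h.ne_zero hu
    have h1 : jet θ (m + 1) (arcDeriv (fun y => ‖b y‖⁻¹) u) ≤ _ :=
      jet_smul_le (hb.norm_inv h.ne_zero) hu.2
    have h2 := hC b _ θ h.of_succ hb.of_succ hDu
    have h3 := hD b θ h hb
    have h5 : 0 ≤ jet θ (m + 1) (deriv u) := jet_nonneg
    have h7 := norm_nonneg (u θ)
    have h8 : arcJet (fun y => ‖b y‖⁻¹) θ (m + 1) (arcDeriv (fun y => ‖b y‖⁻¹) u) ≤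
        C * (3 ^ (m + 1) * (D * jet θ (m + 1) (deriv u))) :=
      h2.trans (mul_le_mul_of_nonneg_left (h1.trans (by gcongr)) hC0)
    have h9 : 0 ≤ C * ((3 : ℝ) ^ (m + 1) * D) := by positivity
    rw [jet, arcJet]
    nlinarith [mul_nonneg h9 h7]

variable (V) in
/-- Arc length derivatives of `h` in terms of parameter derivatives, the counterpart of
`exists_jet_deriv_le`. -/
theorem exists_arcJet_arcDeriv_le (m : ℕ) (M : ℝ) : ∃ C, 0 ≤ C ∧ ∀ (b h : ℝ → V) (θ : ℝ),
    JetBound θ M m b → DiffUpTo θ (m + 1) b → DiffUpTo θ (m + 2) h →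
    arcJet (fun y => ‖b y‖⁻¹) θ (m + 1) (arcDeriv (fun y => ‖b y‖⁻¹) h) ≤
      C * (jet θ (m + 1) (deriv h) + jet θ (m + 1) b * jet θ m (deriv h)) := by
  obtain ⟨C₁, h1, H1⟩ := exists_jet_norm_inv_le V m M
  obtain ⟨C₂, h2, H2⟩ := exists_jet_succ_norm_inv_le V m M
  obtain ⟨C₃, h3, H3⟩ := exists_arcJet_succ_le_jet V m M
  refine ⟨C₃ * (3 ^ (m + 1) * (C₁ + C₂)), by positivity, fun b h θ hJ hb hh => ?_⟩
  have hDu := hb.arcDeriv hJ.ne_zero hh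
  have key : jet θ (m + 1) (arcDeriv (fun y => ‖b y‖⁻¹) h) ≤ _ :=
    jet_succ_smul_le (hb.norm_inv hJ.ne_zero) hh.2
  have i1 := H1 b θ hJ hb.of_succ
  have i2 := H2 b θ hJ hb
  have i3 := H3 b _ θ hJ hb.of_succ hDu
  have j1 : 0 ≤ jet θ m (fun y => ‖b y‖⁻¹) := jet_nonneg
  have j3 : 0 ≤ jet θ (m + 1) (deriv h) := jet_nonneg
  have j4 : 0 ≤ jet θ m (deriv h) := jet_nonneg
  have j5 : 0 ≤ jet θ (m + 1) b := jet_nonneg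
  have j7 : jet θ m (deriv h) ≤ jet θ (m + 1) (deriv h) := jet_le_succ
  refine i3.trans ?_
  rw [mul_assoc C₃]
  refine mul_le_mul_of_nonneg_left (key.trans ?_) h3
  calc _ ≤ 3 ^ (m + 1) * (C₁ * jet θ (m + 1) (deriv h) +
        C₂ * (1 + jet θ (m + 1) b) * jet θ m (deriv h)) := by gcongr
    _ = 3 ^ (m + 1) * (C₁ * jet θ (m + 1) (deriv h) +
        C₂ * (jet θ m (deriv h) + jet θ (m + 1) b * jet θ m (deriv h))) := by ring
    _ ≤ 3 ^ (m + 1) * (C₁ * (jet θ (m + 1) (deriv h) + jet θ (m + 1) b * jet θ m (deriv h)) +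
        C₂ * (jet θ (m + 1) (deriv h) + jet θ (m + 1) b * jet θ m (deriv h))) := by
        gcongr
        exact le_add_of_nonneg_right (mul_nonneg j5 j4)
    _ = _ := by ring

end SpeedJets

/-! ### Sup bounds by energies of higher order -/

section FTC

variable {V : Type*} [NormedAddCommGroup V] [InnerProductSpace ℝ V]

theorem MemHs.intervalIntegrable {u : ℝ → V} {m : ℕ} (hu : MemHs m u) {x y : ℝ}
    (hx : x ∈ Icc 0 (2 * Real.pi)) (hy : y ∈ Icc 0 (2 * Real.pi)) :
    IntervalIntegrable u volume x y := by
  have h : IntervalIntegrable u volume 0 (2 * Real.pi) := by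
    rw [intervalIntegrable_iff_integrableOn_Ioc_of_le Real.two_pi_pos.le]
    exact hu.memLp.integrable (by norm_num)
  refine h.mono_set (uIcc_subset_uIcc ?_ ?_)
  · rwa [uIcc_of_le Real.two_pi_pos.le]
  · rwa [uIcc_of_le Real.two_pi_pos.le]

theorem MemHs.integrable_sq {u : ℝ → V} {m : ℕ} (hu : MemHs m u) :
    Integrable (fun θ => ‖u θ‖ ^ 2) circ :=
  (memLp_two_iff_integrable_sq_norm hu.memLp.aestronglyMeasurable).1 hu.memLp

variable [FiniteDimensional ℝ V]

/-- The fundamental theorem of calculus for `H¹` functions with values in a Euclidean space. -/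
theorem MemHs.integral_deriv {u : ℝ → V} {m : ℕ} (hu : MemHs (m + 1) u) {x y : ℝ}
    (hx : x ∈ Icc 0 (2 * Real.pi)) (hy : y ∈ Icc 0 (2 * Real.pi)) :
    ∫ θ in x..y, _root_.deriv u θ = u y - u x := by
  have hI := hu.deriv.intervalIntegrable hx hy
  have hsub : uIcc x y ⊆ uIcc 0 (2 * Real.pi) := by
    rw [← uIcc_of_le Real.two_pi_pos.le] at hx hy
    exact uIcc_subset_uIcc hx hy
  have hac := hu.absCont.mono hsub
  refine ext_inner_left ℝ fun v => ?_
  have h1 : AbsolutelyContinuousOnInterval (fun θ => (inner ℝ v (u θ) : ℝ)) x y :=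
    absolutelyContinuousOnInterval_bilin (innerSL ℝ)
      ((contDiff_const (c := v)).contDiffOn (n := 1)).absolutelyContinuousOnInterval hac
  have h2 : ∫ θ in x..y, (inner ℝ v (_root_.deriv u θ) : ℝ) =
      inner ℝ v (∫ θ in x..y, _root_.deriv u θ) :=
    ((innerSL ℝ v).intervalIntegral_comp_comm hI)
  rw [← h2, inner_sub_right, ← h1.integral_deriv_eq_sub]
  refine intervalIntegral.integral_congr_ae ?_
  filter_upwards [hac.boundedVariationOn.ae_differentiableAt_of_mem_uIcc] with θ hθ hθ'
  have := (hθ (uIoc_subset_uIcc hθ')).hasDerivAt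
  exact (((innerSL ℝ v).hasFDerivAt.comp_hasDerivAt θ this).deriv).symm

theorem MemHs.norm_sub_le {u : ℝ → V} {m : ℕ} (hu : MemHs (m + 1) u) {x y : ℝ}
    (hx : x ∈ Icc 0 (2 * Real.pi)) (hy : y ∈ Icc 0 (2 * Real.pi)) :
    ‖u x - u y‖ ≤ ∫ θ in (0 : ℝ)..(2 * Real.pi), ‖_root_.deriv u θ‖ := by
  rw [← hu.integral_deriv hy hx]
  refine (intervalIntegral.norm_integral_le_integral_norm_uIoc).trans ?_
  rw [intervalIntegral.integral_of_le Real.two_pi_pos.le]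
  refine setIntegral_mono_set ?_ (Filter.Eventually.of_forall fun _ => norm_nonneg _) ?_
  · exact (hu.deriv.memLp.integrable (by norm_num)).norm
  · refine Filter.Eventually.of_forall fun θ hθ => ?_
    exact ⟨lt_of_le_of_lt (le_min hy.1 hx.1) hθ.1, hθ.2.trans (max_le hy.2 hx.2)⟩

end FTC

section Weights

/-- A positive periodic weight `p` of class `H^{n-1}`, used to differentiate with respect to the
parameter `s` with `ds = p⁻¹ dθ`. Examples are the inverse speed `p = |c'|⁻¹` of an `H^n`-immersion
of the circle, with `n ≥ 2`, and the constant `1`, which gives back the parameter `θ`. -/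
structure ArcWeight (n : ℕ) (p : ℝ → ℝ) : Prop where
  pos : ∀ θ, 0 < p θ
  continuous : Continuous p
  periodic : Function.Periodic p (2 * Real.pi)
  memHs : MemHs (n - 1) p

/-- The length `∫ ds`. -/
noncomputable def arcLen (p : ℝ → ℝ) : ℝ := ∫ θ in (0 : ℝ)..(2 * Real.pi), (p θ)⁻¹

variable {V : Type*} [NormedAddCommGroup V] [InnerProductSpace ℝ V]

/-- The energy `∫ |D^k h|² ds`. -/
noncomputable def arcEnergy (p : ℝ → ℝ) (k : ℕ) (h : ℝ → V) : ℝ :=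
  ∫ θ in (0 : ℝ)..(2 * Real.pi), ‖((arcDeriv p)^[k] h) θ‖ ^ 2 * (p θ)⁻¹

/-- The `L¹`-norm `∫ |D^k h| ds`. -/
noncomputable def arcL1 (p : ℝ → ℝ) (k : ℕ) (h : ℝ → V) : ℝ :=
  ∫ θ in (0 : ℝ)..(2 * Real.pi), ‖((arcDeriv p)^[k] h) θ‖ * (p θ)⁻¹

variable {n : ℕ} {p : ℝ → ℝ} {h : ℝ → V}

theorem ArcWeight.continuous_inv (hp : ArcWeight n p) : Continuous fun θ => (p θ)⁻¹ :=
  hp.continuous.inv₀ fun θ => (hp.pos θ).ne'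

theorem ArcWeight.inv_pos (hp : ArcWeight n p) (θ : ℝ) : 0 < (p θ)⁻¹ := _root_.inv_pos.2 (hp.pos θ)

theorem ArcWeight.arcLen_pos (hp : ArcWeight n p) : 0 < arcLen p :=
  intervalIntegral.intervalIntegral_pos_of_pos (hp.continuous_inv.intervalIntegrable _ _)
    hp.inv_pos Real.two_pi_pos

theorem ArcWeight.arcEnergy_nonneg (hp : ArcWeight n p) (k : ℕ) : 0 ≤ arcEnergy p k h :=
  intervalIntegral.integral_nonneg Real.two_pi_pos.le fun θ _ =>
    mul_nonneg (sq_nonneg _) (hp.inv_pos θ).le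

theorem arcWeight_one (n : ℕ) : ArcWeight n (fun _ => 1) :=
  ⟨fun _ => one_pos, continuous_const, fun _ => rfl, memHs_const _ _⟩

theorem periodic_arcDeriv {p : ℝ → ℝ} {u : ℝ → V} {T : ℝ} (hp : Function.Periodic p T)
    (hu : Function.Periodic u T) : Function.Periodic (arcDeriv p u) T := by
  intro θ
  have e : (fun x => u (x + T)) = u := funext hu
  have h1 : deriv u (θ + T) = deriv u θ := by
    rw [← deriv_comp_add_const, e]
  simp only [arcDeriv, hp θ, h1]

theorem periodic_iterate_arcDeriv {p : ℝ → ℝ} {u : ℝ → V} {T : ℝ} (hp : Function.Periodic p T)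
    (hu : Function.Periodic u T) (j : ℕ) : Function.Periodic ((arcDeriv p)^[j] u) T := by
  induction j with
  | zero => exact hu
  | succ j ih => rw [Function.iterate_succ_apply']; exact periodic_arcDeriv hp ih

theorem ArcWeight.norm_deriv (hp : ArcWeight n p) (u : ℝ → V) (θ : ℝ) :
    ‖deriv u θ‖ = ‖arcDeriv p u θ‖ * (p θ)⁻¹ := by
  have := hp.pos θ
  rw [arcDeriv, norm_smul, Real.norm_of_nonneg this.le]
  field_simp

variable [FiniteDimensional ℝ V]

theorem ArcWeight.memHs_iterate (hp : ArcWeight n p) (hh : MemHs n h) {j : ℕ} (hj : j ≤ n) :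
    MemHs (n - j) ((arcDeriv p)^[j] h) := by
  induction j with
  | zero => exact hh
  | succ j ih =>
    rw [Function.iterate_succ_apply']
    have h1 := ih (by omega)
    have e : n - j = (n - (j + 1)) + 1 := by omega
    rw [e] at h1
    exact MemHs.smul hp.continuous (hp.memHs.mono (by omega)) h1.deriv

/-- Since `∫ D^j h ds = 0` for `j ≥ 1`, the function `D^j h` is bounded by its total variation. -/
theorem ArcWeight.norm_iterate_le_arcL1 (hp : ArcWeight n p) (hh : MemHs n h)
    (hper : Function.Periodic h (2 * Real.pi)) {j : ℕ} (hj : 1 ≤ j) (hjn : j < n) {x : ℝ}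
    (hx : x ∈ Icc 0 (2 * Real.pi)) : ‖((arcDeriv p)^[j] h) x‖ ≤ arcL1 p (j + 1) h := by
  obtain ⟨i, rfl⟩ : ∃ i, j = i + 1 := ⟨j - 1, by omega⟩
  obtain ⟨r, rfl⟩ : ∃ r, n = r + i + 2 := ⟨n - i - 2, by omega⟩
  have h0 : (0 : ℝ) ∈ Icc 0 (2 * Real.pi) := ⟨le_rfl, Real.two_pi_pos.le⟩
  have h2 : (2 * Real.pi) ∈ Icc 0 (2 * Real.pi) := ⟨Real.two_pi_pos.le, le_rfl⟩
  have hw := hp.memHs_iterate hh (j := i) (by omega)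
  have hf := hp.memHs_iterate hh (j := i + 1) (by omega)
  have hwp := periodic_iterate_arcDeriv hp.periodic hper i
  rw [show r + i + 2 - i = r + 2 by omega] at hw
  rw [show r + i + 2 - (i + 1) = r + 1 by omega] at hf
  set w := (arcDeriv p)^[i] h
  have e1 : (arcDeriv p)^[i + 1] h = arcDeriv p w := Function.iterate_succ_apply' _ _ _
  have e2 : arcL1 p (i + 1 + 1) h = ∫ θ in (0 : ℝ)..(2 * Real.pi), ‖deriv (arcDeriv p w) θ‖ := by
    unfold arcL1
    simp only [hp.norm_deriv (arcDeriv p w)]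
    rw [Function.iterate_succ_apply', e1]
  rw [e1] at hf ⊢
  rw [e2]
  set A := ∫ θ in (0 : ℝ)..(2 * Real.pi), ‖deriv (arcDeriv p w) θ‖
  have e3 : ∀ θ, (p θ)⁻¹ • arcDeriv p w θ = deriv w θ := fun θ => by
    rw [arcDeriv, smul_smul, inv_mul_cancel₀ (hp.pos θ).ne', one_smul]
  have hci := hp.continuous_inv
  have key : ∫ θ in (0 : ℝ)..(2 * Real.pi), (p θ)⁻¹ • (arcDeriv p w x - arcDeriv p w θ) =
      arcLen p • arcDeriv p w x := by
    simp only [smul_sub, e3]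
    rw [intervalIntegral.integral_sub, intervalIntegral.integral_smul_const,
      hw.integral_deriv h0 h2]
    · have : w (2 * Real.pi) = w 0 := by simpa using hwp 0
      rw [this, sub_self, sub_zero]; rfl
    · exact (hci.smul continuous_const).intervalIntegrable _ _
    · exact hw.deriv.intervalIntegrable h0 h2
  have hb : ‖∫ θ in (0 : ℝ)..(2 * Real.pi), (p θ)⁻¹ • (arcDeriv p w x - arcDeriv p w θ)‖ ≤
      ∫ θ in (0 : ℝ)..(2 * Real.pi), (p θ)⁻¹ * A := by
    refine intervalIntegral.norm_integral_le_of_norm_le Real.two_pi_pos.le ?_ ?_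
    · refine Filter.Eventually.of_forall fun θ hθ => ?_
      rw [norm_smul, Real.norm_of_nonneg (hp.inv_pos θ).le]
      exact mul_le_mul_of_nonneg_left (hf.norm_sub_le hx (Ioc_subset_Icc_self hθ))
        (hp.inv_pos θ).le
    · exact (hci.mul continuous_const).intervalIntegrable _ _
  rw [key, intervalIntegral.integral_mul_const, norm_smul, Real.norm_of_nonneg hp.arcLen_pos.le]
    at hb
  exact le_of_mul_le_mul_left hb hp.arcLen_pos

theorem ArcWeight.arcL1_le_mul_arcL1 (hp : ArcWeight n p) (hh : MemHs n h)
    (hper : Function.Periodic h (2 * Real.pi)) {j : ℕ} (hj : 1 ≤ j) (hjn : j < n) :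
    arcL1 p j h ≤ arcLen p * arcL1 p (j + 1) h := by
  have hc : Continuous ((arcDeriv p)^[j] h) := by
    have := hp.memHs_iterate hh (j := j) hjn.le
    rw [show n - j = (n - j - 1) + 1 by omega] at this
    exact this.continuous
  have : ∫ θ in (0 : ℝ)..(2 * Real.pi), ‖((arcDeriv p)^[j] h) θ‖ * (p θ)⁻¹ ≤
      ∫ θ in (0 : ℝ)..(2 * Real.pi), (p θ)⁻¹ * arcL1 p (j + 1) h := by
    refine intervalIntegral.integral_mono_on Real.two_pi_pos.le ?_ ?_ fun θ hθ => ?_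
    · exact (hc.norm.mul hp.continuous_inv).intervalIntegrable _ _
    · exact (hp.continuous_inv.mul continuous_const).intervalIntegrable _ _
    · rw [mul_comm]
      exact mul_le_mul_of_nonneg_left (hp.norm_iterate_le_arcL1 hh hper hj hjn hθ)
        (hp.inv_pos θ).le
  rwa [intervalIntegral.integral_mul_const] at this

theorem intervalIntegrable_circ {f : ℝ → ℝ} (hf : Integrable f circ) :
    IntervalIntegrable f volume 0 (2 * Real.pi) :=
  (intervalIntegrable_iff_integrableOn_Ioc_of_le Real.two_pi_pos.le).2 hf

theorem ArcWeight.intervalIntegrable_mul_inv (hp : ArcWeight n p) {f : ℝ → ℝ}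
    (hf : Integrable f circ) :
    IntervalIntegrable (fun θ => f θ * (p θ)⁻¹) volume 0 (2 * Real.pi) :=
  (intervalIntegrable_circ hf).mul_continuousOn hp.continuous_inv.continuousOn

/-- The Cauchy–Schwarz inequality `(∫ |D^k h| ds)² ≤ ℓ ∫ |D^k h|² ds`. -/
theorem ArcWeight.arcL1_sq_le (hp : ArcWeight n p) (hh : MemHs n h) {k : ℕ} (hk : k ≤ n) :
    arcL1 p k h ^ 2 ≤ arcLen p * arcEnergy p k h := by
  have hu := hp.memHs_iterate hh hk
  have hL := hp.arcLen_pos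
  -- The nonnegative quantity below is the variance of `|D^k h|`, with `m` its mean.
  set m := arcL1 p k h / arcLen p with hm
  have h1 := hp.intervalIntegrable_mul_inv hu.integrable_sq
  have h2 := hp.intervalIntegrable_mul_inv (hu.memLp.integrable (by norm_num)).norm
  have h3 : IntervalIntegrable (fun θ => (p θ)⁻¹) volume 0 (2 * Real.pi) :=
    hp.continuous_inv.intervalIntegrable _ _
  have hpos : 0 ≤ ∫ θ in (0 : ℝ)..(2 * Real.pi),
      (‖((arcDeriv p)^[k] h) θ‖ - m) ^ 2 * (p θ)⁻¹ :=
    intervalIntegral.integral_nonneg Real.two_pi_pos.le fun θ _ =>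
      mul_nonneg (sq_nonneg _) (hp.inv_pos θ).le
  have e : ∀ θ, (‖((arcDeriv p)^[k] h) θ‖ - m) ^ 2 * (p θ)⁻¹ =
      ‖((arcDeriv p)^[k] h) θ‖ ^ 2 * (p θ)⁻¹ - 2 * m * (‖((arcDeriv p)^[k] h) θ‖ * (p θ)⁻¹) +
        m ^ 2 * (p θ)⁻¹ := fun θ => by ring
  simp only [e] at hpos
  rw [intervalIntegral.integral_add (h1.sub (h2.const_mul _)) (h3.const_mul _),
    intervalIntegral.integral_sub h1 (h2.const_mul _), intervalIntegral.integral_const_mul,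
    intervalIntegral.integral_const_mul] at hpos
  change 0 ≤ arcEnergy p k h - 2 * m * arcL1 p k h + m ^ 2 * arcLen p at hpos
  have e2 : arcL1 p k h = m * arcLen p := by rw [hm]; field_simp
  have : m ^ 2 * arcLen p ≤ arcEnergy p k h := by rw [e2] at hpos; nlinarith
  rw [e2]
  nlinarith

/-- Poincaré's inequality in `L¹` and Cauchy–Schwarz. -/
theorem ArcWeight.arcL1_le (hp : ArcWeight n p) (hh : MemHs n h)
    (hper : Function.Periodic h (2 * Real.pi)) {j i : ℕ} (hj : 1 ≤ j) (hk : j + i ≤ n) :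
    arcL1 p j h ≤ arcLen p ^ i * Real.sqrt (arcLen p * arcEnergy p (j + i) h) := by
  induction i generalizing j with
  | zero =>
    rw [pow_zero, one_mul]
    exact Real.le_sqrt_of_sq_le (hp.arcL1_sq_le hh hk)
  | succ i ih =>
    have h1 := hp.arcL1_le_mul_arcL1 hh hper hj (by omega)
    have h2 := ih (j := j + 1) (by omega) (by omega)
    rw [show j + 1 + i = j + (i + 1) by omega] at h2
    rw [pow_succ', mul_assoc]
    exact h1.trans (mul_le_mul_of_nonneg_left h2 hp.arcLen_pos.le)

theorem ArcWeight.norm_iterate_le (hp : ArcWeight n p) (hh : MemHs n h)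
    (hper : Function.Periodic h (2 * Real.pi)) {j i : ℕ} (hj : 1 ≤ j) (hk : j + 1 + i ≤ n) {x : ℝ}
    (hx : x ∈ Icc 0 (2 * Real.pi)) : ‖((arcDeriv p)^[j] h) x‖ ≤
      arcLen p ^ i * Real.sqrt (arcLen p * arcEnergy p (j + 1 + i) h) :=
  (hp.norm_iterate_le_arcL1 hh hper hj (by omega) hx).trans
    (hp.arcL1_le hh hper (by omega) hk)

end Weights

/-! ### Variation of a seminorm along a path -/

section Paths

open Filter Topology

variable {V : Type*} [NormedAddCommGroup V] [NormedSpace ℝ V]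

theorem continuous_seminorm_of_le {q : Seminorm ℝ V} {C : ℝ} (hq : ∀ x, q x ≤ C * ‖x‖) :
    Continuous q := by
  refine Seminorm.continuous_of_le (q := C.toNNReal • normSeminorm ℝ V) ?_ fun x => ?_
  · change Continuous fun x : V => C.toNNReal • ‖x‖
    fun_prop
  · refine (hq x).trans ?_
    change C * ‖x‖ ≤ (C.toNNReal : ℝ) * ‖x‖
    gcongr
    exact Real.le_coe_toNNReal C

/-- Along a path `γ` the quantity `P (q (γ t))` has right Dini derivative at most
`|P'| q(γ')`. -/
theorem eventually_slope_lt {γ : ℝ → V} {v : V} {x : ℝ} (hγ : HasDerivWithinAt γ v (Ioi x) x)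
    {q : Seminorm ℝ V} (hq : Continuous q) {P : ℝ → ℝ} {p : ℝ} (hP : HasDerivAt P p (q (γ x)))
    {r : ℝ} (hr : |p| * q v < r) : ∀ᶠ z in 𝓝[>] x, slope (fun t => P (q (γ t))) x z < r := by
  obtain ⟨ε, hε, hεr⟩ : ∃ ε > 0, (|p| + ε) * q v < r := by
    have hc : Tendsto (fun ε : ℝ => (|p| + ε) * q v) (𝓝[>] 0) (𝓝 ((|p| + 0) * q v)) :=
      ((continuous_const.add continuous_id).mul continuous_const).continuousWithinAt
    rw [add_zero] at hc
    obtain ⟨ε, h1, h2⟩ := ((hc.eventually_lt_const hr).and self_mem_nhdsWithin).exists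
    exact ⟨ε, h2, h1⟩
  have hs : Tendsto (slope γ x) (𝓝[>] x) (𝓝 v) := by
    have := hasDerivWithinAt_iff_tendsto_slope.1 hγ
    rwa [sdiff_singleton_eq_self (by simp)] at this
  have h1 : ∀ᶠ z in 𝓝[>] x, (|p| + ε) * q (slope γ x z) < r := by
    have : Tendsto (fun z => (|p| + ε) * q (slope γ x z)) (𝓝[>] x) (𝓝 ((|p| + ε) * q v)) :=
      ((hq.tendsto v).comp hs).const_mul _
    exact this.eventually_lt_const hεr
  have h2 : ∀ᶠ y in 𝓝 (q (γ x)), |P y - P (q (γ x))| ≤ (|p| + ε) * |y - q (γ x)| := by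
    filter_upwards [hP.isLittleO.def hε] with y hy
    rw [Real.norm_eq_abs, Real.norm_eq_abs, smul_eq_mul] at hy
    have e : P y - P (q (γ x)) = (P y - P (q (γ x)) - (y - q (γ x)) * p) + (y - q (γ x)) * p := by
      ring
    rw [e]
    refine (abs_add_le _ _).trans ?_
    rw [abs_mul]
    linarith
  have h3 : Tendsto (fun z => q (γ z)) (𝓝[>] x) (𝓝 (q (γ x))) :=
    (hq.tendsto _).comp hγ.continuousWithinAt
  filter_upwards [h1, h3.eventually h2, self_mem_nhdsWithin] with z hz1 hz2 hz3
  have hzx : 0 < z - x := sub_pos.2 hz3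
  refine lt_of_le_of_lt ?_ hz1
  have e : q (slope γ x z) = (z - x)⁻¹ * q (γ z - γ x) := by
    rw [slope_def_module, map_smul_eq_mul, Real.norm_of_nonneg (by positivity)]
  rw [slope_def_field, e, div_le_iff₀ hzx]
  have h4 : |q (γ z) - q (γ x)| ≤ q (γ z - γ x) := abs_sub_map_le_sub q _ _
  have h5 : 0 ≤ |p| + ε := by positivity
  calc P (q (γ z)) - P (q (γ x)) ≤ (|p| + ε) * q (γ z - γ x) :=
        (le_abs_self _).trans (hz2.trans (mul_le_mul_of_nonneg_left h4 h5))
    _ = _ := by field_simp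

/-- If a seminorm `q` changes along a `C¹`-path with `|P'(q)| q(γ') ≤ K g`, then `P ∘ q` varies by
at most `K ∫ g`. No measurability of `g` is needed, as `|P'(q)| q(γ')` is continuous. -/
theorem abs_sub_le_of_path {γ : ℝ → V} (hγ : ContDiffOn ℝ 1 γ (Icc 0 1)) {q : Seminorm ℝ V}
    (hq : Continuous q) {P p g : ℝ → ℝ} (hp : ContinuousOn p (Icc 0 1))
    (hP : ∀ t ∈ Icc (0 : ℝ) 1, HasDerivAt P (p t) (q (γ t))) {K R : ℝ} (hK : 0 ≤ K) (hR : 0 ≤ R)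
    (hg : ∀ t ∈ Icc (0 : ℝ) 1, |p t| * q (derivWithin γ (Icc 0 1) t) ≤ K * g t)
    (hgR : ∫⁻ t in Icc (0 : ℝ) 1, ENNReal.ofReal (g t) ≤ ENNReal.ofReal R) :
    ∀ t ∈ Icc (0 : ℝ) 1, |P (q (γ t)) - P (q (γ 0))| ≤ K * R := by
  set φ : ℝ → ℝ := fun t => |p t| * q (derivWithin γ (Icc 0 1) t) with hφ
  have hφc : ContinuousOn φ (Icc 0 1) :=
    hp.abs.mul (hq.comp_continuousOn
      (hγ.continuousOn_derivWithin (uniqueDiffOn_Icc zero_lt_one) le_rfl))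
  have hφ0 : ∀ t, 0 ≤ φ t := fun t => mul_nonneg (abs_nonneg _) (apply_nonneg q _)
  set ψ : ℝ → ℝ := fun t => φ (projIcc 0 1 zero_le_one t) with hψ
  have hψc : Continuous ψ :=
    hφc.comp_continuous (continuous_subtype_val.comp continuous_projIcc) fun t => (projIcc _ _ _ t).2
  have hψφ : ∀ t ∈ Icc (0 : ℝ) 1, ψ t = φ t := fun t ht => by
    simp only [hψ, projIcc_of_mem zero_le_one ht]
  have hψ0 : ∀ t, 0 ≤ ψ t := fun t => hφ0 _
  have hB : ∀ t, HasDerivAt (fun t => ∫ s in (0 : ℝ)..t, ψ s) (ψ t) t := fun t =>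
    hψc.integral_hasStrictDerivAt 0 t |>.hasDerivAt
  have hB1 : ∫ s in (0 : ℝ)..1, ψ s ≤ K * R := by
    rw [intervalIntegral.integral_of_le zero_le_one, ← integral_Icc_eq_integral_Ioc]
    refine (ENNReal.ofReal_le_ofReal_iff (by positivity)).1 ?_
    rw [ofReal_integral_eq_lintegral_ofReal (hψc.integrableOn_Icc)
      (Eventually.of_forall hψ0), ENNReal.ofReal_mul hK]
    calc ∫⁻ t in Icc (0 : ℝ) 1, ENNReal.ofReal (ψ t)
        ≤ ∫⁻ t in Icc (0 : ℝ) 1, ENNReal.ofReal K * ENNReal.ofReal (g t) := by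
          refine setLIntegral_mono' measurableSet_Icc fun t ht => ?_
          rw [← ENNReal.ofReal_mul hK, hψφ t ht]
          exact ENNReal.ofReal_le_ofReal (hg t ht)
      _ = ENNReal.ofReal K * ∫⁻ t in Icc (0 : ℝ) 1, ENNReal.ofReal (g t) :=
          lintegral_const_mul' _ _ ENNReal.ofReal_ne_top
      _ ≤ _ := by gcongr
  have hBt : ∀ t ∈ Icc (0 : ℝ) 1, ∫ s in (0 : ℝ)..t, ψ s ≤ K * R := fun t ht =>
    (intervalIntegral.integral_mono_interval le_rfl ht.1 ht.2 (Eventually.of_forall hψ0)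
      (hψc.intervalIntegrable _ _)).trans hB1
  have hγd : ∀ x ∈ Ico (0 : ℝ) 1,
      HasDerivWithinAt γ (derivWithin γ (Icc 0 1) x) (Ioi x) x := fun x hx => by
    have h1 := (hγ.differentiableOn one_ne_zero x (Ico_subset_Icc_self hx)).hasDerivWithinAt
    refine h1.mono_of_mem_nhdsWithin ?_
    exact mem_of_superset (Ioo_mem_nhdsGT hx.2) fun y hy => ⟨hx.1.trans hy.1.le, hy.2.le⟩
  have one_side : ∀ (Q : ℝ → ℝ) (s : ℝ → ℝ), (∀ t, |s t| = |p t|) →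
      (∀ t ∈ Icc (0 : ℝ) 1, HasDerivAt Q (s t) (q (γ t))) →
      ∀ t ∈ Icc (0 : ℝ) 1, Q (q (γ t)) ≤ Q (q (γ 0)) + K * R := by
    intro Q s hs hQ t ht
    have hf : ContinuousOn (fun t => Q (q (γ t))) (Icc 0 1) := fun t ht =>
      ContinuousAt.comp_continuousWithinAt (f := fun t => q (γ t)) (hQ t ht).continuousAt
        (hq.comp_continuousOn hγ.continuousOn t ht)
    have := image_le_of_liminf_slope_right_le_deriv_boundary hf
      (B := fun t => Q (q (γ 0)) + ∫ s in (0 : ℝ)..t, ψ s) (B' := ψ) (by simp)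
      (continuousOn_const.add fun t _ => (hB t).continuousAt.continuousWithinAt)
      (fun x _ => ((hB x).const_add _).hasDerivWithinAt)
      (fun x hx r hr => by
        have hx' := Ico_subset_Icc_self hx
        rw [hψφ x hx'] at hr
        refine (eventually_slope_lt (hγd x hx) hq (hQ x hx') ?_).frequently
        rw [hs]; exact hr) ht
    have := hBt t ht
    linarith
  intro t ht
  have h1 := one_side P p (fun _ => rfl) hP t ht
  have h2 := one_side (fun x => -P x) (fun t => -p t) (fun _ => abs_neg _)
    (fun t ht => (hP t ht).neg) t ht
  rw [abs_le]
  constructor <;> linarith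

/-- Grönwall's inequality for a seminorm along a path. -/
theorem seminorm_le_of_path {γ : ℝ → V} (hγ : ContDiffOn ℝ 1 γ (Icc 0 1)) {q : Seminorm ℝ V}
    (hq : Continuous q) {g : ℝ → ℝ} {K R : ℝ} (hK : 0 ≤ K) (hR : 0 ≤ R)
    (hg : ∀ t ∈ Icc (0 : ℝ) 1,
      q (derivWithin γ (Icc 0 1) t) ≤ K * g t * (1 + q (γ t)))
    (hgR : ∫⁻ t in Icc (0 : ℝ) 1, ENNReal.ofReal (g t) ≤ ENNReal.ofReal R) :
    ∀ t ∈ Icc (0 : ℝ) 1, q (γ t) ≤ (1 + q (γ 0)) * Real.exp (K * R) := by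
  have h0 : ∀ x, 0 < 1 + q x := fun x => by have := apply_nonneg q x; positivity
  intro t ht
  have := abs_sub_le_of_path hγ hq (P := fun r => Real.log (1 + r)) (p := fun t => (1 + q (γ t))⁻¹)
    ((continuousOn_const.add (hq.comp_continuousOn hγ.continuousOn)).inv₀ fun t _ => (h0 _).ne')
    (fun t _ => by
      have := ((hasDerivAt_id (q (γ t))).const_add 1).log (h0 _).ne'
      simpa using this) hK hR
    (fun t ht => by
      rw [abs_of_pos (inv_pos.2 (h0 _)), inv_mul_le_iff₀ (h0 _)]
      linarith [hg t ht]) hgR t ht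
  have h1 := (abs_le.1 this).2
  rw [← Real.log_div (h0 _).ne' (h0 _).ne', Real.log_le_iff_le_exp (div_pos (h0 _) (h0 _)),
    div_le_iff₀ (h0 _)] at h1
  linarith

/-- Two-sided bounds for a seminorm whose logarithm has bounded variation along a path. -/
theorem seminorm_bounds_of_path {γ : ℝ → V} (hγ : ContDiffOn ℝ 1 γ (Icc 0 1)) {q : Seminorm ℝ V}
    (hq : Continuous q) (hpos : ∀ t ∈ Icc (0 : ℝ) 1, 0 < q (γ t)) {g : ℝ → ℝ} {K R : ℝ}
    (hK : 0 ≤ K) (hR : 0 ≤ R)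
    (hg : ∀ t ∈ Icc (0 : ℝ) 1, q (derivWithin γ (Icc 0 1) t) ≤ K * g t * q (γ t))
    (hgR : ∫⁻ t in Icc (0 : ℝ) 1, ENNReal.ofReal (g t) ≤ ENNReal.ofReal R) :
    ∀ t ∈ Icc (0 : ℝ) 1, q (γ t) ≤ q (γ 0) * Real.exp (K * R) ∧
      q (γ 0) ≤ q (γ t) * Real.exp (K * R) := by
  intro t ht
  have ht0 := hpos t ht
  have h00 := hpos 0 ⟨le_rfl, zero_le_one⟩
  have := abs_sub_le_of_path hγ hq (P := Real.log) (p := fun t => (q (γ t))⁻¹)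
    ((hq.comp_continuousOn hγ.continuousOn).inv₀ fun t ht => (hpos t ht).ne')
    (fun t ht => Real.hasDerivAt_log (hpos t ht).ne') hK hR
    (fun t ht => by
      rw [abs_of_pos (inv_pos.2 (hpos t ht)), inv_mul_le_iff₀ (hpos t ht)]
      linarith [hg t ht]) hgR t ht
  rw [abs_le] at this
  constructor
  · have h1 := this.2
    rw [← Real.log_div ht0.ne' h00.ne', Real.log_le_iff_le_exp (div_pos ht0 h00),
      div_le_iff₀ h00] at h1
    linarith
  · have h1 : Real.log (q (γ 0)) - Real.log (q (γ t)) ≤ K * R := by linarith [this.1]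
    rw [← Real.log_div h00.ne' ht0.ne', Real.log_le_iff_le_exp (div_pos h00 ht0),
      div_le_iff₀ ht0] at h1
    linarith

end Paths

/-! ### Divergent weight integrals -/

section WeightIntegral

open Filter Topology

variable {w : ℝ → ℝ}

theorem intervalIntegrable_of_pos (hw : ContinuousOn w (Ioi 0)) {a b : ℝ} (ha : 0 < a)
    (hb : 0 < b) : IntervalIntegrable w volume a b :=
  (hw.mono fun _ hx => (lt_min ha hb).trans_le hx.1).intervalIntegrable

theorem hasDerivAt_integral_of_pos (hw : ContinuousOn w (Ioi 0)) {a b : ℝ} (ha : 0 < a)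
    (hb : 0 < b) : HasDerivAt (fun x => ∫ r in a..x, w r) (w b) b :=
  intervalIntegral.integral_hasDerivAt_right (intervalIntegrable_of_pos hw ha hb)
    (hw.stronglyMeasurableAtFilter isOpen_Ioi b hb) (hw.continuousAt (Ioi_mem_nhds hb))

/-- If `w` is not integrable near `0`, then `r` stays away from `0` as long as `∫_r^l w` is
bounded. -/
theorem exists_lower_bound_of_lintegral_eq_top (hw : ContinuousOn w (Ioi 0))
    (hw0 : ∀ r, 0 < r → 0 ≤ w r) (htop : ∫⁻ r in Ioc 0 1, ENNReal.ofReal (w r) = ⊤) {l : ℝ}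
    (hl : 0 < l) (R : ℝ) : ∃ ε, 0 < ε ∧ ∀ r, 0 < r → ∫ x in r..l, w x ≤ R → ε ≤ r := by
  by_contra! hcon
  choose f hf0 hfR hf1 using fun m : ℕ => hcon (1 / ((m : ℝ) + 1)) (by positivity)
  have hf : Tendsto f atTop (𝓝 0) :=
    squeeze_zero (fun m => (hf0 m).le) (fun m => (hf1 m).le) tendsto_one_div_add_atTop_nhds_zero_nat
  have hint : IntegrableOn w (Ioc 0 l) := by
    refine integrableOn_Ioc_of_intervalIntegral_norm_bounded_left (I := R) (a := f) (l := atTop)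
      (fun i => (intervalIntegrable_of_pos hw (hf0 i) hl).1) hf ?_
    filter_upwards [hf.eventually_le_const hl] with i hi
    rw [← intervalIntegral.integral_of_le hi]
    refine le_trans (le_of_eq ?_) (hfR i)
    refine intervalIntegral.integral_congr fun x hx => ?_
    rw [uIcc_of_le hi] at hx
    exact Real.norm_of_nonneg (hw0 x ((hf0 i).trans_le hx.1))
  have hint1 : IntegrableOn w (Ioc 0 1) := by
    refine (hint.union (intervalIntegrable_of_pos hw hl one_pos).1).mono_set fun x hx => ?_
    rcases le_or_gt x l with h | h
    · exact Or.inl ⟨hx.1, h⟩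
    · exact Or.inr ⟨h, hx.2⟩
  exact hint1.lintegral_lt_top.ne htop

/-- If `w` is not integrable near `∞`, then `r` stays bounded as long as `∫_l^r w` does. -/
theorem exists_upper_bound_of_lintegral_eq_top (hw : ContinuousOn w (Ioi 0))
    (hw0 : ∀ r, 0 < r → 0 ≤ w r) (htop : ∫⁻ r in Ici 1, ENNReal.ofReal (w r) = ⊤) {l : ℝ}
    (hl : 0 < l) (R : ℝ) : ∃ L, 0 < L ∧ ∀ r, 0 < r → ∫ x in l..r, w x ≤ R → r ≤ L := by
  by_contra! hcon
  choose f hf0 hfR hf1 using fun m : ℕ => hcon ((m : ℝ) + 1) (by positivity)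
  have hf : Tendsto f atTop atTop :=
    tendsto_atTop_mono (fun m => (hf1 m).le)
      (tendsto_atTop_add_const_right _ _ tendsto_natCast_atTop_atTop)
  have hint : IntegrableOn w (Ioi l) := by
    refine integrableOn_Ioi_of_intervalIntegral_norm_bounded R l (b := f) (l := atTop)
      (fun i => (intervalIntegrable_of_pos hw hl (hf0 i)).1) hf ?_
    filter_upwards [hf.eventually_ge_atTop l] with i hi
    refine le_trans (le_of_eq ?_) (hfR i)
    refine intervalIntegral.integral_congr fun x hx => ?_
    rw [uIcc_of_le hi] at hx
    exact Real.norm_of_nonneg (hw0 x (hl.trans_le hx.1))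
  have hint1 : IntegrableOn w (Ici 1) := by
    rw [integrableOn_Ici_iff_integrableOn_Ioi]
    refine ((intervalIntegrable_of_pos hw one_pos hl).1.union hint).mono_set fun x hx => ?_
    rcases le_or_gt x l with h | h
    · exact Or.inl ⟨hx, h⟩
    · exact Or.inr h
  exact hint1.lintegral_lt_top.ne htop

end WeightIntegral

/-! ### The metric in terms of arc length energies -/

section Metric

variable {n d : ℕ} {a : ℕ → ℝ → ℝ}

/-- The inverse speed `|c'|⁻¹`, for which `D_s = arcDeriv (invSpeed c)`. -/
noncomputable def invSpeed (c : ℝ → E d) : ℝ → ℝ := fun θ => ‖deriv c θ‖⁻¹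

theorem Ds_eq_arcDeriv (c : ℝ → E d) : Ds c = arcDeriv (invSpeed c) := rfl

theorem len_eq_arcLen (c : ℝ → E d) : len c = arcLen (invSpeed c) := by
  simp only [len, arcLen, invSpeed, inv_inv]

theorem G_eq_sum (c h : ℝ → E d) : G n a c h h =
    ∑ j ∈ Finset.range (n + 1), a j (len c) * arcEnergy (invSpeed c) j h := by
  unfold G arcEnergy
  refine Finset.sum_congr rfl fun j _ => ?_
  rw [← intervalIntegral.integral_const_mul]
  refine intervalIntegral.integral_congr fun θ _ => ?_
  simp only [Ds_eq_arcDeriv, real_inner_self_eq_norm_sq, invSpeed, inv_inv, mul_assoc]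

theorem MemSobolev.arcWeight (hn : 2 ≤ n) {c : ℝ → E d} (hc : MemSobolev n c)
    (h0 : ∀ θ, deriv c θ ≠ 0) : ArcWeight n (invSpeed c) := by
  obtain ⟨m, rfl⟩ : ∃ m, n = m + 2 := ⟨n - 2, by omega⟩
  have h1 : MemHs (m + 1) (deriv c) := (hc.memHs (by omega)).deriv
  refine ⟨fun θ => inv_pos.2 (norm_pos_iff.2 (h0 θ)),
    h1.continuous.norm.inv₀ fun θ => norm_ne_zero_iff.2 (h0 θ), fun θ => ?_, h1.norm_inv h0⟩
  have e : (fun x => c (x + 2 * Real.pi)) = c := funext hc.periodic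
  simp only [invSpeed]
  rw [← deriv_comp_add_const, e]

variable {c : ℝ → E d}

theorem IsLengthWeight.mul_energy_nonneg (ha : IsLengthWeight n a)
    (hc : ArcWeight n (invSpeed c)) (h : ℝ → E d) {j : ℕ} (hj : j ≤ n) :
    0 ≤ a j (len c) * arcEnergy (invSpeed c) j h :=
  mul_nonneg (ha.nonneg j hj _ (by rw [len_eq_arcLen]; exact hc.arcLen_pos))
    (hc.arcEnergy_nonneg j)

theorem IsLengthWeight.G_nonneg (ha : IsLengthWeight n a)
    (hc : ArcWeight n (invSpeed c)) (h : ℝ → E d) : 0 ≤ G n a c h h := by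
  rw [G_eq_sum]
  exact Finset.sum_nonneg fun j hj =>
    ha.mul_energy_nonneg hc h (Nat.lt_succ_iff.1 (Finset.mem_range.1 hj))

theorem IsLengthWeight.mul_energy_le_G (ha : IsLengthWeight n a)
    (hc : ArcWeight n (invSpeed c)) (h : ℝ → E d) {j : ℕ} (hj : j ≤ n) :
    a j (len c) * arcEnergy (invSpeed c) j h ≤ G n a c h h := by
  rw [G_eq_sum]
  exact Finset.single_le_sum (f := fun j => a j (len c) * arcEnergy (invSpeed c) j h)
    (fun j hj => ha.mul_energy_nonneg hc h (Nat.lt_succ_iff.1 (Finset.mem_range.1 hj)))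
    (Finset.mem_range.2 (Nat.lt_succ_iff.2 hj))

theorem normSqDs_eq (hc : ArcWeight n (invSpeed c)) {h : ℝ → E d} (hh : MemHs n h) :
    normSqDs n c h = arcEnergy (invSpeed c) 0 h + arcEnergy (invSpeed c) n h := by
  unfold normSqDs arcEnergy
  rw [← intervalIntegral.integral_add]
  · refine intervalIntegral.integral_congr fun θ _ => ?_
    simp only [Ds_eq_arcDeriv, invSpeed, inv_inv, Function.iterate_zero, id_eq, add_mul]
  · exact hc.intervalIntegrable_mul_inv (hc.memHs_iterate hh (Nat.zero_le n)).integrable_sq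
  · exact hc.intervalIntegrable_mul_inv (hc.memHs_iterate hh le_rfl).integrable_sq

/-- The inequality behind the length bounds: each of the weights `r^{1/2-k} √(a_k(r))` controls
the change `∫ |h'| dθ` of the length by the metric. -/
theorem IsLengthWeight.weight_mul_arcL1_le (ha : IsLengthWeight n a)
    (hc : ArcWeight n (invSpeed c)) {h : ℝ → E d} (hh : MemHs n h)
    (hper : Function.Periodic h (2 * Real.pi)) {k : ℕ} (hk : k ∈ Finset.Icc 1 n) :
    len c ^ ((1 : ℝ) / 2 - (k : ℝ)) * Real.sqrt (a k (len c)) * arcL1 (invSpeed c) 1 h ≤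
      Real.sqrt (G n a c h h) := by
  obtain ⟨hk1, hkn⟩ := Finset.mem_Icc.1 hk
  obtain ⟨i, rfl⟩ : ∃ i, k = 1 + i := ⟨k - 1, by omega⟩
  have hL : 0 < len c := by rw [len_eq_arcLen]; exact hc.arcLen_pos
  have h1 := hc.arcL1_le hh hper le_rfl hkn
  rw [← len_eq_arcLen, Real.sqrt_mul hL.le] at h1
  have h2 := ha.nonneg _ hkn _ hL
  have e : len c ^ ((1 : ℝ) / 2 - ((1 + i : ℕ) : ℝ)) * (len c ^ i * Real.sqrt (len c)) = 1 := by
    rw [Real.sqrt_eq_rpow, ← Real.rpow_natCast, ← Real.rpow_add hL, ← Real.rpow_add hL]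
    push_cast
    rw [show (1 : ℝ) / 2 - (1 + i) + (i + 1 / 2) = 0 by ring, Real.rpow_zero]
  calc _ ≤ len c ^ ((1 : ℝ) / 2 - ((1 + i : ℕ) : ℝ)) * Real.sqrt (a (1 + i) (len c)) *
        (len c ^ i * (Real.sqrt (len c) *
          Real.sqrt (arcEnergy (invSpeed c) (1 + i) h))) := by gcongr
    _ = (len c ^ ((1 : ℝ) / 2 - ((1 + i : ℕ) : ℝ)) * (len c ^ i * Real.sqrt (len c))) *
        (Real.sqrt (a (1 + i) (len c)) * Real.sqrt (arcEnergy (invSpeed c) (1 + i) h)) := by ring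
    _ = Real.sqrt (a (1 + i) (len c) * arcEnergy (invSpeed c) (1 + i) h) := by
        rw [e, one_mul, Real.sqrt_mul h2]
    _ ≤ _ := Real.sqrt_le_sqrt (ha.mul_energy_le_G hc h hkn)

end Metric

/-! ### Continuous seminorms on the Sobolev space -/

section Seminorms

variable {n d : ℕ}

theorem arcDeriv_one {V : Type*} [NormedAddCommGroup V] [NormedSpace ℝ V] :
    arcDeriv (V := V) (fun _ => (1 : ℝ)) = deriv := by
  funext u θ; simp [arcDeriv]

theorem SobolevH.integral_sq_le (h : SobolevH n d) :
    ∫ θ in (0 : ℝ)..(2 * Real.pi), ‖h θ‖ ^ 2 ≤ ‖h‖ ^ 2 := by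
  rw [norm_sq_eq]
  refine intervalIntegral.integral_mono_on Real.two_pi_pos.le ?_ ?_ fun θ _ =>
    le_add_of_nonneg_right (sq_nonneg _)
  · exact intervalIntegrable_circ ((memLp_two_iff_integrable_sq_norm
      h.2.memLp_self.aestronglyMeasurable).1 h.2.memLp_self)
  · refine intervalIntegrable_circ ((integrable_density h h).congr ?_)
    exact Filter.Eventually.of_forall fun θ => by simp only [real_inner_self_eq_norm_sq]

theorem SobolevH.integrable_iteratedDeriv_sq (h : SobolevH n d) :
    Integrable (fun θ => ‖iteratedDeriv n h θ‖ ^ 2) circ :=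
  (memLp_two_iff_integrable_sq_norm h.2.memLp.aestronglyMeasurable).1 h.2.memLp

theorem SobolevH.integral_iteratedDeriv_sq_le (h : SobolevH n d) :
    ∫ θ in (0 : ℝ)..(2 * Real.pi), ‖iteratedDeriv n h θ‖ ^ 2 ≤ ‖h‖ ^ 2 := by
  rw [norm_sq_eq]
  refine intervalIntegral.integral_mono_on Real.two_pi_pos.le ?_ ?_ fun θ _ =>
    le_add_of_nonneg_left (sq_nonneg _)
  · exact intervalIntegrable_circ h.integrable_iteratedDeriv_sq
  · refine intervalIntegrable_circ ((integrable_density h h).congr ?_)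
    exact Filter.Eventually.of_forall fun θ => by simp only [real_inner_self_eq_norm_sq]

/-- Sobolev's inequality. -/
theorem exists_norm_iteratedDeriv_le (n d : ℕ) : ∃ K : ℝ, 0 ≤ K ∧ ∀ h : SobolevH n d, ∀ k : ℕ,
    1 ≤ k → k < n → ∀ θ ∈ Icc 0 (2 * Real.pi), ‖iteratedDeriv k h θ‖ ≤ K * ‖h‖ := by
  have hw := arcWeight_one n
  have hL : arcLen (fun _ => (1 : ℝ)) = 2 * Real.pi := by simp [arcLen]
  have hpi : (1 : ℝ) ≤ 2 * Real.pi := by linarith [Real.pi_gt_three]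
  refine ⟨(2 * Real.pi) ^ n * Real.sqrt (2 * Real.pi), by positivity, fun h k hk hkn θ hθ => ?_⟩
  obtain ⟨i, hi⟩ : ∃ i, n = k + 1 + i := ⟨n - k - 1, by omega⟩
  have h1 := hw.norm_iterate_le (h.2.memHs (by omega)) h.2.periodic hk hi.ge hθ
  rw [hL, arcDeriv_one, ← iteratedDeriv_eq_iterate, Real.sqrt_mul Real.two_pi_pos.le] at h1
  have h2 : arcEnergy (fun _ => (1 : ℝ)) (k + 1 + i) h.1 ≤ ‖h‖ ^ 2 := by
    refine le_trans (le_of_eq ?_) h.integral_iteratedDeriv_sq_le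
    unfold arcEnergy
    simp only [arcDeriv_one, ← iteratedDeriv_eq_iterate, inv_one, mul_one, ← hi]
  have h3 : Real.sqrt (arcEnergy (fun _ => (1 : ℝ)) (k + 1 + i) h.1) ≤ ‖h‖ := by
    rw [← Real.sqrt_sq (norm_nonneg h)]
    exact Real.sqrt_le_sqrt h2
  have h4 : (2 * Real.pi) ^ i ≤ (2 * Real.pi) ^ n := pow_le_pow_right₀ hpi (by omega)
  calc _ ≤ (2 * Real.pi) ^ i * (Real.sqrt (2 * Real.pi) *
        Real.sqrt (arcEnergy (fun _ => (1 : ℝ)) (k + 1 + i) h.1)) := h1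
    _ ≤ (2 * Real.pi) ^ n * (Real.sqrt (2 * Real.pi) * ‖h‖) := by gcongr
    _ = _ := by ring

theorem SobolevH.contDiffAt (h : SobolevH n d) {k : ℕ} (hk : k < n) (θ : ℝ) :
    ContDiffAt ℝ k h θ :=
  (h.2.contDiff.of_le (by exact_mod_cast Nat.le_sub_one_of_lt hk)).contDiffAt

/-- The seminorm `h ↦ |h^{(k)}(θ)|`. -/
noncomputable def derivSeminorm (n d : ℕ) {k : ℕ} (hk : k < n) (θ : ℝ) :
    Seminorm ℝ (SobolevH n d) :=
  Seminorm.of (fun h => ‖iteratedDeriv k h θ‖)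
    (fun u v => by
      have e : iteratedDeriv k (u + v : SobolevH n d).1 θ =
          iteratedDeriv k u.1 θ + iteratedDeriv k v.1 θ :=
        iteratedDeriv_add (u.contDiffAt hk θ) (v.contDiffAt hk θ)
      rw [e]
      exact norm_add_le _ _)
    (fun r u => by
      have e : iteratedDeriv k (r • u : SobolevH n d).1 θ = r • iteratedDeriv k u.1 θ :=
        congrFun (iteratedDeriv_smul_eq k r u.1) θ
      rw [e, norm_smul])

theorem continuous_derivSeminorm {k : ℕ} (h1 : 1 ≤ k) (hk : k < n) {θ : ℝ}
    (hθ : θ ∈ Icc 0 (2 * Real.pi)) : Continuous (derivSeminorm n d hk θ) := by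
  obtain ⟨K, -, hK⟩ := exists_norm_iteratedDeriv_le n d
  exact continuous_seminorm_of_le fun h => hK h k h1 hk θ hθ

theorem SobolevH.continuous_deriv (hn : 2 ≤ n) (h : SobolevH n d) : Continuous (deriv h) :=
  (h.2.contDiff.continuous_deriv (by exact_mod_cast (by omega : 1 ≤ n - 1)))

theorem SobolevH.differentiable (hn : 2 ≤ n) (h : SobolevH n d) : Differentiable ℝ h :=
  h.2.contDiff.differentiable (by
    have : (n - 1 : ℕ) ≠ 0 := by omega
    exact_mod_cast this)

/-- The seminorm `h ↦ ∫ |h'| dθ`, whose value at a curve is its length. -/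
noncomputable def lengthSeminorm (d : ℕ) (hn : 2 ≤ n) : Seminorm ℝ (SobolevH n d) :=
  Seminorm.of (fun h => len h)
    (fun u v => by
      have e : ∀ θ, deriv (u + v : SobolevH n d).1 θ = deriv u.1 θ + deriv v.1 θ := fun θ =>
        deriv_add (u.differentiable hn θ) (v.differentiable hn θ)
      unfold len
      rw [← intervalIntegral.integral_add ((u.continuous_deriv hn).norm.intervalIntegrable _ _)
        ((v.continuous_deriv hn).norm.intervalIntegrable _ _)]
      refine intervalIntegral.integral_mono_on Real.two_pi_pos.le
        (((u + v).continuous_deriv hn).norm.intervalIntegrable _ _)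
        (((u.continuous_deriv hn).norm.add (v.continuous_deriv hn).norm).intervalIntegrable _ _)
        fun θ _ => ?_
      rw [e]
      exact norm_add_le _ _)
    (fun r u => by
      have e : ∀ θ, deriv (r • u : SobolevH n d).1 θ = r • deriv u.1 θ := fun θ => by
        have := congrFun (iteratedDeriv_smul_eq 1 r u.1) θ
        rwa [iteratedDeriv_one, iteratedDeriv_one] at this
      unfold len
      rw [← intervalIntegral.integral_const_mul]
      refine intervalIntegral.integral_congr fun θ _ => ?_
      simp only [e, norm_smul])

theorem continuous_lengthSeminorm (hn : 2 ≤ n) : Continuous (lengthSeminorm d hn) := by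
  obtain ⟨K, -, hK⟩ := exists_norm_iteratedDeriv_le n d
  refine continuous_seminorm_of_le (C := 2 * Real.pi * K) fun h => ?_
  have : len h ≤ ∫ _ in (0 : ℝ)..(2 * Real.pi), K * ‖h‖ := by
    refine intervalIntegral.integral_mono_on Real.two_pi_pos.le
      ((h.continuous_deriv hn).norm.intervalIntegrable _ _) (by simp) fun θ hθ => ?_
    have := hK h 1 le_rfl (by omega) θ hθ
    rwa [iteratedDeriv_one] at this
  refine this.trans (le_of_eq ?_)
  rw [intervalIntegral.integral_const, smul_eq_mul, sub_zero]
  ring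

end Seminorms

/-! ### Bounds on geodesic balls -/

section Reach

variable {n d : ℕ} {a : ℕ → ℝ → ℝ} {c₀ : SobolevH n d} {R : ℝ}

/-- The curves that lie on some path of length less than `R` starting at `c₀`. Working with this
set rather than with the ball allows to use a bound at all times of a path without
reparametrizing its initial segments. -/
def reach (n : ℕ) (a : ℕ → ℝ → ℝ) {d : ℕ} (c₀ : SobolevH n d) (R : ℝ) : Set (SobolevH n d) :=
  {c | ∃ (c₁ : SobolevH n d) (γ : ℝ → SobolevH n d), IsPath c₀ c₁ γ ∧
    pathLen n a γ < ENNReal.ofReal R ∧ ∃ t ∈ Icc (0 : ℝ) 1, γ t = c}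

theorem geoBall_subset_reach : geoBall n a c₀ R ⊆ reach n a c₀ R := by
  rintro c ⟨-, hc⟩
  obtain ⟨γ, hγ⟩ := iInf_lt_iff.1 hc
  obtain ⟨hp, hγ⟩ := iInf_lt_iff.1 hγ
  exact ⟨c, γ, hp, hγ, 1, ⟨zero_le_one, le_rfl⟩, hp.target⟩

theorem reach_subset_sobolevImm : reach n a c₀ R ⊆ sobolevImm n d := by
  rintro c ⟨c₁, γ, hp, -, t, ht, rfl⟩
  exact hp.mem t ht

/-- A seminorm that the metric controls up to a factor linear in its value at the curve is bounded
on geodesic balls. -/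
theorem seminorm_le_of_mem_reach {q : Seminorm ℝ (SobolevH n d)} (hq : Continuous q) {K : ℝ}
    (hK : 0 ≤ K) (hR : 0 ≤ R) (h : ∀ c ∈ reach n a c₀ R, ∀ h : SobolevH n d,
      q h ≤ K * Real.sqrt (G n a c h h) * (1 + q c)) :
    ∀ c ∈ reach n a c₀ R, q c ≤ (1 + q c₀) * Real.exp (K * R) := by
  rintro c ⟨c₁, γ, hp, hl, t, ht, rfl⟩
  rw [← hp.source]
  exact seminorm_le_of_path hp.contDiffOn hq hK hR
    (fun s hs => h _ ⟨c₁, γ, hp, hl, s, hs, rfl⟩ _) hl.le t ht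

theorem seminorm_bounds_of_mem_reach {q : Seminorm ℝ (SobolevH n d)} (hq : Continuous q) {K : ℝ}
    (hK : 0 ≤ K) (hR : 0 ≤ R) (hpos : ∀ c ∈ reach n a c₀ R, 0 < q c)
    (h : ∀ c ∈ reach n a c₀ R, ∀ h : SobolevH n d,
      q h ≤ K * Real.sqrt (G n a c h h) * q c) :
    ∀ c ∈ reach n a c₀ R, q c ≤ q c₀ * Real.exp (K * R) ∧ q c₀ ≤ q c * Real.exp (K * R) := by
  rintro c ⟨c₁, γ, hp, hl, t, ht, rfl⟩
  rw [← hp.source]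
  exact seminorm_bounds_of_path hp.contDiffOn hq
    (fun s hs => hpos _ ⟨c₁, γ, hp, hl, s, hs, rfl⟩) hK hR
    (fun s hs => h _ ⟨c₁, γ, hp, hl, s, hs, rfl⟩ _) hl.le t ht

theorem arcWeight_of_mem_reach (hn : 2 ≤ n) {c : SobolevH n d} (hc : c ∈ reach n a c₀ R) :
    ArcWeight n (invSpeed c) :=
  c.2.arcWeight hn (reach_subset_sobolevImm hc)

theorem SobolevH.memHs (hn : 2 ≤ n) (h : SobolevH n d) : MemHs n h := h.2.memHs (by omega)

theorem len_pos_of_mem_reach (hn : 2 ≤ n) {c : SobolevH n d} (hc : c ∈ reach n a c₀ R) :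
    0 < len c := by
  rw [len_eq_arcLen]; exact (arcWeight_of_mem_reach hn hc).arcLen_pos

/-- The weight `r^{1/2-k} √(a_k(r))`. -/
noncomputable def lengthWeight (a : ℕ → ℝ → ℝ) (k : ℕ) (r : ℝ) : ℝ :=
  r ^ ((1 : ℝ) / 2 - (k : ℝ)) * Real.sqrt (a k r)

theorem continuousOn_lengthWeight (ha : IsLengthWeight n a) {k : ℕ} (hk : k ≤ n) :
    ContinuousOn (lengthWeight a k) (Ioi 0) :=
  (continuousOn_id.rpow_const fun _ hx => Or.inl (ne_of_gt hx)).mul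
    (ha.smooth k hk).continuousOn.sqrt

theorem lengthWeight_nonneg {k : ℕ} {r : ℝ} (hr : 0 < r) : 0 ≤ lengthWeight a k r :=
  mul_nonneg (Real.rpow_nonneg hr.le _) (Real.sqrt_nonneg _)

/-- The primitives of the weights `r^{1/2-k} √(a_k(r))`, as functions of the length, are Lipschitz
for the geodesic distance. -/
theorem abs_integral_lengthWeight_le (hn : 2 ≤ n) (ha : IsLengthWeight n a)
    (hc₀ : c₀ ∈ sobolevImm n d) (hR : 0 ≤ R) {k : ℕ} (hk : k ∈ Finset.Icc 1 n)
    {c : SobolevH n d} (hc : c ∈ reach n a c₀ R) :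
    |∫ r in len c₀..len c, lengthWeight a k r| ≤ R := by
  obtain ⟨c₁, γ, hp, hl, t, ht, rfl⟩ := hc
  have hreach : ∀ s ∈ Icc (0 : ℝ) 1, γ s ∈ reach n a c₀ R :=
    fun s hs => ⟨c₁, γ, hp, hl, s, hs, rfl⟩
  have hkn := (Finset.mem_Icc.1 hk).2
  have hw := continuousOn_lengthWeight ha hkn
  have h0 : 0 < len c₀ := by
    rw [len_eq_arcLen]; exact (c₀.2.arcWeight hn hc₀).arcLen_pos
  have hq : ∀ h : SobolevH n d, lengthSeminorm d hn h = len h := fun _ => rfl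
  have key := abs_sub_le_of_path hp.contDiffOn (continuous_lengthSeminorm hn)
    (P := fun x => ∫ r in len c₀..x, lengthWeight a k r)
    (p := fun s => lengthWeight a k (len (γ s)))
    (g := fun s => Real.sqrt (G n a (γ s) (derivWithin γ (Icc 0 1) s : SobolevH n d)
      (derivWithin γ (Icc 0 1) s : SobolevH n d)))
    (K := 1) (R := R)
    (hw.comp ((continuous_lengthSeminorm hn).comp_continuousOn hp.contDiffOn.continuousOn)
      fun s hs => len_pos_of_mem_reach hn (hreach s hs))
    (fun s hs => hasDerivAt_integral_of_pos hw h0 (len_pos_of_mem_reach hn (hreach s hs)))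
    zero_le_one hR
    (fun s hs => by
      have h1 := ha.weight_mul_arcL1_le (arcWeight_of_mem_reach hn (hreach s hs))
        ((derivWithin γ (Icc 0 1) s).memHs hn) (derivWithin γ (Icc 0 1) s).2.periodic hk
      have hpos := lengthWeight_nonneg (a := a) (k := k) (len_pos_of_mem_reach hn (hreach s hs))
      rw [one_mul, abs_of_nonneg hpos]
      refine le_trans (le_of_eq ?_) h1
      unfold lengthWeight
      congr 1
      have hW := arcWeight_of_mem_reach hn (hreach s hs)
      change len (derivWithin γ (Icc 0 1) s : SobolevH n d) = _
      unfold len arcL1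
      simp only [hW.norm_deriv, Function.iterate_one]) hl.le t ht
  rw [hp.source, hq, hq, one_mul] at key
  simpa using key

/-- The length is bounded above and away from zero on geodesic balls. -/
theorem exists_len_bounds (hn : 2 ≤ n) (ha : IsLengthWeight n a)
    (h_zero : CondZero n a) (h_infty : CondInfty n a) (hc₀ : c₀ ∈ sobolevImm n d) (hR : 0 ≤ R) :
    ∃ l L : ℝ, 0 < l ∧ ∀ c ∈ reach n a c₀ R, len c ∈ Icc l L := by
  have hne : (Finset.Icc 1 n).Nonempty := ⟨1, Finset.mem_Icc.2 ⟨le_rfl, by omega⟩⟩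
  have h0 : 0 < len c₀ := by
    rw [len_eq_arcLen]; exact (c₀.2.arcWeight hn hc₀).arcLen_pos
  obtain ⟨k, hk, hk'⟩ := Finset.exists_mem_eq_sup _ hne fun k => weightIntegral a k (Ioc 0 1)
  obtain ⟨j, hj, hj'⟩ := Finset.exists_mem_eq_sup _ hne fun k => weightIntegral a k (Ici 1)
  obtain ⟨l, hl, hl'⟩ := exists_lower_bound_of_lintegral_eq_top
    (continuousOn_lengthWeight ha (Finset.mem_Icc.1 hk).2) (fun _ hr => lengthWeight_nonneg hr)
    (hk'.symm.trans h_zero) h0 R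
  obtain ⟨L, -, hL'⟩ := exists_upper_bound_of_lintegral_eq_top
    (continuousOn_lengthWeight ha (Finset.mem_Icc.1 hj).2) (fun _ hr => lengthWeight_nonneg hr)
    (hj'.symm.trans h_infty) h0 R
  refine ⟨l, L, hl, fun c hc => ⟨?_, ?_⟩⟩
  · refine hl' _ (len_pos_of_mem_reach hn hc) ?_
    have := (abs_le.1 (abs_integral_lengthWeight_le hn ha hc₀ hR hk hc)).1
    rw [intervalIntegral.integral_symm]
    linarith
  · exact hL' _ (len_pos_of_mem_reach hn hc)
      (abs_le.1 (abs_integral_lengthWeight_le hn ha hc₀ hR hj hc)).2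

/-- The coefficients `a_0` and `a_n` are bounded below and all coefficients are bounded above on
compact intervals of lengths. -/
theorem IsLengthWeight.exists_bounds (ha : IsLengthWeight n a) {l : ℝ} (hl : 0 < l) (L : ℝ) :
    ∃ μ A : ℝ, 0 < μ ∧ 0 ≤ A ∧ ∀ r ∈ Icc l L, μ ≤ a 0 r ∧ μ ≤ a n r ∧ ∀ j ≤ n, a j r ≤ A := by
  have hsub : Icc l L ⊆ Ioi 0 := fun r hr => hl.trans_le hr.1
  have hc : ∀ j ≤ n, ContinuousOn (a j) (Icc l L) := fun j hj =>
    (ha.smooth j hj).continuousOn.mono hsub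
  have low : ∀ j ≤ n, (∀ r, 0 < r → 0 < a j r) → ∃ μ, 0 < μ ∧ ∀ r ∈ Icc l L, μ ≤ a j r := by
    intro j hj hpos
    rcases (Icc l L).eq_empty_or_nonempty with h | h
    · exact ⟨1, one_pos, by simp [h]⟩
    · obtain ⟨x, hx, hx'⟩ := isCompact_Icc.exists_isMinOn h (hc j hj)
      exact ⟨a j x, hpos x (hsub hx), fun r hr => hx' hr⟩
  have up : ∃ A, 0 ≤ A ∧ ∀ r ∈ Icc l L, ∀ j ≤ n, a j r ≤ A := by
    have h1 : ∀ j ≤ n, ∃ A, ∀ r ∈ Icc l L, a j r ≤ A := fun j hj => by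
      obtain ⟨A, hA⟩ := isCompact_Icc.exists_bound_of_continuousOn (hc j hj)
      exact ⟨A, fun r hr => (le_abs_self _).trans (hA r hr)⟩
    choose! B hB using h1
    refine ⟨∑ j ∈ Finset.range (n + 1), |B j|, Finset.sum_nonneg fun _ _ => abs_nonneg _,
      fun r hr j hj => ((hB j hj r hr).trans (le_abs_self _)).trans ?_⟩
    exact Finset.single_le_sum (f := fun j => |B j|) (fun _ _ => abs_nonneg _)
      (Finset.mem_range.2 (Nat.lt_succ_iff.2 hj))
  obtain ⟨μ, hμ, h1⟩ := low 0 (Nat.zero_le _) ha.pos_zero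
  obtain ⟨ν, hν, h2⟩ := low n le_rfl ha.pos_top
  obtain ⟨A, hA, h3⟩ := up
  exact ⟨min μ ν, A, lt_min hμ hν, hA, fun r hr => ⟨(min_le_left _ _).trans (h1 r hr),
    (min_le_right _ _).trans (h2 r hr), h3 r hr⟩⟩

/-- On geodesic balls the metric is uniformly comparable with the energies: `G` dominates the
energies of order `0` and `n`, and is dominated by the sum of all of them. -/
theorem exists_energy_bounds (hn : 2 ≤ n) (ha : IsLengthWeight n a)
    (h_zero : CondZero n a) (h_infty : CondInfty n a) (hc₀ : c₀ ∈ sobolevImm n d) (hR : 0 ≤ R) :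
    ∃ C L : ℝ, 0 < C ∧ 0 ≤ L ∧ ∀ c ∈ reach n a c₀ R, len c ≤ L ∧ ∀ h : SobolevH n d,
      arcEnergy (invSpeed c) 0 h + arcEnergy (invSpeed c) n h ≤ C * G n a c h h ∧
      G n a c h h ≤ C * ∑ j ∈ Finset.range (n + 1), arcEnergy (invSpeed c) j h := by
  obtain ⟨l, L, hl, hlen⟩ := exists_len_bounds hn ha h_zero h_infty hc₀ hR
  obtain ⟨μ, A, hμ, hA, hb⟩ := ha.exists_bounds hl L
  refine ⟨2 * μ⁻¹ + A, max L 0, by positivity, le_max_right _ _, fun c hc =>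
    ⟨(hlen c hc).2.trans (le_max_left _ _), fun h => ?_⟩⟩
  obtain ⟨b0, bn, bA⟩ := hb _ (hlen c hc)
  have hW := arcWeight_of_mem_reach hn hc
  have hG := ha.G_nonneg hW h
  have e0 : 0 ≤ arcEnergy (invSpeed c) 0 h := hW.arcEnergy_nonneg 0
  have en : 0 ≤ arcEnergy (invSpeed c) n h := hW.arcEnergy_nonneg n
  constructor
  · have h1 : μ * arcEnergy (invSpeed c) 0 h ≤ G n a c h h :=
      (mul_le_mul_of_nonneg_right b0 e0).trans (ha.mul_energy_le_G hW h (Nat.zero_le n))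
    have h2 : μ * arcEnergy (invSpeed c) n h ≤ G n a c h h :=
      (mul_le_mul_of_nonneg_right bn en).trans (ha.mul_energy_le_G hW h le_rfl)
    rw [← le_inv_mul_iff₀ hμ] at h1 h2
    nlinarith [mul_nonneg hA hG]
  · rw [G_eq_sum, Finset.mul_sum]
    refine Finset.sum_le_sum fun j hj => ?_
    refine mul_le_mul_of_nonneg_right ?_ (hW.arcEnergy_nonneg j)
    refine (bA j (Nat.lt_succ_iff.1 (Finset.mem_range.1 hj))).trans ?_
    have : 0 < μ⁻¹ := inv_pos.2 hμ
    linarith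

/-- On geodesic balls the metric controls the arc length derivatives of intermediate orders
pointwise. -/
theorem exists_norm_iterate_le (hn : 2 ≤ n) (ha : IsLengthWeight n a)
    (h_zero : CondZero n a) (h_infty : CondInfty n a) (hc₀ : c₀ ∈ sobolevImm n d) (hR : 0 ≤ R) :
    ∃ K : ℝ, 0 ≤ K ∧ ∀ c ∈ reach n a c₀ R, ∀ h : SobolevH n d, ∀ j : ℕ, 1 ≤ j → j < n →
      ∀ θ ∈ Icc 0 (2 * Real.pi),
      ‖((arcDeriv (invSpeed c))^[j] h) θ‖ ≤ K * Real.sqrt (G n a c h h) := by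
  obtain ⟨C, L, hC, hL, hb⟩ := exists_energy_bounds hn ha h_zero h_infty hc₀ hR
  refine ⟨max 1 L ^ n * Real.sqrt (L * C), by positivity, fun c hc h j hj hjn θ hθ => ?_⟩
  obtain ⟨i, hi⟩ : ∃ i, n = j + 1 + i := ⟨n - j - 1, by omega⟩
  obtain ⟨hlen, hen⟩ := hb c hc
  have hW := arcWeight_of_mem_reach hn hc
  have h1 := hW.norm_iterate_le (h.memHs hn) h.2.periodic hj hi.ge hθ
  rw [← len_eq_arcLen, ← hi] at h1
  have e0 : 0 ≤ arcEnergy (invSpeed c) 0 h := hW.arcEnergy_nonneg 0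
  have en : 0 ≤ arcEnergy (invSpeed c) n h := hW.arcEnergy_nonneg n
  have h2 : arcEnergy (invSpeed c) n h ≤ C * G n a c h h := by linarith [(hen h).1]
  have hl0 := (len_pos_of_mem_reach hn hc).le
  have h3 : len c ^ i ≤ max 1 L ^ n :=
    (pow_le_pow_left₀ hl0 (hlen.trans (le_max_right _ _)) i).trans
      (pow_le_pow_right₀ (le_max_left _ _) (by omega))
  have h4 : len c * arcEnergy (invSpeed c) n h ≤ L * C * G n a c h h := by
    rw [mul_assoc]; gcongr
  calc _ ≤ len c ^ i * Real.sqrt (len c * arcEnergy (invSpeed c) n h) := h1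
    _ ≤ max 1 L ^ n * Real.sqrt (L * C * G n a c h h) := by gcongr
    _ = _ := by rw [Real.sqrt_mul (by positivity), mul_assoc]

/-- The speed is bounded above and away from zero on geodesic balls. -/
theorem exists_speed_bounds (hn : 2 ≤ n) (ha : IsLengthWeight n a)
    (h_zero : CondZero n a) (h_infty : CondInfty n a) (hc₀ : c₀ ∈ sobolevImm n d) (hR : 0 ≤ R) :
    ∃ M : ℝ, ∀ c ∈ reach n a c₀ R, ∀ θ ∈ Icc 0 (2 * Real.pi),
      ‖deriv c θ‖ ≤ M ∧ ‖deriv c θ‖⁻¹ ≤ M := by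
  obtain ⟨K, hK, hb⟩ := exists_norm_iterate_le hn ha h_zero h_infty hc₀ hR
  obtain ⟨M₁, hM₁⟩ := isCompact_Icc.exists_bound_of_continuousOn
    (c₀.continuous_deriv hn).norm.continuousOn (s := Icc 0 (2 * Real.pi))
  have hinv : Continuous fun θ => ‖deriv c₀ θ‖⁻¹ := (c₀.2.arcWeight hn hc₀).continuous
  obtain ⟨M₂, hM₂⟩ := isCompact_Icc.exists_bound_of_continuousOn
    hinv.continuousOn (s := Icc 0 (2 * Real.pi))
  refine ⟨max (M₁ * Real.exp (K * R)) (M₂ * Real.exp (K * R)), fun c hc θ hθ => ?_⟩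
  have hq : ∀ h : SobolevH n d, derivSeminorm n d (by omega : 1 < n) θ h = ‖deriv h θ‖ :=
    fun h => by
      change ‖iteratedDeriv 1 h θ‖ = _
      rw [iteratedDeriv_one]
  have key := seminorm_bounds_of_mem_reach
    (continuous_derivSeminorm le_rfl (by omega : 1 < n) hθ) hK hR
    (fun c hc => by
      rw [hq]; exact norm_pos_iff.2 (reach_subset_sobolevImm hc θ))
    (fun c hc h => by
      rw [hq, hq, (arcWeight_of_mem_reach hn hc).norm_deriv]
      have := hb c hc h 1 le_rfl (by omega) θ hθ
      simp only [invSpeed, inv_inv]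
      exact mul_le_mul_of_nonneg_right this (norm_nonneg _)) c hc
  rw [hq, hq] at key
  have p0 := norm_pos_iff.2 (hc₀ θ)
  have p1 := norm_pos_iff.2 (reach_subset_sobolevImm hc θ)
  have hexp := Real.exp_pos (K * R)
  constructor
  · refine key.1.trans (le_trans ?_ (le_max_left _ _))
    have := hM₁ θ hθ
    rw [norm_norm] at this
    gcongr
  · refine le_trans ?_ (le_max_right _ _)
    have := hM₂ θ hθ
    rw [norm_inv, norm_norm] at this
    calc ‖deriv c θ‖⁻¹ ≤ ‖deriv c₀ θ‖⁻¹ * Real.exp (K * R) := by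
          rw [inv_mul_eq_div, le_div_iff₀ p0, inv_mul_le_iff₀ p1]
          exact key.2
      _ ≤ _ := by gcongr

end Reach

/-! ### Bounds for higher derivatives on geodesic balls -/

section Higher

variable {n d : ℕ} {a : ℕ → ℝ → ℝ} {c₀ : SobolevH n d} {R : ℝ}

theorem norm_iterate_le_arcJet {V : Type*} [NormedAddCommGroup V] [NormedSpace ℝ V] {p : ℝ → ℝ}
    {θ : ℝ} {u : ℝ → V} {i m : ℕ} (hi : i ≤ m) :
    ‖((arcDeriv p)^[i] u) θ‖ ≤ arcJet p θ m u := by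
  induction hi with
  | refl =>
    rcases i with _ | i
    · exact le_rfl
    · rw [arcJet_succ_eq]; exact le_add_of_nonneg_left arcJet_nonneg
  | step _ ih => exact ih.trans arcJet_le_succ

theorem norm_iteratedDeriv_le_jet {V : Type*} [NormedAddCommGroup V] [NormedSpace ℝ V]
    {θ : ℝ} {u : ℝ → V} {m : ℕ} : ‖iteratedDeriv (m + 1) u θ‖ ≤ jet θ (m + 1) u := by
  rw [jet_succ_eq]; exact le_add_of_nonneg_left jet_nonneg

theorem jet_deriv_le_of_forall {V : Type*} [NormedAddCommGroup V] [NormedSpace ℝ V]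
    {θ B : ℝ} {u : ℝ → V} {m : ℕ} (h : ∀ j, 1 ≤ j → j ≤ m + 1 → ‖iteratedDeriv j u θ‖ ≤ B) :
    jet θ m (deriv u) ≤ (m + 1) * B := by
  induction m with
  | zero => simpa [jet, iteratedDeriv_one] using h 1 le_rfl le_rfl
  | succ m ih =>
    rw [jet_succ_eq, ← iteratedDeriv_succ']
    have h1 := ih fun j hj hjm => h j hj (by omega)
    have h2 := h (m + 2) (by omega) le_rfl
    push_cast
    linarith

theorem arcJet_arcDeriv_le_of_forall {V : Type*} [NormedAddCommGroup V] [NormedSpace ℝ V]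
    {p : ℝ → ℝ} {θ B : ℝ} {u : ℝ → V} {m : ℕ}
    (h : ∀ j, 1 ≤ j → j ≤ m + 1 → ‖((arcDeriv p)^[j] u) θ‖ ≤ B) :
    arcJet p θ m (arcDeriv p u) ≤ (m + 1) * B := by
  induction m with
  | zero => simpa [arcJet] using h 1 le_rfl le_rfl
  | succ m ih =>
    rw [arcJet_succ_eq, ← Function.iterate_succ_apply]
    have h1 := ih fun j hj hjm => h j hj (by omega)
    have h2 := h (m + 2) (by omega) le_rfl
    push_cast
    linarith

/-- The derivatives of order between `1` and `n - 1` of the curves in a geodesic ball are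
uniformly bounded. Each of them solves, pointwise in `θ`, a linear differential inequality whose
coefficients are controlled by the derivatives of lower order. -/
theorem exists_jetBound (hn : 2 ≤ n) (ha : IsLengthWeight n a)
    (h_zero : CondZero n a) (h_infty : CondInfty n a) (hc₀ : c₀ ∈ sobolevImm n d) (hR : 0 ≤ R)
    {m : ℕ} (hm : m + 2 ≤ n) :
    ∃ M : ℝ, ∀ c ∈ reach n a c₀ R, ∀ θ ∈ Icc 0 (2 * Real.pi), JetBound θ M m (deriv c) := by
  induction m with
  | zero =>
    obtain ⟨M, hM⟩ := exists_speed_bounds hn ha h_zero h_infty hc₀ hR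
    exact ⟨M, fun c hc θ hθ => ⟨reach_subset_sobolevImm hc, (hM c hc θ hθ).2, (hM c hc θ hθ).1⟩⟩
  | succ m ih =>
    obtain ⟨M, hM⟩ := ih (by omega)
    obtain ⟨K, hK, hb⟩ := exists_norm_iterate_le hn ha h_zero h_infty hc₀ hR
    obtain ⟨C, hC, hCb⟩ := exists_jet_deriv_le (E d) m M
    have hmn : m + 2 < n := by omega
    have hdiff : ∀ h : SobolevH n d, ∀ θ, DiffUpTo θ (m + 2) h := fun h θ =>
      ((h.memHs hn).mono (by omega : m + 3 ≤ n)).diffUpTo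
    obtain ⟨B, hB⟩ := isCompact_Icc.exists_bound_of_continuousOn
      ((contDiff_iff_contDiffAt.2 (c₀.contDiffAt hmn)).continuous_iteratedDeriv
        (m + 2) le_rfl).continuousOn (s := Icc 0 (2 * Real.pi))
    set K' := C * ((m + 2) * K + (m + 1) * K) * (1 + |M|) with hK'
    have hK'0 : 0 ≤ K' := by positivity
    set N := M + (1 + B) * Real.exp (K' * R)
    have key : ∀ c ∈ reach n a c₀ R, ∀ θ ∈ Icc 0 (2 * Real.pi),
        jet θ (m + 1) (deriv c) ≤ N := by
      intro c hc θ hθ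
      have h1 := seminorm_le_of_mem_reach (a := a) (c₀ := c₀)
        (continuous_derivSeminorm (d := d) (by omega : 1 ≤ m + 2) hmn hθ) hK'0 hR ?_ c hc
      · change ‖iteratedDeriv (m + 2) c θ‖ ≤ (1 + ‖iteratedDeriv (m + 2) c₀ θ‖) * _ at h1
        rw [jet_succ_eq, ← iteratedDeriv_succ']
        have h2 := hB θ hθ
        refine add_le_add (hM c hc θ hθ).jet_le (h1.trans ?_)
        gcongr
      · intro c hc h
        change ‖iteratedDeriv (m + 2) h θ‖ ≤
          K' * Real.sqrt (G n a c h h) * (1 + ‖iteratedDeriv (m + 2) c θ‖)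
        have hJ := hM c hc θ hθ
        have i1 : arcJet (invSpeed c) θ (m + 1) (arcDeriv (invSpeed c) h) ≤
            ((m + 1 : ℕ) + 1) * (K * Real.sqrt (G n a c h h)) :=
          arcJet_arcDeriv_le_of_forall fun j hj hjm => hb c hc h j hj (by omega) θ hθ
        have i2 : arcJet (invSpeed c) θ m (arcDeriv (invSpeed c) h) ≤
            (m + 1) * (K * Real.sqrt (G n a c h h)) :=
          arcJet_arcDeriv_le_of_forall fun j hj hjm => hb c hc h j hj (by omega) θ hθ
        have i3 : jet θ (m + 1) (deriv h) ≤ C * (arcJet (invSpeed c) θ (m + 1)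
            (arcDeriv (invSpeed c) h) + jet θ (m + 1) (deriv c) *
            arcJet (invSpeed c) θ m (arcDeriv (invSpeed c) h)) :=
          hCb (deriv c) h θ hJ (hdiff c θ).2 (hdiff h θ)
        have i4 : jet θ (m + 1) (deriv c) ≤ |M| + ‖iteratedDeriv (m + 2) c θ‖ := by
          rw [jet_succ_eq, ← iteratedDeriv_succ']
          exact add_le_add (hJ.jet_le.trans (le_abs_self M)) le_rfl
        rw [iteratedDeriv_succ']
        refine norm_iteratedDeriv_le_jet.trans (i3.trans ?_)
        set S := Real.sqrt (G n a c h h)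
        have hS : 0 ≤ S := Real.sqrt_nonneg _
        set x := ‖iteratedDeriv (m + 2) c θ‖
        have hx : 0 ≤ x := norm_nonneg _
        have hM0 := abs_nonneg M
        have j6 : 0 ≤ arcJet (invSpeed c) θ m (arcDeriv (invSpeed c) h) := arcJet_nonneg
        push_cast at i1
        have k1 : 1 ≤ (1 + |M|) * (1 + x) := by nlinarith [mul_nonneg hM0 hx]
        have k2 : |M| + x ≤ (1 + |M|) * (1 + x) := by nlinarith [mul_nonneg hM0 hx]
        calc _ ≤ C * (((m + 1 + 1) * (K * S)) * 1 + (|M| + x) * ((m + 1) * (K * S))) := by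
              rw [mul_one]; gcongr
          _ ≤ C * (((m + 1 + 1) * (K * S)) * ((1 + |M|) * (1 + x)) +
              ((1 + |M|) * (1 + x)) * ((m + 1) * (K * S))) := by gcongr
          _ = _ := by rw [hK']; ring
    refine ⟨max M N, fun c hc θ hθ => ⟨reach_subset_sobolevImm hc,
      (hM c hc θ hθ).inv_le.trans (le_max_left _ _), (key c hc θ hθ).trans (le_max_right _ _)⟩⟩

/-- Integrated form of a pointwise bound `f ≤ C (X + X v + g)`; it serves with `v = |c^{(n)}|`. -/
theorem integral_sq_le_of_ae_le {f v g : ℝ → ℝ} (hf : Integrable (fun θ => f θ ^ 2) circ)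
    (hv : Integrable (fun θ => v θ ^ 2) circ) (hg : Integrable (fun θ => g θ ^ 2) circ)
    (hf0 : ∀ θ, 0 ≤ f θ) {C X : ℝ} (h : ∀ᵐ θ ∂circ, f θ ≤ C * (X + X * v θ + g θ)) :
    ∫ θ in (0 : ℝ)..(2 * Real.pi), f θ ^ 2 ≤
      3 * C ^ 2 * (X ^ 2 * (2 * Real.pi) + X ^ 2 * (∫ θ in (0 : ℝ)..(2 * Real.pi), v θ ^ 2) +
        ∫ θ in (0 : ℝ)..(2 * Real.pi), g θ ^ 2) := by
  have h1 : ∫ θ in (0 : ℝ)..(2 * Real.pi), f θ ^ 2 ≤ ∫ θ in (0 : ℝ)..(2 * Real.pi),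
      3 * C ^ 2 * (X ^ 2 + X ^ 2 * v θ ^ 2 + g θ ^ 2) := by
    simp only [intervalIntegral.integral_of_le Real.two_pi_pos.le]
    refine integral_mono_ae hf ?_ ?_
    · exact (((integrable_const _).add (hv.const_mul _)).add hg).const_mul _
    · filter_upwards [h] with θ hθ
      have h2 : f θ ^ 2 ≤ (C * (X + X * v θ + g θ)) ^ 2 := pow_le_pow_left₀ (hf0 θ) hθ 2
      have h3 : (X + X * v θ + g θ) ^ 2 ≤ 3 * (X ^ 2 + X ^ 2 * v θ ^ 2 + g θ ^ 2) := by
        nlinarith [sq_nonneg (X - X * v θ), sq_nonneg (X - g θ), sq_nonneg (X * v θ - g θ)]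
      rw [mul_pow] at h2
      nlinarith [mul_le_mul_of_nonneg_left h3 (sq_nonneg C)]
  refine h1.trans (le_of_eq ?_)
  have i1 : IntervalIntegrable (fun _ : ℝ => X ^ 2) volume 0 (2 * Real.pi) := by simp
  have i2 := (intervalIntegrable_circ hv).const_mul (X ^ 2)
  rw [intervalIntegral.integral_const_mul, intervalIntegral.integral_add (i1.add i2)
    (intervalIntegrable_circ hg), intervalIntegral.integral_add i1 i2,
    intervalIntegral.integral_const_mul, intervalIntegral.integral_const, smul_eq_mul]
  ring

/-- Bounded inverse speed allows to pass from `dθ` to `ds`. -/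
theorem integral_sq_le_arcEnergy {V : Type*} [NormedAddCommGroup V] [InnerProductSpace ℝ V]
    [FiniteDimensional ℝ V] {p : ℝ → ℝ} {M : ℝ} (hp : ArcWeight n p)
    (hM : ∀ θ ∈ Icc 0 (2 * Real.pi), p θ ≤ M) {h : ℝ → V} (hh : MemHs n h) {j : ℕ} (hj : j ≤ n) :
    ∫ θ in (0 : ℝ)..(2 * Real.pi), ‖((arcDeriv p)^[j] h) θ‖ ^ 2 ≤ M * arcEnergy p j h := by
  have hI := (hp.memHs_iterate hh hj).integrable_sq
  unfold arcEnergy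
  rw [← intervalIntegral.integral_const_mul]
  refine intervalIntegral.integral_mono_on Real.two_pi_pos.le (intervalIntegrable_circ hI)
    ((hp.intervalIntegrable_mul_inv hI).const_mul _) fun θ hθ => ?_
  have h1 := mul_le_mul_of_nonneg_right (hM θ hθ)
    (mul_nonneg (sq_nonneg ‖((arcDeriv p)^[j] h) θ‖) (hp.inv_pos θ).le)
  refine le_trans (le_of_eq ?_) h1
  have := (hp.pos θ).ne'
  field_simp

/-- Bounded speed allows to pass from `ds` to `dθ`. -/
theorem arcEnergy_le_integral_sq {V : Type*} [NormedAddCommGroup V] [InnerProductSpace ℝ V]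
    [FiniteDimensional ℝ V] {p : ℝ → ℝ} {M : ℝ} (hp : ArcWeight n p)
    (hM : ∀ θ ∈ Icc 0 (2 * Real.pi), (p θ)⁻¹ ≤ M) {h : ℝ → V} (hh : MemHs n h) {j : ℕ}
    (hj : j ≤ n) : arcEnergy p j h ≤
      M * ∫ θ in (0 : ℝ)..(2 * Real.pi), ‖((arcDeriv p)^[j] h) θ‖ ^ 2 := by
  have hI := (hp.memHs_iterate hh hj).integrable_sq
  unfold arcEnergy
  rw [← intervalIntegral.integral_const_mul]
  refine intervalIntegral.integral_mono_on Real.two_pi_pos.le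
    (hp.intervalIntegrable_mul_inv hI) ((intervalIntegrable_circ hI).const_mul _) fun θ hθ => ?_
  rw [mul_comm]
  exact mul_le_mul_of_nonneg_right (hM θ hθ) (sq_nonneg _)

theorem SobolevH.norm_sq_eq_add (h : SobolevH n d) :
    ‖h‖ ^ 2 = (∫ θ in (0 : ℝ)..(2 * Real.pi), ‖h θ‖ ^ 2) +
      ∫ θ in (0 : ℝ)..(2 * Real.pi), ‖iteratedDeriv n h θ‖ ^ 2 := by
  rw [norm_sq_eq, intervalIntegral.integral_add]
  · exact intervalIntegrable_circ ((memLp_two_iff_integrable_sq_norm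
      h.2.memLp_self.aestronglyMeasurable).1 h.2.memLp_self)
  · exact intervalIntegrable_circ h.integrable_iteratedDeriv_sq

theorem mul_sq_add_le {P Q A X S c : ℝ} (hP : 0 ≤ P) (hQ : 0 ≤ Q) (hA : 0 ≤ A) (hc : 0 ≤ c) :
    P * S ^ 2 + Q * (A * S ^ 2 + X ^ 2 * S ^ 2 * c ^ 2 + P * S ^ 2) ≤
      (P + Q * (A + X ^ 2 + P)) * (S * (1 + c)) ^ 2 := by
  have h1 : (1 : ℝ) ≤ (1 + c) ^ 2 := by nlinarith
  have h2 : c ^ 2 ≤ (1 + c) ^ 2 := by nlinarith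
  calc _ = S ^ 2 * (P * 1 + Q * (A * 1 + X ^ 2 * c ^ 2 + P * 1)) := by ring
    _ ≤ S ^ 2 * (P * (1 + c) ^ 2 + Q * (A * (1 + c) ^ 2 + X ^ 2 * (1 + c) ^ 2 +
        P * (1 + c) ^ 2)) := by gcongr
    _ = _ := by ring

/-- Almost everywhere, `|h^{(n)}| ≤ C (X + X |c^{(n)}| + |D^n h|)` with `X` a multiple of the
metric norm of `h`. -/
theorem exists_ae_norm_iteratedDeriv_le (hn : 2 ≤ n) (ha : IsLengthWeight n a)
    (h_zero : CondZero n a) (h_infty : CondInfty n a) (hc₀ : c₀ ∈ sobolevImm n d) (hR : 0 ≤ R) :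
    ∃ C X : ℝ, 0 ≤ C ∧ 0 ≤ X ∧ ∀ c ∈ reach n a c₀ R, ∀ h : SobolevH n d, ∀ᵐ θ ∂circ,
      ‖iteratedDeriv n h θ‖ ≤ C * (X * Real.sqrt (G n a c h h) +
        X * Real.sqrt (G n a c h h) * ‖iteratedDeriv n c θ‖ +
        ‖((arcDeriv (invSpeed c))^[n] h) θ‖) := by
  obtain ⟨m, rfl⟩ : ∃ m, n = m + 2 := ⟨n - 2, by omega⟩
  obtain ⟨M, hM⟩ := exists_jetBound hn ha h_zero h_infty hc₀ hR le_rfl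
  obtain ⟨K, hK, hb⟩ := exists_norm_iterate_le hn ha h_zero h_infty hc₀ hR
  obtain ⟨C, hC, hCb⟩ := exists_jet_deriv_le (E d) m M
  refine ⟨C, (1 + |M|) * ((m + 1) * K), hC, by positivity, fun c hc h => ?_⟩
  set X₀ := (1 + |M|) * ((m + 1) * K) with hX₀
  set S := Real.sqrt (G (m + 2) a c h h) with hS
  have hS0 : 0 ≤ S := Real.sqrt_nonneg _
  filter_upwards [(c.memHs hn).ae_diffUpTo, (h.memHs hn).ae_diffUpTo,
    ae_restrict_mem measurableSet_Ioc] with θ hcθ hhθ hθ'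
  have hθ := Ioc_subset_Icc_self hθ'
  have hJ := hM c hc θ hθ
  have i2 : arcJet (invSpeed c) θ m (arcDeriv (invSpeed c) h) ≤ (m + 1) * (K * S) :=
    arcJet_arcDeriv_le_of_forall fun j hj hjm => hb c hc h j hj (by omega) θ hθ
  have i1 : arcJet (invSpeed c) θ (m + 1) (arcDeriv (invSpeed c) h) ≤
      (m + 1) * (K * S) + ‖((arcDeriv (invSpeed c))^[m + 2] h) θ‖ := by
    rw [arcJet_succ_eq, ← Function.iterate_succ_apply]
    linarith
  have i3 : jet θ (m + 1) (deriv h) ≤ C * (arcJet (invSpeed c) θ (m + 1)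
      (arcDeriv (invSpeed c) h) + jet θ (m + 1) (deriv c) *
      arcJet (invSpeed c) θ m (arcDeriv (invSpeed c) h)) :=
    hCb (deriv c) h θ hJ hcθ.2 hhθ
  have i4 : jet θ (m + 1) (deriv c) ≤ |M| + ‖iteratedDeriv (m + 2) c θ‖ := by
    rw [jet_succ_eq, ← iteratedDeriv_succ']
    exact add_le_add (hJ.jet_le.trans (le_abs_self M)) le_rfl
  rw [iteratedDeriv_succ']
  refine norm_iteratedDeriv_le_jet.trans (i3.trans ?_)
  set x := ‖iteratedDeriv (m + 2) c θ‖
  have hx : 0 ≤ x := norm_nonneg _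
  have hM0 := abs_nonneg M
  have j6 : 0 ≤ arcJet (invSpeed c) θ m (arcDeriv (invSpeed c) h) := arcJet_nonneg
  have k3 : 0 ≤ (m + 1) * (K * S) := by positivity
  refine mul_le_mul_of_nonneg_left ?_ hC
  calc _ ≤ ((m + 1) * (K * S) + ‖((arcDeriv (invSpeed c))^[m + 2] h) θ‖) +
        (|M| + x) * ((m + 1) * (K * S)) := by gcongr
    _ ≤ _ := by
      rw [hX₀]
      nlinarith [mul_nonneg (mul_nonneg hM0 hx) k3]

/-- At top order the estimate for the parameter derivatives holds in `L²`, with the norm of the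
curve as a linear factor. -/
theorem exists_norm_le_mul_one_add (hn : 2 ≤ n) (ha : IsLengthWeight n a)
    (h_zero : CondZero n a) (h_infty : CondInfty n a) (hc₀ : c₀ ∈ sobolevImm n d) (hR : 0 ≤ R) :
    ∃ K : ℝ, 0 ≤ K ∧ ∀ c ∈ reach n a c₀ R, ∀ h : SobolevH n d,
      ‖h‖ ≤ K * Real.sqrt (G n a c h h) * (1 + ‖c‖) := by
  obtain ⟨M, hM⟩ := exists_speed_bounds hn ha h_zero h_infty hc₀ hR
  obtain ⟨D, L, hD, -, hen⟩ := exists_energy_bounds hn ha h_zero h_infty hc₀ hR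
  obtain ⟨C, X₀, hC, hX₀, hae⟩ := exists_ae_norm_iteratedDeriv_le hn ha h_zero h_infty hc₀ hR
  set K' := |M| * D + 3 * C ^ 2 * (X₀ ^ 2 * (2 * Real.pi) + X₀ ^ 2 + |M| * D) with hK'
  have hK'0 : 0 ≤ K' := by positivity
  refine ⟨Real.sqrt K', Real.sqrt_nonneg _, fun c hc h => ?_⟩
  have hW := arcWeight_of_mem_reach hn hc
  have hG := ha.G_nonneg hW h
  set S := Real.sqrt (G n a c h h) with hS
  have hS0 : 0 ≤ S := Real.sqrt_nonneg _
  have hSG : S ^ 2 = G n a c h h := Real.sq_sqrt hG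
  have hpM : ∀ θ ∈ Icc 0 (2 * Real.pi), invSpeed c θ ≤ |M| := fun θ hθ =>
    (hM c hc θ hθ).2.trans (le_abs_self M)
  have e0 : 0 ≤ arcEnergy (invSpeed c) 0 h := hW.arcEnergy_nonneg 0
  have en : 0 ≤ arcEnergy (invSpeed c) n h := hW.arcEnergy_nonneg n
  have hen1 := (hen c hc).2 h |>.1
  rw [← hSG] at hen1
  have hint := integral_sq_le_of_ae_le h.integrable_iteratedDeriv_sq c.integrable_iteratedDeriv_sq
    (hW.memHs_iterate (h.memHs hn) le_rfl).integrable_sq (fun _ => norm_nonneg _) (hae c hc h)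
  have hDn := integral_sq_le_arcEnergy hW hpM (h.memHs hn) (le_refl n)
  have hD0 := integral_sq_le_arcEnergy hW hpM (h.memHs hn) (Nat.zero_le n)
  simp only [Function.iterate_zero, id_eq] at hD0
  have hcn := c.integral_iteratedDeriv_sq_le
  set I₁ := ∫ θ in (0 : ℝ)..(2 * Real.pi), ‖iteratedDeriv n c θ‖ ^ 2
  set I₂ := ∫ θ in (0 : ℝ)..(2 * Real.pi), ‖((arcDeriv (invSpeed c))^[n] h) θ‖ ^ 2
  have b0 : ∫ θ in (0 : ℝ)..(2 * Real.pi), ‖h θ‖ ^ 2 ≤ |M| * (D * S ^ 2) :=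
    hD0.trans (by gcongr; linarith)
  have b1 : I₂ ≤ |M| * (D * S ^ 2) := hDn.trans (by gcongr; linarith)
  have hc0 := norm_nonneg c
  have hfinal : ‖h‖ ^ 2 ≤ K' * (S * (1 + ‖c‖)) ^ 2 := by
    rw [h.norm_sq_eq_add]
    calc _ ≤ |M| * (D * S ^ 2) + 3 * C ^ 2 * ((X₀ * S) ^ 2 * (2 * Real.pi) +
          (X₀ * S) ^ 2 * ‖c‖ ^ 2 + |M| * (D * S ^ 2)) := by
          refine add_le_add b0 (hint.trans ?_)
          gcongr
      _ = (|M| * D) * S ^ 2 + 3 * C ^ 2 * ((X₀ ^ 2 * (2 * Real.pi)) * S ^ 2 +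
          X₀ ^ 2 * S ^ 2 * ‖c‖ ^ 2 + (|M| * D) * S ^ 2) := by ring
      _ ≤ _ := mul_sq_add_le (by positivity) (by positivity)
          (mul_nonneg (sq_nonneg X₀) Real.two_pi_pos.le) (norm_nonneg c)
  rw [mul_assoc]
  refine (pow_le_pow_iff_left₀ (norm_nonneg h) (by positivity) two_ne_zero).1 ?_
  rw [mul_pow (Real.sqrt K'), Real.sq_sqrt hK'0]
  exact hfinal

/-- The curves of a geodesic ball are bounded in `H^n(dθ)`. -/
theorem exists_norm_le_of_mem_reach (hn : 2 ≤ n) (ha : IsLengthWeight n a)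
    (h_zero : CondZero n a) (h_infty : CondInfty n a) (hc₀ : c₀ ∈ sobolevImm n d) (hR : 0 ≤ R) :
    ∃ B : ℝ, 0 ≤ B ∧ ∀ c ∈ reach n a c₀ R, ‖c‖ ≤ B := by
  obtain ⟨K, hK, hb⟩ := exists_norm_le_mul_one_add hn ha h_zero h_infty hc₀ hR
  exact ⟨(1 + ‖c₀‖) * Real.exp (K * R), by positivity,
    seminorm_le_of_mem_reach (q := normSeminorm ℝ (SobolevH n d)) continuous_norm hK hR hb⟩

theorem exists_norm_le_sqrt_G (hn : 2 ≤ n) (ha : IsLengthWeight n a)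
    (h_zero : CondZero n a) (h_infty : CondInfty n a) (hc₀ : c₀ ∈ sobolevImm n d) (hR : 0 ≤ R) :
    ∃ K : ℝ, 0 ≤ K ∧ ∀ c ∈ reach n a c₀ R, ∀ h : SobolevH n d,
      ‖h‖ ≤ K * Real.sqrt (G n a c h h) := by
  obtain ⟨K, hK, hb⟩ := exists_norm_le_mul_one_add hn ha h_zero h_infty hc₀ hR
  obtain ⟨B, hB, hcB⟩ := exists_norm_le_of_mem_reach hn ha h_zero h_infty hc₀ hR
  refine ⟨K * (1 + B), by positivity, fun c hc h => (hb c hc h).trans ?_⟩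
  have h1 := hcB c hc
  have h2 := Real.sqrt_nonneg (G n a c h h)
  calc _ ≤ K * Real.sqrt (G n a c h h) * (1 + B) := by gcongr
    _ = _ := by ring

theorem exists_sqrt_G_le_norm (hn : 2 ≤ n) (ha : IsLengthWeight n a)
    (h_zero : CondZero n a) (h_infty : CondInfty n a) (hc₀ : c₀ ∈ sobolevImm n d) (hR : 0 ≤ R) :
    ∃ K : ℝ, 0 ≤ K ∧ ∀ c ∈ reach n a c₀ R, ∀ h : SobolevH n d,
      Real.sqrt (G n a c h h) ≤ K * ‖h‖ := by
  obtain ⟨m, rfl⟩ : ∃ m, n = m + 2 := ⟨n - 2, by omega⟩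
  obtain ⟨M, hM⟩ := exists_jetBound hn ha h_zero h_infty hc₀ hR le_rfl
  obtain ⟨M', hM'⟩ := exists_speed_bounds hn ha h_zero h_infty hc₀ hR
  obtain ⟨B, hB, hcB⟩ := exists_norm_le_of_mem_reach hn ha h_zero h_infty hc₀ hR
  obtain ⟨D, L, hD, -, hen⟩ := exists_energy_bounds hn ha h_zero h_infty hc₀ hR
  obtain ⟨K, hK, hb⟩ := exists_norm_iteratedDeriv_le (m + 2) d
  obtain ⟨C, hC, hCb⟩ := exists_arcJet_arcDeriv_le (E d) m M
  set X₀ := (1 + |M|) * ((m + 1) * K) with hX₀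
  set T := |M'| * (1 + 3 * C ^ 2 * (X₀ ^ 2 * (2 * Real.pi) + X₀ ^ 2 * B ^ 2 + 1)) with hT
  have hpi := Real.pi_pos
  have hT0 : 0 ≤ T := by positivity
  refine ⟨Real.sqrt (D * ((m + 3) * T)), Real.sqrt_nonneg _, fun c hc h => ?_⟩
  have hW := arcWeight_of_mem_reach hn hc
  have hpM : ∀ θ ∈ Icc 0 (2 * Real.pi), (invSpeed c θ)⁻¹ ≤ |M'| := fun θ hθ => by
    simp only [invSpeed, inv_inv]
    exact (hM' c hc θ hθ).1.trans (le_abs_self M')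
  have hh0 := norm_nonneg h
  -- Almost everywhere, all `|D^j h|` are at most `C (X + X |c^{(n)}| + |h^{(n)}|)`, with `X` a
  -- multiple of the norm of `h`.
  have hae : ∀ᵐ θ ∂circ, arcJet (invSpeed c) θ (m + 1) (arcDeriv (invSpeed c) h) ≤
      C * (X₀ * ‖h‖ + X₀ * ‖h‖ * ‖iteratedDeriv (m + 2) c θ‖ + ‖iteratedDeriv (m + 2) h θ‖) := by
    filter_upwards [(c.memHs hn).ae_diffUpTo, (h.memHs hn).ae_diffUpTo,
      ae_restrict_mem measurableSet_Ioc] with θ hcθ hhθ hθ'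
    have hθ := Ioc_subset_Icc_self hθ'
    have hJ := hM c hc θ hθ
    have i2 : jet θ m (deriv h) ≤ (m + 1) * (K * ‖h‖) :=
      jet_deriv_le_of_forall fun j hj hjm => hb h j hj (by omega) θ hθ
    have i1 : jet θ (m + 1) (deriv h) ≤
        (m + 1) * (K * ‖h‖) + ‖iteratedDeriv (m + 2) h θ‖ := by
      rw [jet_succ_eq, ← iteratedDeriv_succ']
      linarith
    have i3 : arcJet (invSpeed c) θ (m + 1) (arcDeriv (invSpeed c) h) ≤
        C * (jet θ (m + 1) (deriv h) + jet θ (m + 1) (deriv c) * jet θ m (deriv h)) :=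
      hCb (deriv c) h θ hJ hcθ.2 hhθ
    have i4 : jet θ (m + 1) (deriv c) ≤ |M| + ‖iteratedDeriv (m + 2) c θ‖ := by
      rw [jet_succ_eq, ← iteratedDeriv_succ']
      exact add_le_add (hJ.jet_le.trans (le_abs_self M)) le_rfl
    refine i3.trans ?_
    set x := ‖iteratedDeriv (m + 2) c θ‖
    have hx : 0 ≤ x := norm_nonneg _
    have hM0 := abs_nonneg M
    have j6 : 0 ≤ jet θ m (deriv h) := jet_nonneg
    have k3 : 0 ≤ (m + 1) * (K * ‖h‖) := by positivity
    refine mul_le_mul_of_nonneg_left ?_ hC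
    calc _ ≤ ((m + 1) * (K * ‖h‖) + ‖iteratedDeriv (m + 2) h θ‖) +
          (|M| + x) * ((m + 1) * (K * ‖h‖)) := by gcongr
      _ ≤ _ := by
        rw [hX₀]
        nlinarith [mul_nonneg (mul_nonneg hM0 hx) k3]
  have hen0 : ∀ j ∈ Finset.range (m + 2 + 1), arcEnergy (invSpeed c) j h ≤ T * ‖h‖ ^ 2 := by
    intro j hj
    have hjn : j ≤ m + 2 := Nat.lt_succ_iff.1 (Finset.mem_range.1 hj)
    refine (arcEnergy_le_integral_sq hW hpM (h.memHs hn) hjn).trans ?_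
    rw [hT, mul_assoc]
    refine mul_le_mul_of_nonneg_left ?_ (abs_nonneg _)
    have hrest : 0 ≤ 3 * C ^ 2 * (X₀ ^ 2 * (2 * Real.pi) + X₀ ^ 2 * B ^ 2 + 1) * ‖h‖ ^ 2 := by
      positivity
    rcases j with _ | j
    · have := h.integral_sq_le
      simp only [Function.iterate_zero, id_eq]
      linarith
    · have hint := integral_sq_le_of_ae_le (hW.memHs_iterate (h.memHs hn) hjn).integrable_sq
        c.integrable_iteratedDeriv_sq h.integrable_iteratedDeriv_sq (fun _ => norm_nonneg _)
        (hae.mono fun θ hθ => by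
          rw [Function.iterate_succ_apply]
          exact (norm_iterate_le_arcJet (by omega)).trans hθ)
      have h1 := c.integral_iteratedDeriv_sq_le
      have h2 := h.integral_iteratedDeriv_sq_le
      have h3 : ‖c‖ ^ 2 ≤ B ^ 2 := pow_le_pow_left₀ (norm_nonneg c) (hcB c hc) 2
      have h4 := h1.trans h3
      refine hint.trans ?_
      calc _ ≤ 3 * C ^ 2 * ((X₀ * ‖h‖) ^ 2 * (2 * Real.pi) + (X₀ * ‖h‖) ^ 2 * B ^ 2 +
            ‖h‖ ^ 2) := by gcongr
        _ ≤ _ := by nlinarith [sq_nonneg ‖h‖]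
  have hsum := Finset.sum_le_sum hen0
  rw [Finset.sum_const, Finset.card_range, nsmul_eq_mul] at hsum
  push_cast at hsum
  have hG := ((hen c hc).2 h).2.trans (mul_le_mul_of_nonneg_left hsum hD.le)
  calc Real.sqrt (G (m + 2) a c h h) ≤ Real.sqrt (D * ((m + 3) * T) * ‖h‖ ^ 2) := by
        refine Real.sqrt_le_sqrt (hG.trans (le_of_eq ?_))
        ring
    _ = _ := by rw [Real.sqrt_mul (by positivity), Real.sqrt_sq hh0]

theorem propertyHSobolev (hn : 2 ≤ n) (ha : IsLengthWeight n a)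
    (h_zero : CondZero n a) (h_infty : CondInfty n a) : PropertyHSobolev n d a := by
  intro c₀ hc₀ R hR
  obtain ⟨C, L, hC, -, hb⟩ := exists_energy_bounds hn ha h_zero h_infty hc₀ hR.le
  refine ⟨C, hC, fun c hc h => ?_⟩
  have hc' := geoBall_subset_reach hc
  rw [normSqDs_eq (arcWeight_of_mem_reach hn hc') (h.memHs hn)]
  exact ((hb c hc').2 h).1

theorem exists_norm_equiv (hn : 2 ≤ n) (ha : IsLengthWeight n a)
    (h_zero : CondZero n a) (h_infty : CondInfty n a) (hc₀ : c₀ ∈ sobolevImm n d) (hR : 0 < R) :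
    ∃ C : ℝ, 0 < C ∧ ∀ c ∈ geoBall n a c₀ R, ∀ h : SobolevH n d,
      C⁻¹ * ‖h‖ ≤ Real.sqrt (G n a c h h) ∧ Real.sqrt (G n a c h h) ≤ C * ‖h‖ := by
  obtain ⟨K₁, h1, H1⟩ := exists_norm_le_sqrt_G hn ha h_zero h_infty hc₀ hR.le
  obtain ⟨K₂, h2, H2⟩ := exists_sqrt_G_le_norm hn ha h_zero h_infty hc₀ hR.le
  refine ⟨1 + K₁ + K₂, by positivity, fun c hc h => ?_⟩
  have hc' := geoBall_subset_reach hc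
  have i1 := H1 c hc' h
  have i2 := H2 c hc' h
  have hG := Real.sqrt_nonneg (G n a c h h)
  have hh := norm_nonneg h
  constructor
  · rw [inv_mul_le_iff₀ (by positivity)]
    nlinarith [mul_nonneg h2 hG]
  · nlinarith [mul_nonneg h1 hh]

end Higher

/-! ### Smooth paths as paths of Sobolev immersions -/

section Strip

variable {F : Type*} [NormedAddCommGroup F] [NormedSpace ℝ F]

/-- The closed strip `[0,1] × ℝ` on which smooth paths live. -/
def strip : Set (ℝ × ℝ) := Icc 0 1 ×ˢ univ

/-- The partial derivative in the parameter `θ`, within the strip. -/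
noncomputable def partialParam (A : ℝ × ℝ → F) (z : ℝ × ℝ) : F := fderivWithin ℝ A strip z (0, 1)

/-- The partial derivative in time, within the strip. -/
noncomputable def partialTime (A : ℝ × ℝ → F) (z : ℝ × ℝ) : F := fderivWithin ℝ A strip z (1, 0)

theorem natCast_le_smooth (m : ℕ) : (m : ℕ∞ω) ≤ (∞ : ℕ∞ω) := by exact_mod_cast le_top

theorem uniqueDiffOn_strip : UniqueDiffOn ℝ strip :=
  (uniqueDiffOn_Icc zero_lt_one).prod uniqueDiffOn_univ

theorem strip_subset_closure_interior : strip ⊆ closure (interior strip) := by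
  rw [strip, interior_prod_eq, interior_Icc, interior_univ, closure_prod_eq,
    closure_Ioo zero_ne_one, closure_univ]

variable {A B : ℝ × ℝ → F}

theorem contDiffOn_partialParam (hA : ContDiffOn ℝ ∞ A strip) :
    ContDiffOn ℝ ∞ (partialParam A) strip :=
  (hA.fderivWithin uniqueDiffOn_strip (m := ∞) (by simp)).clm_apply contDiffOn_const

theorem contDiffOn_partialTime (hA : ContDiffOn ℝ ∞ A strip) :
    ContDiffOn ℝ ∞ (partialTime A) strip :=
  (hA.fderivWithin uniqueDiffOn_strip (m := ∞) (by simp)).clm_apply contDiffOn_const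

theorem contDiffOn_iterate_partialParam (hA : ContDiffOn ℝ ∞ A strip) (k : ℕ) :
    ContDiffOn ℝ ∞ (partialParam^[k] A) strip := by
  induction k with
  | zero => exact hA
  | succ k ih => rw [Function.iterate_succ_apply']; exact contDiffOn_partialParam ih

theorem hasDerivAt_param (hA : ContDiffOn ℝ ∞ A strip) {t : ℝ} (ht : t ∈ Icc (0 : ℝ) 1) (θ : ℝ) :
    HasDerivAt (fun x => A (t, x)) (partialParam A (t, θ)) θ := by
  have h1 : HasFDerivWithinAt A (fderivWithin ℝ A strip (t, θ)) strip (t, θ) :=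
    (hA.differentiableOn (by simp) (t, θ) ⟨ht, mem_univ _⟩).hasFDerivWithinAt
  have h2 : HasDerivWithinAt (fun x : ℝ => (t, x)) ((0 : ℝ), (1 : ℝ)) univ θ :=
    ((hasDerivAt_const θ t).prodMk (hasDerivAt_id θ)).hasDerivWithinAt
  have h3 : MapsTo (fun x : ℝ => (t, x)) univ strip := fun x _ => ⟨ht, mem_univ _⟩
  exact (h1.comp_hasDerivWithinAt θ h2 h3).hasDerivAt Filter.univ_mem

theorem hasDerivWithinAt_time (hA : ContDiffOn ℝ ∞ A strip) {t : ℝ} (ht : t ∈ Icc (0 : ℝ) 1)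
    (θ : ℝ) : HasDerivWithinAt (fun s => A (s, θ)) (partialTime A (t, θ)) (Icc 0 1) t := by
  have h1 : HasFDerivWithinAt A (fderivWithin ℝ A strip (t, θ)) strip (t, θ) :=
    (hA.differentiableOn (by simp) (t, θ) ⟨ht, mem_univ _⟩).hasFDerivWithinAt
  have h2 : HasDerivWithinAt (fun s : ℝ => (s, θ)) ((1 : ℝ), (0 : ℝ)) (Icc 0 1) t :=
    ((hasDerivAt_id t).prodMk (hasDerivAt_const t θ)).hasDerivWithinAt
  have h3 : MapsTo (fun s : ℝ => (s, θ)) (Icc 0 1) strip := fun x hx => ⟨hx, mem_univ _⟩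
  exact h1.comp_hasDerivWithinAt t h2 h3

theorem partialParam_congr (h : EqOn A B strip) : EqOn (partialParam A) (partialParam B) strip := by
  intro z hz
  simp only [partialParam, fderivWithin_congr h (h hz)]

/-- The partial derivatives commute, up to the boundary of the strip. -/
theorem partialTime_partialParam (hA : ContDiffOn ℝ ∞ A strip) :
    EqOn (partialTime (partialParam A)) (partialParam (partialTime A)) strip := by
  intro z hz
  have hd : DifferentiableWithinAt ℝ (fderivWithin ℝ A strip) strip z :=
    (hA.fderivWithin uniqueDiffOn_strip (m := ∞) (by simp)).differentiableOn (by simp) z hz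
  have hu := uniqueDiffOn_strip z hz
  have e : ∀ v w : ℝ × ℝ, fderivWithin ℝ (fun y => fderivWithin ℝ A strip y v) strip z w =
      fderivWithin ℝ (fderivWithin ℝ A strip) strip z w v := fun v w => by
    rw [fderivWithin_clm_apply hu hd (differentiableWithinAt_const v)]
    simp
  have hs : IsSymmSndFDerivWithinAt ℝ A strip z :=
    (hA z hz).isSymmSndFDerivWithinAt (by simpa using natCast_le_smooth 2) uniqueDiffOn_strip
      (strip_subset_closure_interior hz) hz
  have h1 := e (0, 1) (1, 0)
  have h2 := e (1, 0) (0, 1)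
  exact h1.trans ((hs (1, 0) (0, 1)).trans h2.symm)

theorem partialTime_iterate_partialParam (hA : ContDiffOn ℝ ∞ A strip) (k : ℕ) :
    EqOn (partialTime (partialParam^[k] A)) (partialParam^[k] (partialTime A)) strip := by
  induction k with
  | zero => exact fun z _ => rfl
  | succ k ih =>
    rw [Function.iterate_succ_apply', Function.iterate_succ_apply']
    exact (partialTime_partialParam (contDiffOn_iterate_partialParam hA k)).trans
      (partialParam_congr ih)

theorem iteratedDeriv_param (hA : ContDiffOn ℝ ∞ A strip) {t : ℝ} (ht : t ∈ Icc (0 : ℝ) 1)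
    (k : ℕ) : iteratedDeriv k (fun x => A (t, x)) = fun x => (partialParam^[k] A) (t, x) := by
  induction k with
  | zero => simp
  | succ k ih =>
    rw [iteratedDeriv_succ, ih, Function.iterate_succ_apply']
    exact funext fun x => (hasDerivAt_param (contDiffOn_iterate_partialParam hA k) ht x).deriv

theorem contDiff_param (hA : ContDiffOn ℝ ∞ A strip) {t : ℝ} (ht : t ∈ Icc (0 : ℝ) 1) :
    ContDiff ℝ ∞ fun x => A (t, x) := by
  rw [← contDiffOn_univ]
  exact hA.comp (f := fun x : ℝ => (t, x)) (contDiff_const.prodMk contDiff_id).contDiffOn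
    fun x _ => ⟨ht, mem_univ _⟩

theorem exists_uniform_delta (hA : ContDiffOn ℝ ∞ A strip) {ε : ℝ} (hε : 0 < ε) :
    ∃ δ > 0, ∀ s ∈ Icc (0 : ℝ) 1, ∀ t ∈ Icc (0 : ℝ) 1, |s - t| < δ →
      ∀ θ ∈ Icc 0 (2 * Real.pi), ‖A (s, θ) - A (t, θ)‖ < ε := by
  have hc : UniformContinuousOn A (Icc 0 1 ×ˢ Icc 0 (2 * Real.pi)) :=
    (isCompact_Icc.prod isCompact_Icc).uniformContinuousOn_of_continuous
      (hA.continuousOn.mono fun z hz => ⟨hz.1, mem_univ _⟩)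
  obtain ⟨δ, hδ, h⟩ := Metric.uniformContinuousOn_iff.1 hc ε hε
  refine ⟨δ, hδ, fun s hs t ht hst θ hθ => ?_⟩
  rw [← dist_eq_norm]
  exact h (s, θ) ⟨hs, hθ⟩ (t, θ) ⟨ht, hθ⟩ (by simpa [Prod.dist_eq, Real.dist_eq, hδ] using hst)

/-- First order Taylor expansion in time, with a remainder that is uniform in `θ`. -/
theorem exists_uniform_taylor (hA : ContDiffOn ℝ ∞ A strip) {ε : ℝ} (hε : 0 < ε) :
    ∃ δ > 0, ∀ s ∈ Icc (0 : ℝ) 1, ∀ t ∈ Icc (0 : ℝ) 1, |s - t| < δ →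
      ∀ θ ∈ Icc 0 (2 * Real.pi),
      ‖A (s, θ) - A (t, θ) - (s - t) • partialTime A (t, θ)‖ ≤ ε * |s - t| := by
  obtain ⟨δ, hδ, h⟩ := exists_uniform_delta (contDiffOn_partialTime hA) hε
  refine ⟨δ, hδ, fun s hs t ht hst θ hθ => ?_⟩
  have hsub : uIcc t s ⊆ Icc 0 1 := by
    rw [← uIcc_of_le (zero_le_one (α := ℝ))] at hs ht ⊢
    exact uIcc_subset_uIcc ht hs
  have := (convex_uIcc t s).norm_image_sub_le_of_norm_hasDerivWithin_le
    (f := fun r => A (r, θ) - r • partialTime A (t, θ))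
    (f' := fun r => partialTime A (r, θ) - partialTime A (t, θ)) (C := ε)
    (fun r hr => by
      have h2 := ((hasDerivAt_id r).smul_const (partialTime A (t, θ))).hasDerivWithinAt
        (s := uIcc t s)
      rw [one_smul] at h2
      exact ((hasDerivWithinAt_time hA (hsub hr) θ).mono hsub).sub h2)
    (fun r hr => (h r (hsub hr) t ht
      (lt_of_le_of_lt (abs_sub_left_of_mem_uIcc hr) hst) θ hθ).le)
    left_mem_uIcc right_mem_uIcc
  rw [Real.norm_eq_abs] at this
  refine le_trans (le_of_eq ?_) this
  congr 1
  rw [sub_smul]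
  abel

end Strip

section SmoothPaths

variable {n d : ℕ} {a : ℕ → ℝ → ℝ}

theorem memSobolev_of_contDiff (n : ℕ) {u : ℝ → E d} (hp : Function.Periodic u (2 * Real.pi))
    (hu : ContDiff ℝ ∞ u) : MemSobolev n u where
  periodic := hp
  contDiff := hu.of_le (natCast_le_smooth _)
  absCont := by
    have h1 : ContDiff ℝ 1 (iteratedDeriv (n - 1) u) := by
      rw [iteratedDeriv_eq_iterate]
      exact (hu.iterate_deriv (n - 1)).of_le (natCast_le_smooth 1)
    exact h1.contDiffOn.absolutelyContinuousOnInterval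
  memLp := memLp_of_continuous (hu.continuous_iteratedDeriv n (natCast_le_smooth n))

theorem SobolevH.norm_le_of_forall (h : SobolevH n d) {ε : ℝ}
    (h0 : ∀ θ ∈ Icc 0 (2 * Real.pi), ‖h θ‖ ≤ ε)
    (hn : ∀ θ ∈ Icc 0 (2 * Real.pi), ‖iteratedDeriv n h θ‖ ≤ ε) : ‖h‖ ≤ 4 * ε := by
  have hε : 0 ≤ ε := (norm_nonneg _).trans (h0 0 ⟨le_rfl, Real.two_pi_pos.le⟩)
  refine (pow_le_pow_iff_left₀ (norm_nonneg h) (by positivity) two_ne_zero).1 ?_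
  rw [norm_sq_eq]
  have h1 : ∫ θ in (0 : ℝ)..(2 * Real.pi), (‖h θ‖ ^ 2 + ‖iteratedDeriv n h θ‖ ^ 2) ≤
      ∫ _ in (0 : ℝ)..(2 * Real.pi), (ε ^ 2 + ε ^ 2) := by
    refine intervalIntegral.integral_mono_on Real.two_pi_pos.le ?_ (by simp) fun θ hθ => ?_
    · refine intervalIntegrable_circ ((integrable_density h h).congr ?_)
      exact Filter.Eventually.of_forall fun θ => by simp only [real_inner_self_eq_norm_sq]
    · exact add_le_add (pow_le_pow_left₀ (norm_nonneg _) (h0 θ hθ) 2)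
        (pow_le_pow_left₀ (norm_nonneg _) (hn θ hθ) 2)
  rw [intervalIntegral.integral_const, smul_eq_mul, sub_zero] at h1
  have := Real.pi_lt_four
  nlinarith [sq_nonneg ε]

theorem IsSmoothPath.contDiffOn_strip {c₀ c₁ : ℝ → E d} {γ : ℝ → ℝ → E d}
    (hγ : IsSmoothPath c₀ c₁ γ) : ContDiffOn ℝ ∞ (Function.uncurry γ) strip := hγ.contDiffOn

theorem velocity_eq {c₀ c₁ : ℝ → E d} {γ : ℝ → ℝ → E d} (hγ : IsSmoothPath c₀ c₁ γ) {t : ℝ}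
    (ht : t ∈ Icc (0 : ℝ) 1) :
    velocity γ t = fun θ => partialTime (Function.uncurry γ) (t, θ) :=
  funext fun θ => (hasDerivWithinAt_time hγ.contDiffOn_strip ht θ).derivWithin
    (uniqueDiffOn_Icc zero_lt_one t ht)

theorem IsSmoothPath.memSobolev (n : ℕ) {c₀ c₁ : ℝ → E d} {γ : ℝ → ℝ → E d}
    (hγ : IsSmoothPath c₀ c₁ γ) {t : ℝ} (ht : t ∈ Icc (0 : ℝ) 1) : MemSobolev n (γ t) :=
  memSobolev_of_contDiff n (hγ.mem t ht).1 (hγ.mem t ht).2.1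

theorem IsSmoothPath.memSobolev_velocity (n : ℕ) {c₀ c₁ : ℝ → E d} {γ : ℝ → ℝ → E d}
    (hγ : IsSmoothPath c₀ c₁ γ) {t : ℝ} (ht : t ∈ Icc (0 : ℝ) 1) :
    MemSobolev n (velocity γ t) := by
  refine memSobolev_of_contDiff n (fun θ => ?_) ?_
  · exact derivWithin_congr (fun s hs => (hγ.mem s hs).1 θ) ((hγ.mem t ht).1 θ)
  · rw [velocity_eq hγ ht]
    exact contDiff_param (contDiffOn_partialTime hγ.contDiffOn_strip) ht

open Classical in
/-- Extension of a family in `H^n` on `[0,1]` by zero. -/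
noncomputable def liftSobolev (n : ℕ) (u : ℝ → ℝ → E d) (t : ℝ) : SobolevH n d :=
  if h : MemSobolev n (u t) then ⟨u t, h⟩ else 0

theorem liftSobolev_coe {u : ℝ → ℝ → E d} {t : ℝ} (h : MemSobolev n (u t)) :
    (liftSobolev n u t).1 = u t := by
  have e : liftSobolev n u t = ⟨u t, h⟩ := dif_pos h
  rw [e]

/-- A smooth path is a `C¹`-path in the Sobolev space with the same velocity. -/
theorem IsSmoothPath.hasDerivWithinAt_lift (n : ℕ) {c₀ c₁ : ℝ → E d} {γ : ℝ → ℝ → E d}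
    (hγ : IsSmoothPath c₀ c₁ γ) {t : ℝ} (ht : t ∈ Icc (0 : ℝ) 1) :
    HasDerivWithinAt (liftSobolev n γ) (liftSobolev n (velocity γ) t) (Icc 0 1) t := by
  have hA := hγ.contDiffOn_strip
  set A := Function.uncurry γ with hAdef
  rw [hasDerivWithinAt_iff_isLittleO, Asymptotics.isLittleO_iff]
  intro ε hε
  obtain ⟨δ₀, hδ₀, h0⟩ := exists_uniform_taylor hA (ε := ε / 4) (by positivity)
  obtain ⟨δ₁, hδ₁, h1⟩ := exists_uniform_taylor (contDiffOn_iterate_partialParam hA n)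
    (ε := ε / 4) (by positivity)
  have hball : ∀ᶠ s in nhdsWithin t (Icc 0 1), |s - t| < min δ₀ δ₁ :=
    nhdsWithin_le_nhds (by
      have := Metric.ball_mem_nhds t (lt_min hδ₀ hδ₁)
      filter_upwards [this] with s hs
      rwa [Metric.mem_ball, Real.dist_eq] at hs)
  filter_upwards [hball, self_mem_nhdsWithin] with s hs hsI
  have e1 := liftSobolev_coe (hγ.memSobolev n hsI)
  have e2 := liftSobolev_coe (hγ.memSobolev n ht)
  have e3 := liftSobolev_coe (hγ.memSobolev_velocity n ht)
  have c1 : ContDiff ℝ n (γ s) := (hγ.mem s hsI).2.1.of_le (by exact_mod_cast le_top)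
  have c2 : ContDiff ℝ n (γ t) := (hγ.mem t ht).2.1.of_le (by exact_mod_cast le_top)
  have c3 : ContDiff ℝ n (velocity γ t) := by
    rw [velocity_eq hγ ht]
    exact (contDiff_param (contDiffOn_partialTime hA) ht).of_le (by exact_mod_cast le_top)
  have e : (liftSobolev n γ s - liftSobolev n γ t - (s - t) • liftSobolev n (velocity γ) t :
      SobolevH n d).1 = γ s - γ t - (s - t) • velocity γ t := by
    rw [← e1, ← e2, ← e3]; rfl
  have hx : ‖s - t‖ = |s - t| := Real.norm_eq_abs _
  have key := SobolevH.norm_le_of_forall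
    (liftSobolev n γ s - liftSobolev n γ t - (s - t) • liftSobolev n (velocity γ) t)
    (ε := ε / 4 * |s - t|)
    (fun θ hθ => by
      rw [e, velocity_eq hγ ht]
      exact h0 s hsI t ht (hs.trans_le (min_le_left _ _)) θ hθ)
    (fun θ hθ => by
      have i1 : iteratedDeriv n (γ s - γ t - (s - t) • velocity γ t) θ =
          iteratedDeriv n (γ s) θ - iteratedDeriv n (γ t) θ -
            (s - t) • iteratedDeriv n (velocity γ t) θ := by
        have c12 : ContDiff ℝ n (γ s - γ t) := c1.sub c2
        have c4 : ContDiff ℝ n ((s - t) • velocity γ t) := contDiff_const.smul c3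
        rw [iteratedDeriv_sub c12.contDiffAt c4.contDiffAt,
          iteratedDeriv_sub c1.contDiffAt c2.contDiffAt, iteratedDeriv_smul_eq]
        rfl
      rw [e, i1, velocity_eq hγ ht]
      have j1 := congrFun (iteratedDeriv_param hA hsI n) θ
      have j2 := congrFun (iteratedDeriv_param hA ht n) θ
      have j3 := congrFun (iteratedDeriv_param (contDiffOn_partialTime hA) ht n) θ
      have j4 := partialTime_iterate_partialParam hA n (x := (t, θ)) ⟨ht, mem_univ _⟩
      have j5 := h1 s hsI t ht (hs.trans_le (min_le_right _ _)) θ hθ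
      rw [j4, ← j1, ← j2, ← j3] at j5
      exact j5)
  rw [hx]
  linarith

theorem IsSmoothPath.continuousOn_lift_velocity (n : ℕ) {c₀ c₁ : ℝ → E d} {γ : ℝ → ℝ → E d}
    (hγ : IsSmoothPath c₀ c₁ γ) : ContinuousOn (liftSobolev n (velocity γ)) (Icc 0 1) := by
  have hV := contDiffOn_partialTime hγ.contDiffOn_strip
  rw [Metric.continuousOn_iff]
  intro t ht ε hε
  obtain ⟨δ₀, hδ₀, h0⟩ := exists_uniform_delta hV (ε := ε / 8) (by positivity)
  obtain ⟨δ₁, hδ₁, h1⟩ := exists_uniform_delta (contDiffOn_iterate_partialParam hV n)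
    (ε := ε / 8) (by positivity)
  refine ⟨min δ₀ δ₁, lt_min hδ₀ hδ₁, fun s hs hst => ?_⟩
  rw [Real.dist_eq] at hst
  have e1 := liftSobolev_coe (hγ.memSobolev_velocity n hs)
  have e2 := liftSobolev_coe (hγ.memSobolev_velocity n ht)
  have c0 : ∀ r ∈ Icc (0 : ℝ) 1, ContDiff ℝ n (velocity γ r) := fun r hr => by
    rw [velocity_eq hγ hr]
    exact (contDiff_param hV hr).of_le (by exact_mod_cast le_top)
  have e : (liftSobolev n (velocity γ) s - liftSobolev n (velocity γ) t : SobolevH n d).1 =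
      velocity γ s - velocity γ t := by
    rw [← e1, ← e2]; rfl
  have key := SobolevH.norm_le_of_forall
    (liftSobolev n (velocity γ) s - liftSobolev n (velocity γ) t) (ε := ε / 8)
    (fun θ hθ => by
      rw [e, velocity_eq hγ ht, velocity_eq hγ hs]
      exact (h0 s hs t ht (hst.trans_le (min_le_left _ _)) θ hθ).le)
    (fun θ hθ => by
      rw [e, iteratedDeriv_sub (c0 s hs).contDiffAt (c0 t ht).contDiffAt, velocity_eq hγ ht,
        velocity_eq hγ hs, iteratedDeriv_param hV ht, iteratedDeriv_param hV hs]
      exact (h1 s hs t ht (hst.trans_le (min_le_right _ _)) θ hθ).le)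
  rw [dist_eq_norm]
  linarith

theorem IsSmoothPath.isPath_lift (n : ℕ) {c₀ c₁ : ℝ → E d} {γ : ℝ → ℝ → E d}
    (hγ : IsSmoothPath c₀ c₁ γ) :
    IsPath (liftSobolev n γ 0) (liftSobolev n γ 1) (liftSobolev n γ) := by
  have hd : ∀ t ∈ Icc (0 : ℝ) 1,
      derivWithin (liftSobolev n γ) (Icc 0 1) t = liftSobolev n (velocity γ) t := fun t ht =>
    (hγ.hasDerivWithinAt_lift n ht).derivWithin (uniqueDiffOn_Icc zero_lt_one t ht)
  refine ⟨?_, fun t ht θ => ?_, rfl, rfl⟩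
  · rw [show (1 : ℕ∞ω) = 0 + 1 by rfl,
      contDiffOn_succ_iff_derivWithin (uniqueDiffOn_Icc zero_lt_one)]
    refine ⟨fun t ht => (hγ.hasDerivWithinAt_lift n ht).differentiableWithinAt, by simp, ?_⟩
    rw [contDiffOn_zero]
    exact (hγ.continuousOn_lift_velocity n).congr hd
  · rw [liftSobolev_coe (hγ.memSobolev n ht)]
    exact (hγ.mem t ht).2.2 θ

theorem IsSmoothPath.pathLen_lift (n : ℕ) {c₀ c₁ : ℝ → E d} {γ : ℝ → ℝ → E d}
    (hγ : IsSmoothPath c₀ c₁ γ) : pathLen n a (liftSobolev n γ) = smoothPathLen n a γ := by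
  refine setLIntegral_congr_fun measurableSet_Icc fun t ht => ?_
  rw [(hγ.hasDerivWithinAt_lift n ht).derivWithin (uniqueDiffOn_Icc zero_lt_one t ht),
    liftSobolev_coe (hγ.memSobolev n ht), liftSobolev_coe (hγ.memSobolev_velocity n ht)]

/-- Geodesic balls of smooth immersions lie in those of Sobolev immersions, since there are more
paths in the latter space. -/
theorem mem_geoBall_of_mem_smoothGeoBall (n : ℕ) {c₀ c : ℝ → E d} {R : ℝ}
    (h0 : MemSobolev n c₀) (hc : MemSobolev n c) (h : c ∈ smoothGeoBall n a c₀ R) :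
    (⟨c, hc⟩ : SobolevH n d) ∈ geoBall n a (⟨c₀, h0⟩ : SobolevH n d) R := by
  obtain ⟨hcI, hlt⟩ := h
  obtain ⟨γ, hγ⟩ := iInf_lt_iff.1 hlt
  obtain ⟨hp, hγ⟩ := iInf_lt_iff.1 hγ
  refine ⟨hcI.2.2, lt_of_le_of_lt (iInf₂_le_of_le (liftSobolev n γ) ?_ le_rfl)
    (by rwa [hp.pathLen_lift])⟩
  have e0 : liftSobolev n γ 0 = ⟨c₀, h0⟩ := Subtype.ext
    ((liftSobolev_coe (hp.memSobolev n ⟨le_rfl, zero_le_one⟩)).trans hp.source)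
  have e1 : liftSobolev n γ 1 = ⟨c, hc⟩ := Subtype.ext
    ((liftSobolev_coe (hp.memSobolev n ⟨zero_le_one, le_rfl⟩)).trans hp.target)
  have := hp.isPath_lift n
  rwa [e0, e1] at this

theorem propertyH_of_propertyHSobolev (h : PropertyHSobolev n d a) : PropertyH n d a := by
  intro c₀ hc₀ R hR
  have h0 : MemSobolev n c₀ := memSobolev_of_contDiff n hc₀.1 hc₀.2.1
  obtain ⟨C, hC, hb⟩ := h ⟨c₀, h0⟩ hc₀.2.2 R hR
  refine ⟨C, hC, fun c hc k hk => ?_⟩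
  have hcS : MemSobolev n c := memSobolev_of_contDiff n hc.1.1 hc.1.2.1
  exact hb ⟨c, hcS⟩ (mem_geoBall_of_mem_smoothGeoBall n h0 hcS hc) ⟨k, hk⟩

end SmoothPaths

end SobolevCurves

theorem mainTheorem2 (n d : ℕ) (hn : 2 ≤ n) (hd : 1 ≤ d) (a : ℕ → ℝ → ℝ)
    (ha : SobolevCurves.IsLengthWeight n a)
    (h_zero : SobolevCurves.CondZero n a) (h_infty : SobolevCurves.CondInfty n a) :
    SobolevCurves.PropertyH n d a ∧ SobolevCurves.PropertyHSobolev n d a ∧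
    ∀ c₀ ∈ SobolevCurves.sobolevImm n d, ∀ R : ℝ, 0 < R → ∃ C : ℝ, 0 < C ∧
      ∀ c ∈ SobolevCurves.geoBall n a c₀ R, ∀ h : SobolevCurves.SobolevH n d,
        C⁻¹ * ‖h‖ ≤ Real.sqrt (SobolevCurves.G n a c h h) ∧
        Real.sqrt (SobolevCurves.G n a c h h) ≤ C * ‖h‖ := by
  have h := SobolevCurves.propertyHSobolev (d := d) hn ha h_zero h_infty
  exact ⟨SobolevCurves.propertyH_of_propertyHSobolev h, h, fun c₀ hc₀ R hR =>
    SobolevCurves.exists_norm_equiv hn ha h_zero h_infty hc₀ hR⟩
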